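/- Let $\mathcal D\subset\mathbb R^d$ be open and let $K$ be a kernel on $\mathcal D\times\mathcal D$ such that $$K(x,y)=Q_0(x,y)+\sum_{n\ge 1}Q_n(x,y)\qquad (x,y\in\mathcal D,\ x\ne y),$$ with the convention $K(x,x)=+\infty$. A kernel $Q$ on $\mathcal D\times\mathcal D$ is called positive definite if $\int_{\mathcal D^2}Q(x,y)g(x)g(y)\,dx\,dy\ge 0$ for every continuous $g$ with compact support in $\mathcal D$. Assume that $Q_0$ is Hölder continuous and positive definite, and that there is a constant $C$ such that for every $n\ge 1$ the function $Q_n$ is continuous, positive definite and satisfies, for all $x,x',y,y'\in\mathcal D$, $$Q_n(x,y)\ge 0,\qquad Q_n(x,x)=1,\qquad Q_n(x,y)=0\ \text{ if } |x-y|\ge e^{-n},\qquad |Q_n(x,y)-Q_n(x',y')|\le Ce^{n}\left(|x-x'|+|y-y'|\right).$$ Let $X=(\langle X,\mu\rangle)_\mu$ be a centered Gaussian process with covariance $\mathbb E[\langle X,\mu\rangle\langle X,\mu'\rangle]=\int K(x,y)\,\mu(dx)\,\mu'(dy)$, indexed by the differences $\mu=\mu_+-\mu_-$ of positive Borel measures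 which are carried by compact subsets of $\mathcal D$ and satisfy $\int|K(x,y)|\,\mu_\pm(dx)\,\mu_\pm(dy)<\infty$. Let $\varrho$ be a bounded measurable function on $\mathcal D$ and let $f$ be a continuous real-valued function with compact support in $\mathcal D$. A smoothing kernel is a non-negative $C^\infty$ function $\theta$ on $\mathbb R^d$, supported in the unit ball, with $\int\theta=1$. For $\varepsilon\in(0,1]$ set $\theta_\varepsilon(x)=\varepsilon^{-d}\theta(x/\varepsilon)$ and $\mathcal D_\varepsilon=\{x\in\mathcal D:\ |x-y|>2\varepsilon\ \text{for all } y\notin\mathcal D\}$. Let $X_\varepsilon(x)=\langle X,\theta_\varepsilon(x-y)\,dy\rangle$, $x\in\mathcal D_\varepsilon$, taken in a version which is almost surely jointly continuous in $(\varepsilon,x)$. Let $K_\varepsilon(x)=\mathbb E[X_\varepsilon(x)^2]=\iint\theta_\varepsilon(x-z_1)\theta_\varepsilon(x-z_2)K(z_1,z_2)\,dz_1\,dz_2$, and for $\gamma\in\mathbb C$ let $$M^{(\gamma)}_\varepsilon(f)=\int_{\mathcal D_\varepsilon}e^{\gamma X_\varepsilon(x)-\frac{\gamma^2}{2}K_\varepsilon(x)}f(x)\varrho(x)\,dx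 .$$ Suppose that $\gamma=\alpha+i\beta$ with $$(\alpha,\beta)\in\mathcal P_{\mathrm{sub}}=\{\alpha^2+\beta^2<d\}\cup\{|\alpha|\in(\sqrt{d/2},\sqrt{2d})\ \text{and}\ |\beta|<\sqrt{2d}-|\alpha|\}.$$ Then there is an integrable complex random variable $M^{(\gamma)}_0(f)$, not depending on $\theta$, such that for every smoothing kernel $\theta$ the variables $M^{(\gamma)}_\varepsilon(f)$, $\varepsilon\in(0,1]$, are integrable and $M^{(\gamma)}_\varepsilon(f)\to M^{(\gamma)}_0(f)$ in probability and in $L^1$ as $\varepsilon\to0$. -/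

import Mathlib

open MeasureTheory ProbabilityTheory Filter Set
open scoped Topology ENNReal NNReal

/-- Positive definiteness of a kernel `Q` on `D × D`: `∫∫ Q(x,y) f(x) f(y) dx dy ≥ 0` for every
continuous `f` with compact support in `D`. -/
def IsPosDefKernel {d : ℕ} (D : Set (EuclideanSpace ℝ (Fin d)))
    (Q : EuclideanSpace ℝ (Fin d) → EuclideanSpace ℝ (Fin d) → ℝ) : Prop :=
  ∀ f : EuclideanSpace ℝ (Fin d) → ℝ, Continuous f → HasCompactSupport f → tsupport f ⊆ D →
    0 ≤ ∫ x in D, ∫ y in D, Q x y * f x * f y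

/-- `K = Q₀ + ∑_{n ≥ 1} Qₙ` on `D × D`, off the diagonal, with `Q₀` Hölder continuous and positive
definite and `Qₙ`, `n ≥ 1`, satisfying the conditions below.  On the diagonal the series diverges,
so the (real) value given to `K` there carries no information. -/
structure HasNiceDecomposition {d : ℕ} (D : Set (EuclideanSpace ℝ (Fin d)))
    (K : EuclideanSpace ℝ (Fin d) → EuclideanSpace ℝ (Fin d) → ℝ)
    (Q : ℕ → EuclideanSpace ℝ (Fin d) → EuclideanSpace ℝ (Fin d) → ℝ) : Prop where
  hasSum : ∀ x ∈ D, ∀ y ∈ D, x ≠ y → HasSum (fun n : ℕ => Q n x y) (K x y)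
  zero_posDef : IsPosDefKernel D (Q 0)
  zero_holder : ∃ C r : ℝ≥0, 0 < r ∧ HolderOnWith C r (Function.uncurry (Q 0)) (D ×ˢ D)
  posDef : ∀ n, 1 ≤ n → IsPosDefKernel D (Q n)
  continuousOn : ∀ n, 1 ≤ n → ContinuousOn (Function.uncurry (Q n)) (D ×ˢ D)
  nonneg : ∀ n, 1 ≤ n → ∀ x ∈ D, ∀ y ∈ D, 0 ≤ Q n x y
  diag : ∀ n, 1 ≤ n → ∀ x ∈ D, Q n x x = 1
  finite_range : ∀ n : ℕ, 1 ≤ n → ∀ x ∈ D, ∀ y ∈ D, Real.exp (-(n : ℝ)) ≤ dist x y → Q n x y = 0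
  lipschitz : ∃ C : ℝ, ∀ n : ℕ, 1 ≤ n → ∀ x ∈ D, ∀ x' ∈ D, ∀ y ∈ D, ∀ y' ∈ D,
    |Q n x y - Q n x' y'| ≤ C * Real.exp n * (dist x x' + dist y y')

open Classical in
/-- `|K(x,y)|`, with the convention `K(x,x) = +∞`. -/
noncomputable def kernelAbs {d : ℕ}
    (K : EuclideanSpace ℝ (Fin d) → EuclideanSpace ℝ (Fin d) → ℝ)
    (x y : EuclideanSpace ℝ (Fin d)) : ℝ≥0∞ :=
  if x = y then ∞ else ENNReal.ofReal |K x y|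

/-- Positive Borel measures, carried by a compact subset of `D`, of finite energy
`∫∫ |K(x,y)| μ(dx) μ(dy) < ∞`. -/
def IsFiniteEnergy {d : ℕ} (D : Set (EuclideanSpace ℝ (Fin d)))
    (K : EuclideanSpace ℝ (Fin d) → EuclideanSpace ℝ (Fin d) → ℝ)
    (μ : Measure (EuclideanSpace ℝ (Fin d))) : Prop :=
  (∃ S : Set (EuclideanSpace ℝ (Fin d)), IsCompact S ∧ S ⊆ D ∧ μ Sᶜ = 0) ∧
    ∫⁻ x, ∫⁻ y, kernelAbs K x y ∂μ ∂μ < ∞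

/-- The signed measures indexing the field: differences of two measures of finite energy.  The
restriction to compactly supported measures (all that is needed to mollify the field inside `D`)
guarantees that `∫∫ |K(x,y)| μ(dx) μ'(dy) < ∞` also for two different measures, and it only weakens
the assumption that is made on the field. -/
def energySpace {d : ℕ} (D : Set (EuclideanSpace ℝ (Fin d)))
    (K : EuclideanSpace ℝ (Fin d) → EuclideanSpace ℝ (Fin d) → ℝ) :
    Set (SignedMeasure (EuclideanSpace ℝ (Fin d))) :=
  {σ | ∃ (μ ν : Measure (EuclideanSpace ℝ (Fin d))) (_ : IsFiniteMeasure μ)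
      (_ : IsFiniteMeasure ν), IsFiniteEnergy D K μ ∧ IsFiniteEnergy D K ν ∧
        σ = μ.toSignedMeasure - ν.toSignedMeasure}

/-- The bilinear form `∫∫ K(x,y) σ(dx) τ(dy)` on signed measures. -/
noncomputable def kernelForm {d : ℕ}
    (K : EuclideanSpace ℝ (Fin d) → EuclideanSpace ℝ (Fin d) → ℝ)
    (σ τ : SignedMeasure (EuclideanSpace ℝ (Fin d))) : ℝ :=
  ∫ᵛ x, (∫ᵛ y, K x y ∂<•τ) ∂<•σ

/-- `X = (⟨X, σ⟩)_σ` is a centered Gaussian process indexed by `energySpace D K` whose covariance is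
`E[⟨X, σ⟩⟨X, τ⟩] = ∫∫ K(x,y) σ(dx) τ(dy)`. -/
structure IsGaussianFieldWithKernel {d : ℕ} {Ω : Type*} [MeasurableSpace Ω] (P : Measure Ω)
    (D : Set (EuclideanSpace ℝ (Fin d)))
    (K : EuclideanSpace ℝ (Fin d) → EuclideanSpace ℝ (Fin d) → ℝ)
    (X : SignedMeasure (EuclideanSpace ℝ (Fin d)) → Ω → ℝ) : Prop where
  gaussian : IsGaussianProcess (fun σ : energySpace D K => X σ) P
  centered : ∀ σ ∈ energySpace D K, ∫ ω, X σ ω ∂P = 0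
  covariance : ∀ σ ∈ energySpace D K, ∀ τ ∈ energySpace D K,
    ∫ ω, X σ ω * X τ ω ∂P = kernelForm K σ τ

/-- Smoothing kernels: non-negative, `C^∞`, supported in the unit ball, of integral one. -/
structure IsSmoothingKernel {d : ℕ} (θ : EuclideanSpace ℝ (Fin d) → ℝ) : Prop where
  smooth : ContDiff ℝ ((⊤ : ℕ∞) : WithTop ℕ∞) θ
  nonneg : ∀ x, 0 ≤ θ x
  support : tsupport θ ⊆ Metric.closedBall 0 1
  integral_eq_one : ∫ x, θ x = 1

/-- `θ_ε(x) = ε^{-d} θ(x / ε)`. -/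
noncomputable def scaledKernel {d : ℕ} (θ : EuclideanSpace ℝ (Fin d) → ℝ) (ε : ℝ)
    (x : EuclideanSpace ℝ (Fin d)) : ℝ :=
  (ε ^ d)⁻¹ * θ (ε⁻¹ • x)

/-- `D_ε`: the points of `D` at distance more than `2ε` from the complement of `D`
(everything, if `D` is the whole space). -/
def shrunkDomain {d : ℕ} (D : Set (EuclideanSpace ℝ (Fin d))) (ε : ℝ) :
    Set (EuclideanSpace ℝ (Fin d)) :=
  {x | x ∈ D ∧ ∀ y, y ∉ D → 2 * ε < dist x y}

/-- `Xε` is a version of the mollified field `X_ε(x) = ⟨X, θ_ε(x - y) dy⟩`, for `ε ∈ (0,1]` and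
`x ∈ D_ε`, that is almost surely jointly continuous in `(ε, x)`. -/
structure IsMollifiedField {d : ℕ} {Ω : Type*} [MeasurableSpace Ω] (P : Measure Ω)
    (D : Set (EuclideanSpace ℝ (Fin d)))
    (X : SignedMeasure (EuclideanSpace ℝ (Fin d)) → Ω → ℝ)
    (θ : EuclideanSpace ℝ (Fin d) → ℝ)
    (Xε : ℝ → EuclideanSpace ℝ (Fin d) → Ω → ℝ) : Prop where
  version : ∀ ε ∈ Ioc (0 : ℝ) 1, ∀ x ∈ shrunkDomain D ε,
    Xε ε x =ᵐ[P] X (volume.withDensityᵥ fun y => scaledKernel θ ε (x - y))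
  continuous : ∀ᵐ ω ∂P, ContinuousOn
    (fun p : ℝ × EuclideanSpace ℝ (Fin d) => Xε p.1 p.2 ω)
    {p | p.1 ∈ Ioc (0 : ℝ) 1 ∧ p.2 ∈ shrunkDomain D p.1}

/-- `K_ε(x) = E[X_ε(x)²] = ∫∫ θ_ε(x - z₁) θ_ε(x - z₂) K(z₁, z₂) dz₁ dz₂`. -/
noncomputable def mollifiedVariance {d : ℕ}
    (K : EuclideanSpace ℝ (Fin d) → EuclideanSpace ℝ (Fin d) → ℝ)
    (θ : EuclideanSpace ℝ (Fin d) → ℝ) (ε : ℝ) (x : EuclideanSpace ℝ (Fin d)) : ℝ :=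
  ∫ z₁, ∫ z₂, scaledKernel θ ε (x - z₁) * scaledKernel θ ε (x - z₂) * K z₁ z₂

/-- The mollified complex chaos
`M_ε^{(γ)}(f) = ∫_{D_ε} exp(γ X_ε(x) - (γ²/2) K_ε(x)) f(x) ϱ(x) dx`. -/
noncomputable def complexChaos {d : ℕ} {Ω : Type*} (D : Set (EuclideanSpace ℝ (Fin d)))
    (K : EuclideanSpace ℝ (Fin d) → EuclideanSpace ℝ (Fin d) → ℝ)
    (θ : EuclideanSpace ℝ (Fin d) → ℝ)
    (Xε : ℝ → EuclideanSpace ℝ (Fin d) → Ω → ℝ)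
    (ϱ f : EuclideanSpace ℝ (Fin d) → ℝ) (γ : ℂ) (ε : ℝ) (ω : Ω) : ℂ :=
  ∫ x in shrunkDomain D ε,
    Complex.exp (γ * (Xε ε x ω : ℂ) - γ ^ 2 / 2 * (mollifiedVariance K θ ε x : ℂ))
      * (f x : ℂ) * (ϱ x : ℂ)

/-- The subcritical region of parameters `(α, β)` in dimension `d`. -/
def subcriticalRegion (d : ℕ) : Set (ℝ × ℝ) :=
  {p | p.1 ^ 2 + p.2 ^ 2 < d} ∪
    {p | |p.1| ∈ Ioo (Real.sqrt (d / 2)) (Real.sqrt (2 * d)) ∧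
      |p.2| < Real.sqrt (2 * d) - |p.1|}

/-!
The limit exists because the mollified chaoses form a Cauchy family in `L¹`, uniformly over the
scales and over the smoothing kernels bounded by a common constant
(`HasNiceDecomposition.exists_integral_norm_complexChaos_sub_le`).  Comparing two different
smoothing kernels in the same way shows that the limit does not depend on the kernel, and
convergence in `L¹` gives convergence in probability.

At fixed scales both chaoses are `L¹` limits of Riemann sums `∑ᵢ wᵢ exp (γ Xᵢ - γ² Var(Xᵢ) / 2)`,
where `X` is a finite centered Gaussian vector, so that everything reduces to bounds on such sums
(`chaosSum`) that are uniform in the mesh.  The covariance of `X` is the sum over `k` of the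
matrices obtained by integrating `Q k` against the mollifiers.  They are positive semidefinite, so
in law `X` is a sum of independent vectors, one for each level; all levels beyond `log (1 / ε)` are
lumped into a single one, of bounded size and of range of order `ε`
(`HasNiceDecomposition.exists_tail_bound`).

The heart of the argument is the effect of adding one level
(`integral_norm_chaosSum_add_sub_le`).  Given the previous levels, the increment is a sum of
centered variables which are uncorrelated as soon as the distance of the points exceeds a constant
times `exp (-k)`.  Its conditional second moment is therefore at most a constant times the sum,
over the cells of a grid of side comparable to `exp (-k)`, of the squares of the masses given to the
cells by the modulus of the current chaos.  For `1 ≤ p ≤ 2` the `ℓ²` norm is at most the `ℓᵖ` norm, and Hölder's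
inequality inside each cell followed by Jensen's inequality bounds the mean of the increment by a
constant times `exp (-c k)` with `c = (d (p - 1) - p ((p - 1) α² + β²) / 2) / p`.  The subcritical
region is exactly the set of parameters for which some such `p` makes `c` positive
(`exists_exponent_of_mem_subcriticalRegion` proves the direction that is needed).

Summing over the levels, each Riemann sum is close to its conditional expectation given the first
`n` levels, uniformly in the scale and the mesh.  For fixed `n` this conditional expectation is a
regular functional of a field with a uniformly continuous covariance, so that two mollifications at
small scales are close to each other (`HasNiceDecomposition.exists_chaosSum_sub_le`).
-/

/-! ### Centered Gaussian vectors -/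

/-- `G` is a centered Gaussian vector with covariance matrix `C` under `P`, expressed through its
complex exponential moments: `E[exp (∑ᵢ cᵢ Gᵢ)] = exp (½ ∑ᵢⱼ cᵢ cⱼ Cᵢⱼ)` for all complex `c`. -/
structure IsCenteredGaussianVec {ι Ω : Type*} [Fintype ι] [MeasurableSpace Ω] (P : Measure Ω)
    (C : ι → ι → ℝ) (G : Ω → ι → ℝ) : Prop where
  aemeasurable : AEMeasurable G P
  integrable_cexp : ∀ c : ι → ℂ, Integrable (fun ω => Complex.exp (∑ i, c i * (G ω i : ℂ))) P
  integral_cexp : ∀ c : ι → ℂ, ∫ ω, Complex.exp (∑ i, c i * (G ω i : ℂ)) ∂P =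
    Complex.exp ((∑ i, ∑ j, c i * c j * (C i j : ℂ)) / 2)

theorem integrable_cexp_mul_gaussianReal (z : ℂ) :
    Integrable (fun x : ℝ => Complex.exp (z * x)) (gaussianReal 0 1) := by
  rw [← integrable_norm_iff (by fun_prop)]
  simp only [Complex.norm_exp, Complex.mul_re, Complex.ofReal_re, Complex.ofReal_im, mul_zero,
    sub_zero]
  exact integrable_exp_mul_gaussianReal z.re

theorem integral_cexp_mul_gaussianReal (z : ℂ) :
    ∫ x : ℝ, Complex.exp (z * x) ∂(gaussianReal 0 1) = Complex.exp (z ^ 2 / 2) := by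
  have := complexMGF_id_gaussianReal (μ := 0) (v := 1) z
  simpa [complexMGF] using this

theorem IsCenteredGaussianVec.of_map_eq {ι Ω Ω' : Type*} [Fintype ι] [MeasurableSpace Ω]
    [MeasurableSpace Ω'] {P : Measure Ω} {P' : Measure Ω'} {C : ι → ι → ℝ} {G : Ω → ι → ℝ}
    {G' : Ω' → ι → ℝ} (h : IsCenteredGaussianVec P C G) (hG' : AEMeasurable G' P')
    (hmap : P.map G = P'.map G') : IsCenteredGaussianVec P' C G' := by
  have hm : ∀ c : ι → ℂ, Continuous fun x : ι → ℝ => Complex.exp (∑ i, c i * (x i : ℂ)) := by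
    intro c; fun_prop
  refine ⟨hG', fun c => ?_, fun c => ?_⟩
  · have h1 := h.integrable_cexp c
    have h2 := (integrable_map_measure (hm c).aestronglyMeasurable h.aemeasurable).2 h1
    rw [hmap] at h2
    exact (integrable_map_measure (hm c).aestronglyMeasurable hG').1 h2
  · rw [← h.integral_cexp c,
      ← integral_map (f := fun x : ι → ℝ => Complex.exp (∑ i, c i * (x i : ℂ)))
        h.aemeasurable (hm c).aestronglyMeasurable, hmap,
      integral_map hG' (hm c).aestronglyMeasurable]

theorem IsCenteredGaussianVec.isProbabilityMeasure {ι Ω : Type*} [Fintype ι] [MeasurableSpace Ω]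
    {P : Measure Ω} {C : ι → ι → ℝ} {G : Ω → ι → ℝ} (h : IsCenteredGaussianVec P C G) :
    IsProbabilityMeasure P := by
  have h1 := h.integral_cexp 0
  simp only [Pi.zero_apply, zero_mul, Finset.sum_const_zero, Complex.exp_zero, zero_div,
    integral_const] at h1
  constructor
  have : P.real univ = 1 := by simpa using h1
  rw [Measure.real, ENNReal.toReal_eq_one_iff] at this
  exact this

open scoped MatrixOrder Matrix.Norms.L2Operator in
/-- The standard Gaussian vector multiplied by a matrix `B` with `Bᵀ B = C` has covariance `C`. -/
theorem exists_isCenteredGaussianVec {ι : Type*} [Fintype ι] {C : ι → ι → ℝ}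
    (hC : (Matrix.of C).PosSemidef) :
    ∃ μ : Measure (ι → ℝ), IsCenteredGaussianVec μ C id := by
  classical
  obtain ⟨B, hB⟩ := CStarAlgebra.nonneg_iff_eq_star_mul_self.1 hC.nonneg
  have hCB : ∀ i j, C i j = ∑ k, B k i * B k j := by
    intro i j
    have := congrFun (congrFun hB i) j
    simpa [Matrix.mul_apply, Matrix.star_eq_conjTranspose] using this
  set Z : Measure (ι → ℝ) := Measure.pi fun _ => gaussianReal 0 1 with hZ
  let G : (ι → ℝ) → ι → ℝ := fun z i => ∑ k, B k i * z k
  have hG : Measurable G := by fun_prop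
  have hrew : ∀ c : ι → ℂ, ∀ z : ι → ℝ, Complex.exp (∑ i, c i * (G z i : ℂ)) =
      ∏ k, Complex.exp ((∑ i, c i * (B k i : ℂ)) * (z k : ℂ)) := by
    intro c z
    rw [← Complex.exp_sum]
    congr 1
    simp only [G, Complex.ofReal_sum, Complex.ofReal_mul, Finset.mul_sum, Finset.sum_mul]
    rw [Finset.sum_comm]
    simp only [mul_assoc]
  have key : IsCenteredGaussianVec Z C G := by
    refine ⟨hG.aemeasurable, fun c => ?_, fun c => ?_⟩
    · simp only [hrew]
      exact Integrable.fintype_prod (f := fun k (x : ℝ) => Complex.exp ((∑ i, c i * (B k i : ℂ)) * x))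
        fun k => integrable_cexp_mul_gaussianReal _
    · simp only [hrew]
      rw [hZ, integral_fintype_prod_eq_prod
        (f := fun k (x : ℝ) => Complex.exp ((∑ i, c i * (B k i : ℂ)) * x))]
      simp only [integral_cexp_mul_gaussianReal]
      rw [← Complex.exp_sum]
      congr 1
      rw [← Finset.sum_div]
      congr 1
      simp only [hCB, Complex.ofReal_sum, Complex.ofReal_mul, Finset.mul_sum, sq, Finset.sum_mul]
      rw [Finset.sum_comm]
      refine Finset.sum_congr rfl fun i _ => ?_
      rw [Finset.sum_comm]
      refine Finset.sum_congr rfl fun j _ => Finset.sum_congr rfl fun k _ => ?_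
      ring
  refine ⟨Z.map G, key.of_map_eq aemeasurable_id ?_⟩
  simp

theorem strongDual_pi_apply {ι : Type*} [Fintype ι] [DecidableEq ι] (L : StrongDual ℝ (ι → ℝ))
    (x : ι → ℝ) : L x = ∑ i, L (Pi.single i 1) * x i := by
  conv_lhs => rw [pi_eq_sum_univ' x]
  rw [map_sum]
  refine Finset.sum_congr rfl fun i _ => ?_
  rw [map_smul, smul_eq_mul, mul_comm]

theorem IsCenteredGaussianVec.charFunDual_map {ι Ω : Type*} [Fintype ι] [MeasurableSpace Ω]
    {P : Measure Ω} {C : ι → ι → ℝ} {G : Ω → ι → ℝ} (h : IsCenteredGaussianVec P C G)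
    [DecidableEq ι] (L : StrongDual ℝ (ι → ℝ)) :
    charFunDual (P.map G) L =
      Complex.exp (-(∑ i, ∑ j, L (Pi.single i 1) * L (Pi.single j 1) * C i j : ℝ) / 2) := by
  have hL := strongDual_pi_apply L
  rw [charFunDual_apply, integral_map h.aemeasurable (by fun_prop)]
  have := h.integral_cexp fun i => Complex.I * L (Pi.single i 1)
  convert this using 2
  · ext ω
    rw [hL]
    push_cast
    rw [Finset.sum_mul]
    congr 1
    exact Finset.sum_congr rfl fun i _ => by ring
  · push_cast
    rw [← Finset.sum_neg_distrib]
    congr 1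
    refine Finset.sum_congr rfl fun i _ => ?_
    rw [← Finset.sum_neg_distrib]
    refine Finset.sum_congr rfl fun j _ => ?_
    linear_combination (-(L (Pi.single i 1) * L (Pi.single j 1) * C i j : ℂ)) * Complex.I_sq

/-- The covariance matrix determines the law of a centered Gaussian vector. -/
theorem IsCenteredGaussianVec.map_eq {ι Ω Ω' : Type*} [Fintype ι] [MeasurableSpace Ω]
    [MeasurableSpace Ω'] {P : Measure Ω} {P' : Measure Ω'} {C : ι → ι → ℝ} {G : Ω → ι → ℝ}
    {G' : Ω' → ι → ℝ} (h : IsCenteredGaussianVec P C G) (h' : IsCenteredGaussianVec P' C G') :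
    P.map G = P'.map G' := by
  classical
  have := h.isProbabilityMeasure
  have := h'.isProbabilityMeasure
  have := Measure.isProbabilityMeasure_map h.aemeasurable
  have := Measure.isProbabilityMeasure_map h'.aemeasurable
  refine Measure.ext_of_charFunDual ?_
  ext L
  rw [h.charFunDual_map, h'.charFunDual_map]

theorem isCenteredGaussianVec_of_hasGaussianLaw {ι Ω : Type*} [Fintype ι] [MeasurableSpace Ω]
    {P : Measure Ω} [IsProbabilityMeasure P] {C : ι → ι → ℝ} {G : Ω → ι → ℝ}
    (hG : HasGaussianLaw G P) (hGm : AEMeasurable G P)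
    (hmean : ∀ i, ∫ ω, G ω i ∂P = 0) (hcov : ∀ i j, ∫ ω, G ω i * G ω j ∂P = C i j)
    (hC : (Matrix.of C).PosSemidef) : IsCenteredGaussianVec P C G := by
  classical
  obtain ⟨μ, hμ⟩ := exists_isCenteredGaussianVec hC
  have := hμ.isProbabilityMeasure
  refine hμ.of_map_eq hGm ?_
  have hmap := hG.isGaussian_map
  have := Measure.isProbabilityMeasure_map hμ.aemeasurable
  refine Measure.ext_of_charFunDual ?_
  ext L
  rw [hμ.charFunDual_map, IsGaussian.charFunDual_eq]
  obtain ⟨a, ha⟩ : ∃ a : ι → ℝ, ∀ i, L (Pi.single i 1) = a i := ⟨_, fun _ => rfl⟩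
  have hL : ∀ x : ι → ℝ, L x = ∑ i, a i * x i := by
    intro x; rw [strongDual_pi_apply L]; simp only [ha]
  simp only [ha]
  have hmem : ∀ i, MemLp (fun ω => G ω i) 2 P := by
    intro i
    have h1 := IsGaussian.memLp_dual (P.map G) (ContinuousLinearMap.proj (R := ℝ) i) 2 (by simp)
    exact (memLp_map_measure_iff (by fun_prop) hGm).1 h1
  have hint : ∀ i, Integrable (fun ω => G ω i) P := fun i => (hmem i).integrable (by simp)
  have hint2 : ∀ i j, Integrable (fun ω => G ω i * G ω j) P := fun i j =>
    (hmem i).integrable_mul (hmem j)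
  have h0 : (P.map G)[L] = 0 := by
    rw [integral_map hGm (by fun_prop)]
    simp only [hL]
    rw [integral_finsetSum _ fun i _ => (hint i).const_mul _]
    simp [integral_const_mul, hmean]
  have hV : Var[L; P.map G] = ∑ i, ∑ j, a i * a j * C i j := by
    rw [variance_of_integral_eq_zero (by fun_prop) h0, integral_map hGm (by fun_prop)]
    simp only [hL, sq, Finset.sum_mul_sum]
    rw [integral_finsetSum]
    · refine Finset.sum_congr rfl fun i _ => ?_
      rw [integral_finsetSum]
      · refine Finset.sum_congr rfl fun j _ => ?_
        rw [← hcov, ← integral_const_mul]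
        congr 1; ext ω; ring
      · intro j _
        have := (hint2 i j).const_mul (a i * a j)
        refine this.congr (ae_of_all _ fun ω => ?_)
        simp only; ring
    · intro i _
      refine integrable_finsetSum _ fun j _ => ?_
      have := (hint2 i j).const_mul (a i * a j)
      refine this.congr (ae_of_all _ fun ω => ?_)
      simp only; ring
  rw [integral_complex_ofReal, h0, hV]
  congr 1
  push_cast
  ring

/-- The sum of two independent centered Gaussian vectors. -/
theorem IsCenteredGaussianVec.add {ι Ω : Type*} [Fintype ι] [MeasurableSpace Ω]
    {P : Measure Ω} {C C' : ι → ι → ℝ} {S T : Ω → ι → ℝ} (hS : IsCenteredGaussianVec P C S)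
    (hT : IsCenteredGaussianVec P C' T) (hST : IndepFun S T P) :
    IsCenteredGaussianVec P (C + C') (S + T) := by
  have hm : ∀ c : ι → ℂ, Measurable fun x : ι → ℝ => Complex.exp (∑ i, c i * (x i : ℂ)) := by
    intro c; fun_prop
  have hrew : ∀ (c : ι → ℂ) ω, Complex.exp (∑ i, c i * ((S + T) ω i : ℂ)) =
      Complex.exp (∑ i, c i * (S ω i : ℂ)) * Complex.exp (∑ i, c i * (T ω i : ℂ)) := by
    intro c ω
    rw [← Complex.exp_add, ← Finset.sum_add_distrib]
    congr 1
    refine Finset.sum_congr rfl fun i _ => ?_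
    simp only [Pi.add_apply, Complex.ofReal_add]; ring
  have hind := fun c => hST.comp (hm c) (hm c)
  refine ⟨hS.aemeasurable.add hT.aemeasurable, fun c => ?_, fun c => ?_⟩
  · simp only [hrew]
    exact (hind c).integrable_mul (hS.integrable_cexp c) (hT.integrable_cexp c)
  · simp only [hrew]
    have := (hind c).integral_mul_eq_mul_integral (hS.integrable_cexp c).aestronglyMeasurable
      (hT.integrable_cexp c).aestronglyMeasurable
    refine this.trans ?_
    simp only [Function.comp_def]
    rw [hS.integral_cexp, hT.integral_cexp, ← Complex.exp_add]
    congr 1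
    rw [← add_div, ← Finset.sum_add_distrib]
    congr 1
    refine Finset.sum_congr rfl fun i _ => ?_
    rw [← Finset.sum_add_distrib]
    refine Finset.sum_congr rfl fun j _ => ?_
    simp only [Pi.add_apply, Complex.ofReal_add]; ring

/-- A reindexing (in particular a sub-vector) of a centered Gaussian vector. -/
theorem IsCenteredGaussianVec.comp {ι κ Ω : Type*} [Fintype ι] [Fintype κ] [MeasurableSpace Ω]
    {P : Measure Ω} {C : ι → ι → ℝ} {G : Ω → ι → ℝ} (h : IsCenteredGaussianVec P C G)
    (e : κ → ι) : IsCenteredGaussianVec P (fun i j => C (e i) (e j)) fun ω i => G ω (e i) := by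
  classical
  have hsum : ∀ (c : κ → ℂ) (x : ι → ℂ),
      ∑ i, c i * x (e i) = ∑ i, (∑ k with e k = i, c k) * x i := by
    intro c x
    simp only [Finset.sum_filter, Finset.sum_mul]
    rw [Finset.sum_comm]
    simp
  have hsumG : ∀ (c : κ → ℂ) ω, ∑ i, c i * (G ω (e i) : ℂ) =
      ∑ i, (∑ k with e k = i, c k) * (G ω i : ℂ) := fun c ω => hsum c fun i => (G ω i : ℂ)
  refine ⟨?_, fun c => ?_, fun c => ?_⟩
  · exact (measurable_pi_lambda _ fun i => measurable_pi_apply (e i)).comp_aemeasurable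
      h.aemeasurable
  · simp only [hsumG]
    exact h.integrable_cexp _
  · have := h.integral_cexp fun i => ∑ k with e k = i, c k
    simp only [← hsumG] at this
    rw [this]
    congr 2
    have h2 : ∀ i, ∑ j, c i * c j * (C (e i) (e j) : ℂ) =
        c i * ∑ l, (∑ k with e k = l, c k) * (C (e i) l : ℂ) := by
      intro i
      rw [← hsum c fun l => (C (e i) l : ℂ), Finset.mul_sum]
      exact Finset.sum_congr rfl fun j _ => by ring
    simp only [h2]
    rw [hsum c fun i => ∑ l, (∑ k with e k = l, c k) * (C i l : ℂ)]
    refine Finset.sum_congr rfl fun i _ => ?_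
    rw [Finset.mul_sum]
    exact Finset.sum_congr rfl fun j _ => by ring

/-- Exponential moment of a combination of two coordinates. -/
theorem IsCenteredGaussianVec.integral_cexp_two {ι Ω : Type*} [Fintype ι] [MeasurableSpace Ω]
    {P : Measure Ω} {C : ι → ι → ℝ} {G : Ω → ι → ℝ} (h : IsCenteredGaussianVec P C G)
    (i j : ι) (a b : ℂ) :
    Integrable (fun ω => Complex.exp (a * G ω i + b * G ω j)) P ∧
    ∫ ω, Complex.exp (a * G ω i + b * G ω j) ∂P =
      Complex.exp ((a ^ 2 * C i i + a * b * (C i j + C j i) + b ^ 2 * C j j) / 2) := by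
  have h2 := h.comp ![i, j]
  have h3 := h2.integrable_cexp ![a, b]
  have h4 := h2.integral_cexp ![a, b]
  simp only [Fin.sum_univ_two, Matrix.cons_val_zero, Matrix.cons_val_one] at h3 h4
  refine ⟨h3, h4.trans ?_⟩
  congr 1
  ring

/-- Exponential moment of a single coordinate. -/
theorem IsCenteredGaussianVec.integral_rexp_mul {ι Ω : Type*} [Fintype ι] [MeasurableSpace Ω]
    {P : Measure Ω} {C : ι → ι → ℝ} {G : Ω → ι → ℝ} (h : IsCenteredGaussianVec P C G)
    (i : ι) (a : ℝ) :
    Integrable (fun ω => Real.exp (a * G ω i)) P ∧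
    ∫ ω, Real.exp (a * G ω i) ∂P = Real.exp (a ^ 2 * C i i / 2) := by
  obtain ⟨h1, h2⟩ := h.integral_cexp_two i i a 0
  simp only [zero_mul, add_zero, mul_zero, ne_eq, OfNat.ofNat_ne_zero, not_false_eq_true, zero_pow]
    at h1 h2
  have hrew : ∀ ω, Complex.exp (a * G ω i) = ((Real.exp (a * G ω i) : ℝ) : ℂ) := by
    intro ω; push_cast; rfl
  simp only [hrew] at h1 h2
  rw [integral_complex_ofReal] at h2
  refine ⟨?_, ?_⟩
  · have := h1.re
    simp only [RCLike.re_to_complex, Complex.ofReal_re] at this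
    exact this
  have := congrArg Complex.re h2
  rw [Complex.ofReal_re] at this
  rw [this, show ((a : ℂ) ^ 2 * C i i / 2) = ((a ^ 2 * C i i / 2 : ℝ) : ℂ) by push_cast; ring,
    ← Complex.ofReal_exp, Complex.ofReal_re]

/-! ### Normalised exponentials and sums over cells -/

/-- The normalised exponential `exp (γ x - γ² v / 2)`, of mean one when `x` is a centered Gaussian
variable of variance `v`. -/
noncomputable def wickExp (γ : ℂ) (v x : ℝ) : ℂ := Complex.exp (γ * x - γ ^ 2 / 2 * v)

theorem wickExp_add (γ : ℂ) (v v' x x' : ℝ) :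
    wickExp γ (v + v') (x + x') = wickExp γ v x * wickExp γ v' x' := by
  rw [wickExp, wickExp, wickExp, ← Complex.exp_add]
  congr 1
  push_cast
  ring

theorem conj_wickExp (γ : ℂ) (v x : ℝ) :
    (starRingEnd ℂ) (wickExp γ v x) = wickExp ((starRingEnd ℂ) γ) v x := by
  rw [wickExp, wickExp, ← Complex.exp_conj]
  simp [map_ofNat]

theorem continuous_wickExp (γ : ℂ) (v : ℝ) : Continuous (wickExp γ v) := by
  unfold wickExp; fun_prop

theorem norm_wickExp (γ : ℂ) (v x : ℝ) :
    ‖wickExp γ v x‖ = Real.exp (γ.re * x - (γ.re ^ 2 - γ.im ^ 2) / 2 * v) := by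
  rw [wickExp, Complex.norm_exp]
  congr 1
  simp [sq]

section moments

variable {ι Ω : Type*} [Fintype ι] [MeasurableSpace Ω] {P : Measure Ω} {C : ι → ι → ℝ}
  {G : Ω → ι → ℝ}

theorem IsCenteredGaussianVec.wickExp_mul_conj (h : IsCenteredGaussianVec P C G)
    (hC : ∀ i j, C i j = C j i) (γ : ℂ) (i j : ι) :
    Integrable (fun ω => wickExp γ (C i i) (G ω i) *
      (starRingEnd ℂ) (wickExp γ (C j j) (G ω j))) P ∧
    ∫ ω, wickExp γ (C i i) (G ω i) * (starRingEnd ℂ) (wickExp γ (C j j) (G ω j)) ∂P =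
      (Real.exp (‖γ‖ ^ 2 * C i j) : ℝ) := by
  obtain ⟨h1, h2⟩ := h.integral_cexp_two i j γ ((starRingEnd ℂ) γ)
  have hrew : ∀ ω, wickExp γ (C i i) (G ω i) * (starRingEnd ℂ) (wickExp γ (C j j) (G ω j)) =
      Complex.exp (-(γ ^ 2 * C i i + ((starRingEnd ℂ) γ) ^ 2 * C j j) / 2) *
        Complex.exp (γ * G ω i + (starRingEnd ℂ) γ * G ω j) := by
    intro ω
    rw [conj_wickExp, wickExp, wickExp, ← Complex.exp_add, ← Complex.exp_add]
    congr 1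
    ring
  simp only [hrew]
  refine ⟨h1.const_mul _, ?_⟩
  rw [integral_const_mul, h2, ← Complex.exp_add, Complex.ofReal_exp]
  congr 1
  have hn : γ * (starRingEnd ℂ) γ = ((‖γ‖ ^ 2 : ℝ) : ℂ) := by
    rw [Complex.mul_conj, Complex.normSq_eq_norm_sq]
  rw [← hC i j]
  push_cast at hn ⊢
  linear_combination (C i j : ℂ) * hn

theorem IsCenteredGaussianVec.integrable_wickExp (h : IsCenteredGaussianVec P C G)
    (γ : ℂ) (v : ℝ) (i : ι) : Integrable (fun ω => wickExp γ v (G ω i)) P := by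
  obtain ⟨h1, -⟩ := h.integral_cexp_two i i γ 0
  refine (h1.mul_const (Complex.exp (-(γ ^ 2 / 2 * v)))).congr (ae_of_all _ fun ω => ?_)
  simp only [wickExp, ← Complex.exp_add]
  congr 1
  ring

theorem IsCenteredGaussianVec.integral_wickExp (h : IsCenteredGaussianVec P C G)
    (γ : ℂ) (i : ι) : ∫ ω, wickExp γ (C i i) (G ω i) ∂P = 1 := by
  obtain ⟨-, h2⟩ := h.integral_cexp_two i i γ 0
  have hrew : ∀ ω, wickExp γ (C i i) (G ω i) =
      Complex.exp (γ * G ω i + 0 * G ω i) * Complex.exp (-(γ ^ 2 / 2 * C i i)) := by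
    intro ω
    rw [wickExp, ← Complex.exp_add]
    congr 1
    ring
  simp only [hrew]
  rw [integral_mul_const, h2, ← Complex.exp_add, ← Complex.exp_zero]
  congr 1
  ring

/-- The moment of order `p` of the normalised exponential. -/
theorem IsCenteredGaussianVec.integral_norm_wickExp_rpow (h : IsCenteredGaussianVec P C G)
    (γ : ℂ) (p : ℝ) (i : ι) :
    Integrable (fun ω => ‖wickExp γ (C i i) (G ω i)‖ ^ p) P ∧
    ∫ ω, ‖wickExp γ (C i i) (G ω i)‖ ^ p ∂P =
      Real.exp (p * ((p - 1) * γ.re ^ 2 + γ.im ^ 2) / 2 * C i i) := by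
  obtain ⟨h1, h2⟩ := h.integral_rexp_mul i (p * γ.re)
  have hrew : ∀ ω, ‖wickExp γ (C i i) (G ω i)‖ ^ p = Real.exp (p * γ.re * G ω i) *
      Real.exp (-(p * (γ.re ^ 2 - γ.im ^ 2) / 2 * C i i)) := by
    intro ω
    rw [norm_wickExp, ← Real.exp_mul, ← Real.exp_add]
    congr 1
    ring
  simp only [hrew]
  refine ⟨h1.mul_const _, ?_⟩
  rw [integral_mul_const, h2, ← Real.exp_add]
  congr 1
  ring

/-- Second moment of a linear combination of the centered normalised exponentials. -/
theorem IsCenteredGaussianVec.integral_norm_sum_sq_le (h : IsCenteredGaussianVec P C G)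
    (hC : ∀ i j, C i j = C j i) (γ : ℂ) (u : ι → ℂ) {B : ℝ} (hB : ∀ i j, |C i j| ≤ B)
    (near : ι → ι → Prop) [∀ i j, Decidable (near i j)]
    (hnear : ∀ i j, ¬ near i j → C i j = 0) :
    Integrable (fun ω => ‖∑ i, u i * (wickExp γ (C i i) (G ω i) - 1)‖ ^ 2) P ∧
    ∫ ω, ‖∑ i, u i * (wickExp γ (C i i) (G ω i) - 1)‖ ^ 2 ∂P ≤
      Real.exp (‖γ‖ ^ 2 * B) * ∑ i, ∑ j, if near i j then ‖u i‖ * ‖u j‖ else 0 := by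
  have := h.isProbabilityMeasure
  set z : ι → Ω → ℂ := fun i ω => wickExp γ (C i i) (G ω i) - 1 with hz
  have hw : ∀ i, Integrable (fun ω => wickExp γ (C i i) (G ω i)) P := fun i =>
    h.integrable_wickExp γ _ i
  have hwc : ∀ i, Integrable (fun ω => (starRingEnd ℂ) (wickExp γ (C i i) (G ω i))) P := by
    intro i
    simp only [conj_wickExp]
    exact h.integrable_wickExp _ _ i
  have hexp : ∀ i j ω, z i ω * (starRingEnd ℂ) (z j ω) =
      wickExp γ (C i i) (G ω i) * (starRingEnd ℂ) (wickExp γ (C j j) (G ω j)) -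
      wickExp γ (C i i) (G ω i) - (starRingEnd ℂ) (wickExp γ (C j j) (G ω j)) + 1 := by
    intro i j ω
    simp only [hz, map_sub, map_one]
    ring
  have hzint : ∀ i j, Integrable (fun ω => z i ω * (starRingEnd ℂ) (z j ω)) P := by
    intro i j
    simp only [hexp]
    exact (((h.wickExp_mul_conj hC γ i j).1.sub (hw i)).sub (hwc j)).add (integrable_const _)
  have hzval : ∀ i j, ∫ ω, z i ω * (starRingEnd ℂ) (z j ω) ∂P =
      ((Real.exp (‖γ‖ ^ 2 * C i j) - 1 : ℝ) : ℂ) := by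
    intro i j
    simp only [hexp]
    have I1 : Integrable (fun ω => wickExp γ (C i i) (G ω i) *
        (starRingEnd ℂ) (wickExp γ (C j j) (G ω j)) - wickExp γ (C i i) (G ω i)) P :=
      (h.wickExp_mul_conj hC γ i j).1.sub (hw i)
    have I2 : Integrable (fun ω => wickExp γ (C i i) (G ω i) *
        (starRingEnd ℂ) (wickExp γ (C j j) (G ω j)) - wickExp γ (C i i) (G ω i) -
        (starRingEnd ℂ) (wickExp γ (C j j) (G ω j))) P := I1.sub (hwc j)
    rw [integral_add I2 (integrable_const _), integral_sub I1 (hwc j),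
      integral_sub (h.wickExp_mul_conj hC γ i j).1 (hw i), (h.wickExp_mul_conj hC γ i j).2,
      h.integral_wickExp, integral_conj, h.integral_wickExp]
    simp
  have hsq : ∀ ω, ((‖∑ i, u i * z i ω‖ ^ 2 : ℝ) : ℂ) =
      ∑ i, ∑ j, u i * (starRingEnd ℂ) (u j) * (z i ω * (starRingEnd ℂ) (z j ω)) := by
    intro ω
    rw [← Complex.normSq_eq_norm_sq, ← Complex.mul_conj, map_sum, Finset.sum_mul_sum]
    refine Finset.sum_congr rfl fun i _ => Finset.sum_congr rfl fun j _ => ?_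
    rw [map_mul]; ring
  have hI : Integrable (fun ω => ((‖∑ i, u i * z i ω‖ ^ 2 : ℝ) : ℂ)) P := by
    simp only [hsq]
    exact integrable_finsetSum _ fun i _ => integrable_finsetSum _ fun j _ =>
      (hzint i j).const_mul _
  have hIr : Integrable (fun ω => ‖∑ i, u i * z i ω‖ ^ 2) P := by
    have := hI.re
    simp only [RCLike.re_to_complex, Complex.ofReal_re] at this
    exact this
  refine ⟨hIr, ?_⟩
  have hval : ((∫ ω, ‖∑ i, u i * z i ω‖ ^ 2 ∂P : ℝ) : ℂ) =
      ∑ i, ∑ j, u i * (starRingEnd ℂ) (u j) * ((Real.exp (‖γ‖ ^ 2 * C i j) - 1 : ℝ) : ℂ) := by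
    rw [← integral_complex_ofReal]
    simp only [hsq]
    rw [integral_finsetSum _ fun i _ => integrable_finsetSum _ fun j _ => (hzint i j).const_mul _]
    refine Finset.sum_congr rfl fun i _ => ?_
    rw [integral_finsetSum _ fun j _ => (hzint i j).const_mul _]
    refine Finset.sum_congr rfl fun j _ => ?_
    rw [integral_const_mul, hzval]
  have h0 : 0 ≤ ∫ ω, ‖∑ i, u i * z i ω‖ ^ 2 ∂P := integral_nonneg fun ω => by positivity
  calc ∫ ω, ‖∑ i, u i * z i ω‖ ^ 2 ∂P
      = ‖((∫ ω, ‖∑ i, u i * z i ω‖ ^ 2 ∂P : ℝ) : ℂ)‖ := by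
        rw [Complex.norm_real, Real.norm_of_nonneg h0]
    _ ≤ ∑ i, ∑ j, ‖u i * (starRingEnd ℂ) (u j) *
          ((Real.exp (‖γ‖ ^ 2 * C i j) - 1 : ℝ) : ℂ)‖ := by
        rw [hval]
        exact (norm_sum_le _ _).trans (Finset.sum_le_sum fun i _ => norm_sum_le _ _)
    _ ≤ _ := by
        rw [Finset.mul_sum]
        refine Finset.sum_le_sum fun i _ => ?_
        rw [Finset.mul_sum]
        refine Finset.sum_le_sum fun j _ => ?_
        rw [norm_mul, norm_mul, RCLike.norm_conj, Complex.norm_real]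
        split_ifs with hn
        · rw [mul_comm]
          refine mul_le_mul_of_nonneg_right ?_ (by positivity)
          rw [Real.norm_eq_abs, abs_le]
          have hle : ‖γ‖ ^ 2 * C i j ≤ ‖γ‖ ^ 2 * B :=
            mul_le_mul_of_nonneg_left ((le_abs_self _).trans (hB i j)) (by positivity)
          have hB0 : 0 ≤ B := (abs_nonneg _).trans (hB i j)
          have h1 : 1 ≤ Real.exp (‖γ‖ ^ 2 * B) := Real.one_le_exp (by positivity)
          have h2 := Real.exp_le_exp.2 hle
          have h3 := Real.exp_pos (‖γ‖ ^ 2 * C i j)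
          constructor <;> linarith
        · rw [hnear i j hn]; simp

end moments

/-- In a sum over pairs of indices lying in adjacent cells, every cell has at most `3 ^ d`
neighbours. -/
theorem sum_adjacent_mul_le {ι : Type*} [Fintype ι] {d : ℕ} (cell : ι → Fin d → ℤ) (a : ι → ℝ)
    (ha : ∀ i, 0 ≤ a i) :
    ∑ i, ∑ j, (if ∀ l, |cell i l - cell j l| ≤ 1 then a i * a j else 0) ≤
      3 ^ d * ∑ u ∈ Finset.univ.image cell, (∑ i with cell i = u, a i) ^ 2 := by
  classical
  set U := Finset.univ.image cell
  set A : (Fin d → ℤ) → ℝ := fun u => ∑ i with cell i = u, a i with hA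
  set T : Finset (Fin d → ℤ) := Fintype.piFinset fun _ => Finset.Icc (-1) 1 with hT
  have hcard : (T.card : ℝ) = 3 ^ d := by
    rw [hT, Fintype.card_piFinset]; simp
  have hA0 : ∀ v, v ∉ U → A v = 0 := by
    intro v hv
    refine Finset.sum_eq_zero fun i hi => ?_
    exact absurd (Finset.mem_image.2 ⟨i, Finset.mem_univ _, (Finset.mem_filter.1 hi).2⟩) hv
  have hτ : ∀ τ : Fin d → ℤ,
      ∑ i, ∑ j, (if cell j = cell i + τ then a i * a j else 0) ≤ ∑ u ∈ U, A u ^ 2 := by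
    intro τ
    have h1 : ∑ i, ∑ j, (if cell j = cell i + τ then a i * a j else 0) =
        ∑ u ∈ U, A u * A (u + τ) := by
      rw [← Finset.sum_fiberwise_of_maps_to (g := cell) (t := U)
        (fun i _ => Finset.mem_image_of_mem _ (Finset.mem_univ _))]
      refine Finset.sum_congr rfl fun u _ => ?_
      rw [hA, Finset.sum_mul]
      refine Finset.sum_congr rfl fun i hi => ?_
      rw [(Finset.mem_filter.1 hi).2, Finset.mul_sum, Finset.sum_filter]
    have h2 : ∑ u ∈ U, A (u + τ) ^ 2 ≤ ∑ u ∈ U, A u ^ 2 := by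
      rw [← Finset.sum_image (s := U) (g := fun u => u + τ) (f := fun u => A u ^ 2)
        (fun x _ y _ h => add_right_cancel h)]
      rw [← Finset.sum_filter_of_ne (p := fun v => v ∈ U) fun v _ hv => by
        by_contra hU
        exact hv (by rw [hA0 v hU]; simp)]
      exact Finset.sum_le_sum_of_subset_of_nonneg
        (fun v hv => (Finset.mem_filter.1 hv).2) fun v _ _ => sq_nonneg _
    rw [h1]
    calc ∑ u ∈ U, A u * A (u + τ) ≤ ∑ u ∈ U, (A u ^ 2 / 2 + A (u + τ) ^ 2 / 2) :=
          Finset.sum_le_sum fun u _ => by nlinarith [sq_nonneg (A u - A (u + τ))]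
      _ ≤ ∑ u ∈ U, A u ^ 2 := by
          rw [Finset.sum_add_distrib, ← Finset.sum_div, ← Finset.sum_div]; linarith
  calc ∑ i, ∑ j, (if ∀ l, |cell i l - cell j l| ≤ 1 then a i * a j else 0)
      ≤ ∑ i, ∑ j, ∑ τ ∈ T, (if cell j = cell i + τ then a i * a j else 0) := by
        refine Finset.sum_le_sum fun i _ => Finset.sum_le_sum fun j _ => ?_
        have hnn : ∀ τ ∈ T, 0 ≤ (if cell j = cell i + τ then a i * a j else 0) := by
          intro τ _
          split_ifs
          · exact mul_nonneg (ha i) (ha j)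
          · exact le_rfl
        split_ifs with h
        · refine le_trans ?_ (Finset.single_le_sum hnn (a := cell j - cell i) ?_)
          · simp
          · rw [hT, Fintype.mem_piFinset]
            intro l
            have := abs_le.1 (h l)
            rw [Finset.mem_Icc, Pi.sub_apply]
            constructor <;> linarith
        · exact Finset.sum_nonneg hnn
    _ = ∑ τ ∈ T, ∑ i, ∑ j, (if cell j = cell i + τ then a i * a j else 0) := by
        exact (Finset.sum_congr rfl fun i _ => Finset.sum_comm).trans Finset.sum_comm
    _ ≤ ∑ _τ ∈ T, ∑ u ∈ U, A u ^ 2 := Finset.sum_le_sum fun τ _ => hτ τ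
    _ = 3 ^ d * ∑ u ∈ U, A u ^ 2 := by rw [Finset.sum_const, nsmul_eq_mul, hcard]

theorem Real.rpow_sum_le_sum_rpow_of_le_one {ι : Type*} (s : Finset ι) (f : ι → ℝ)
    (hf : ∀ i, 0 ≤ f i) {q : ℝ} (hq0 : 0 < q) (hq1 : q ≤ 1) :
    (∑ i ∈ s, f i) ^ q ≤ ∑ i ∈ s, f i ^ q := by
  classical
  induction s using Finset.induction_on with
  | empty => simp [Real.zero_rpow hq0.ne']
  | insert i s hi ih =>
    rw [Finset.sum_insert hi, Finset.sum_insert hi]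
    exact (Real.rpow_add_le_add_rpow (hf i) (Finset.sum_nonneg fun j _ => hf j) hq0.le hq1).trans
      (by gcongr)

/-- The `ℓ²` norm over cells of the cell sums `∑ wᵢ yᵢ` is at most their `ℓᵖ` norm, which the
weighted Hölder inequality bounds by a weighted `p`-th moment of `y`. -/
theorem sqrt_sum_cell_sq_le {ι κ : Type*} [Fintype ι] [DecidableEq κ] (cell : ι → κ)
    (w y : ι → ℝ) (hw : ∀ i, 0 ≤ w i) (hy : ∀ i, 0 ≤ y i) {m p : ℝ} (hp1 : 1 ≤ p) (hp2 : p ≤ 2)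
    (hm : ∀ u, ∑ i with cell i = u, w i ≤ m) :
    Real.sqrt (∑ u ∈ Finset.univ.image cell, (∑ i with cell i = u, w i * y i) ^ 2) ≤
      (m ^ (p - 1) * ∑ i, w i * y i ^ p) ^ p⁻¹ := by
  have hp0 : 0 < p := by linarith
  set U := Finset.univ.image cell
  have hA : ∀ u, 0 ≤ ∑ i with cell i = u, w i * y i := fun u =>
    Finset.sum_nonneg fun i _ => mul_nonneg (hw i) (hy i)
  have hW : ∀ u, 0 ≤ ∑ i with cell i = u, w i := fun u => Finset.sum_nonneg fun i _ => hw i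
  have hwy : ∀ i, 0 ≤ w i * y i ^ p := fun i => mul_nonneg (hw i) (Real.rpow_nonneg (hy i) _)
  have hcell : ∀ u, (∑ i with cell i = u, w i * y i) ^ p ≤
      m ^ (p - 1) * ∑ i with cell i = u, w i * y i ^ p := by
    intro u
    have h1 := Real.inner_le_weight_mul_Lp_of_nonneg (Finset.univ.filter fun i => cell i = u) hp1
      w y hw hy
    have hs : 0 ≤ ∑ i with cell i = u, w i * y i ^ p := Finset.sum_nonneg fun i _ => hwy i
    calc (∑ i with cell i = u, w i * y i) ^ p
        ≤ ((∑ i with cell i = u, w i) ^ (1 - p⁻¹) *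
            (∑ i with cell i = u, w i * y i ^ p) ^ p⁻¹) ^ p :=
          Real.rpow_le_rpow (hA u) h1 hp0.le
      _ = (∑ i with cell i = u, w i) ^ (p - 1) * ∑ i with cell i = u, w i * y i ^ p := by
          rw [Real.mul_rpow (Real.rpow_nonneg (hW u) _) (Real.rpow_nonneg hs _),
            ← Real.rpow_mul (hW u), ← Real.rpow_mul hs, inv_mul_cancel₀ hp0.ne', Real.rpow_one,
            sub_mul, one_mul, inv_mul_cancel₀ hp0.ne']
      _ ≤ _ := mul_le_mul_of_nonneg_right
          (Real.rpow_le_rpow (hW u) (hm u) (by linarith)) hs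
  have hsq : 0 ≤ ∑ u ∈ U, (∑ i with cell i = u, w i * y i) ^ 2 :=
    Finset.sum_nonneg fun u _ => sq_nonneg _
  rw [Real.le_rpow_inv_iff_of_pos (Real.sqrt_nonneg _) _ hp0]
  · rw [Real.sqrt_eq_rpow, ← Real.rpow_mul hsq]
    refine (Real.rpow_sum_le_sum_rpow_of_le_one U _ (fun u => sq_nonneg _) (by positivity)
      (by linarith)).trans ?_
    calc ∑ u ∈ U, ((∑ i with cell i = u, w i * y i) ^ 2) ^ (1 / 2 * p)
        = ∑ u ∈ U, (∑ i with cell i = u, w i * y i) ^ p := by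
          refine Finset.sum_congr rfl fun u _ => ?_
          rw [← Real.rpow_natCast, ← Real.rpow_mul (hA u)]
          congr 1
          push_cast
          ring
      _ ≤ ∑ u ∈ U, m ^ (p - 1) * ∑ i with cell i = u, w i * y i ^ p :=
          Finset.sum_le_sum fun u _ => hcell u
      _ = m ^ (p - 1) * ∑ i, w i * y i ^ p := by
          rw [← Finset.mul_sum, Finset.sum_fiberwise_of_maps_to
            (fun i _ => Finset.mem_image_of_mem _ (Finset.mem_univ _))]
  · rcases isEmpty_or_nonempty ι with hι | ⟨⟨i⟩⟩
    · simp
    · have : 0 ≤ m := (hW (cell i)).trans (hm _)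
      exact mul_nonneg (Real.rpow_nonneg this _) (Finset.sum_nonneg fun i _ => hwy i)

/-- Jensen's inequality for the concave function `x ↦ x ^ q`. -/
theorem integral_rpow_le_rpow_integral {Ω : Type*} [MeasurableSpace Ω] {P : Measure Ω}
    [IsProbabilityMeasure P] {h : Ω → ℝ} (h0 : ∀ ω, 0 ≤ h ω) (hi : Integrable h P) {q : ℝ}
    (hq0 : 0 ≤ q) (hq1 : q ≤ 1) :
    Integrable (fun ω => h ω ^ q) P ∧ ∫ ω, h ω ^ q ∂P ≤ (∫ ω, h ω ∂P) ^ q := by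
  have hint : Integrable (fun ω => h ω ^ q) P := by
    refine ((integrable_const (1 : ℝ)).add hi).mono'
      (hi.aestronglyMeasurable.aemeasurable.pow_const q).aestronglyMeasurable
      (ae_of_all _ fun ω => ?_)
    rw [Real.norm_of_nonneg (Real.rpow_nonneg (h0 ω) _)]
    rcases le_total (h ω) 1 with h1 | h1
    · exact (Real.rpow_le_one (h0 ω) h1 hq0).trans (by simpa using h0 ω)
    · exact (Real.rpow_le_rpow_of_exponent_le h1 hq1).trans (by simp)
  refine ⟨hint, ?_⟩
  exact (Real.concaveOn_rpow hq0 hq1).le_map_integral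
    (Real.continuous_rpow_const hq0).continuousOn isClosed_Ici (ae_of_all _ h0) hi hint

/-! ### Adding one independent level of short range -/

/-- The discretised chaos `∑ᵢ wᵢ exp (γ xᵢ - γ² vᵢ / 2)`. -/
noncomputable def chaosSum {ι : Type*} [Fintype ι] (γ : ℂ) (w : ι → ℂ) (v x : ι → ℝ) : ℂ :=
  ∑ i, w i * wickExp γ (v i) (x i)

theorem continuous_chaosSum {ι : Type*} [Fintype ι] (γ : ℂ) (w : ι → ℂ) (v : ι → ℝ) :
    Continuous (chaosSum γ w v) := by
  unfold chaosSum
  exact continuous_finsetSum _ fun i _ => continuous_const.mul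
    ((continuous_wickExp γ (v i)).comp (continuous_apply i))

theorem IsCenteredGaussianVec.map_id {ι Ω : Type*} [Fintype ι] [MeasurableSpace Ω]
    {P : Measure Ω} {C : ι → ι → ℝ} {G : Ω → ι → ℝ} (h : IsCenteredGaussianVec P C G) :
    IsCenteredGaussianVec (P.map G) C id :=
  h.of_map_eq aemeasurable_id (by simp)

theorem IsCenteredGaussianVec.integrable_chaosSum {ι Ω : Type*} [Fintype ι] [MeasurableSpace Ω]
    {P : Measure Ω} {C : ι → ι → ℝ} {G : Ω → ι → ℝ} (h : IsCenteredGaussianVec P C G)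
    (γ : ℂ) (w : ι → ℂ) (v : ι → ℝ) : Integrable (fun ω => chaosSum γ w v (G ω)) P := by
  unfold chaosSum
  exact integrable_finsetSum _ fun i _ => (h.integrable_wickExp γ (v i) i).const_mul _

/-- The effect on the discretised chaos of adding an independent field `T` of short range to the
field `S`.  Given `S`, the conditional second moment of the difference only sees pairs of points
in adjacent cells; raised to the power `p / 2 ≤ 1` it is subadditive over cells. -/
theorem integral_norm_chaosSum_add_sub_le {ι Ω : Type*} [Fintype ι] [MeasurableSpace Ω]
    {P : Measure Ω} {C C' : ι → ι → ℝ} {S T : Ω → ι → ℝ} (hS : IsCenteredGaussianVec P C S)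
    (hT : IsCenteredGaussianVec P C' T) (hST : IndepFun S T P)
    (hC' : ∀ i j, C' i j = C' j i) (γ : ℂ) (w : ι → ℂ) {B V W m p : ℝ}
    (hB : ∀ i j, |C' i j| ≤ B) {d : ℕ} (cell : ι → Fin d → ℤ)
    (hnear : ∀ i j, ¬ (∀ l, |cell i l - cell j l| ≤ 1) → C' i j = 0)
    (hV : ∀ i, C i i ≤ V) (hp1 : 1 ≤ p) (hp2 : p ≤ 2) (hm0 : 0 ≤ m)
    (hm : ∀ u, ∑ i with cell i = u, ‖w i‖ ≤ m) (hW : ∑ i, ‖w i‖ ≤ W) :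
    ∫ ω, ‖chaosSum γ w (fun i => C i i + C' i i) (S ω + T ω) -
        chaosSum γ w (fun i => C i i) (S ω)‖ ∂P ≤
      Real.sqrt (3 ^ d * Real.exp (‖γ‖ ^ 2 * B)) *
        (m ^ (p - 1) *
          (W * Real.exp (p * ((p - 1) * γ.re ^ 2 + γ.im ^ 2) / 2 * V))) ^ p⁻¹ := by
  classical
  have hp0 : 0 < p := by linarith
  have hPP := hS.isProbabilityMeasure
  have hμS := Measure.isProbabilityMeasure_map hS.aemeasurable
  have hμT := Measure.isProbabilityMeasure_map hT.aemeasurable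
  set F : (ι → ℝ) × (ι → ℝ) → ℂ := fun q =>
    chaosSum γ w (fun i => C i i + C' i i) (q.1 + q.2) - chaosSum γ w (fun i => C i i) q.1 with hF
  have hFc : Continuous F :=
    ((continuous_chaosSum γ w _).comp (continuous_fst.add continuous_snd)).sub
      ((continuous_chaosSum γ w _).comp continuous_fst)
  have hFsum : ∀ s t, F (s, t) =
      ∑ i, (w i * wickExp γ (C i i) (s i)) * (wickExp γ (C' i i) (t i) - 1) := by
    intro s t
    simp only [hF, chaosSum, Pi.add_apply, wickExp_add]
    rw [← Finset.sum_sub_distrib]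
    exact Finset.sum_congr rfl fun i _ => by ring
  have hmap : P.map (fun ω => (S ω, T ω)) = (P.map S).prod (P.map T) :=
    (indepFun_iff_map_prod_eq_prod_map_map hS.aemeasurable hT.aemeasurable).1 hST
  have hpm : AEMeasurable (fun ω => (S ω, T ω)) P := hS.aemeasurable.prodMk hT.aemeasurable
  have hFint : Integrable (fun q => ‖F q‖) ((P.map S).prod (P.map T)) := by
    rw [← hmap]
    refine (integrable_map_measure hFc.norm.aestronglyMeasurable hpm).2 ?_
    exact (((hS.add hT hST).integrable_chaosSum γ w _).sub (hS.integrable_chaosSum γ w _)).norm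
  have hTl := hT.map_id
  have hSl := hS.map_id
  set K := Real.sqrt (3 ^ d * Real.exp (‖γ‖ ^ 2 * B)) with hK
  set y : (ι → ℝ) → ι → ℝ := fun s i => ‖wickExp γ (C i i) (s i)‖ with hy
  set h : (ι → ℝ) → ℝ := fun s => m ^ (p - 1) * ∑ i, ‖w i‖ * y s i ^ p with hh
  have hinner : ∀ s, ∫ t, ‖F (s, t)‖ ∂(P.map T) ≤ K * h s ^ p⁻¹ := by
    intro s
    obtain ⟨hi2, hle2⟩ := hTl.integral_norm_sum_sq_le hC' γ
      (fun i => w i * wickExp γ (C i i) (s i)) hB (fun i j => ∀ l, |cell i l - cell j l| ≤ 1) hnear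
    simp only [id] at hi2 hle2
    simp only [hFsum]
    obtain ⟨-, hj⟩ := integral_rpow_le_rpow_integral (fun t => sq_nonneg _) hi2
      (q := 1 / 2) (by norm_num) (by norm_num)
    simp only [← Real.sqrt_eq_rpow, Real.sqrt_sq (norm_nonneg _)] at hj
    refine hj.trans ?_
    have hs := sum_adjacent_mul_le cell (fun i => ‖w i‖ * y s i) fun i => by positivity
    have hb : ∑ i, ∑ j, (if ∀ l, |cell i l - cell j l| ≤ 1 then
        ‖w i * wickExp γ (C i i) (s i)‖ * ‖w j * wickExp γ (C j j) (s j)‖ else 0) ≤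
        3 ^ d * ∑ u ∈ Finset.univ.image cell, (∑ i with cell i = u, ‖w i‖ * y s i) ^ 2 := by
      simp only [norm_mul]
      exact hs
    have hc := sqrt_sum_cell_sq_le cell (fun i => ‖w i‖) (y s) (fun i => norm_nonneg _)
      (fun i => norm_nonneg _) hp1 hp2 hm
    calc Real.sqrt _ ≤ Real.sqrt (Real.exp (‖γ‖ ^ 2 * B) * (3 ^ d *
            ∑ u ∈ Finset.univ.image cell, (∑ i with cell i = u, ‖w i‖ * y s i) ^ 2)) :=
          Real.sqrt_le_sqrt (hle2.trans (mul_le_mul_of_nonneg_left hb (Real.exp_pos _).le))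
      _ = K * Real.sqrt (∑ u ∈ Finset.univ.image cell,
            (∑ i with cell i = u, ‖w i‖ * y s i) ^ 2) := by
          rw [hK, ← Real.sqrt_mul (by positivity)]
          congr 1
          ring
      _ ≤ K * h s ^ p⁻¹ := mul_le_mul_of_nonneg_left hc (Real.sqrt_nonneg _)
  have hh0 : ∀ s, 0 ≤ h s := fun s => mul_nonneg (Real.rpow_nonneg hm0 _)
    (Finset.sum_nonneg fun i _ => mul_nonneg (norm_nonneg _)
      (Real.rpow_nonneg (norm_nonneg _) _))
  have hyi : ∀ i, Integrable (fun s => ‖w i‖ * y s i ^ p) (P.map S) := fun i =>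
    (hSl.integral_norm_wickExp_rpow γ p i).1.const_mul _
  have hhi : Integrable h (P.map S) := (integrable_finsetSum _ fun i _ => hyi i).const_mul _
  have hhval : ∫ s, h s ∂(P.map S) ≤ m ^ (p - 1) *
      (W * Real.exp (p * ((p - 1) * γ.re ^ 2 + γ.im ^ 2) / 2 * V)) := by
    rw [hh, integral_const_mul]
    refine mul_le_mul_of_nonneg_left ?_ (Real.rpow_nonneg hm0 _)
    rw [integral_finsetSum _ fun i _ => hyi i]
    refine le_trans ?_ (mul_le_mul_of_nonneg_right hW (Real.exp_pos _).le)
    rw [Finset.sum_mul]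
    refine Finset.sum_le_sum fun i _ => ?_
    rw [integral_const_mul]
    refine mul_le_mul_of_nonneg_left ?_ (norm_nonneg _)
    refine ((hSl.integral_norm_wickExp_rpow γ p i).2).le.trans ?_
    refine Real.exp_le_exp.2 (mul_le_mul_of_nonneg_left (hV i) ?_)
    have : 0 ≤ p - 1 := by linarith
    positivity
  obtain ⟨hqi, hqle⟩ := integral_rpow_le_rpow_integral hh0 hhi (inv_nonneg.2 hp0.le)
    (inv_le_one_of_one_le₀ hp1)
  calc ∫ ω, ‖F (S ω, T ω)‖ ∂P = ∫ q, ‖F q‖ ∂((P.map S).prod (P.map T)) := by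
        rw [← hmap, integral_map hpm hFc.norm.aestronglyMeasurable]
    _ = ∫ s, ∫ t, ‖F (s, t)‖ ∂(P.map T) ∂(P.map S) := integral_prod _ hFint
    _ ≤ ∫ s, K * h s ^ p⁻¹ ∂(P.map S) :=
        integral_mono hFint.integral_prod_left (hqi.const_mul _) hinner
    _ = K * ∫ s, h s ^ p⁻¹ ∂(P.map S) := integral_const_mul _ _
    _ ≤ _ := mul_le_mul_of_nonneg_left (hqle.trans (Real.rpow_le_rpow
        (integral_nonneg hh0) hhval (inv_nonneg.2 hp0.le))) (Real.sqrt_nonneg _)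

/-! ### Telescoping over independent levels -/

theorem isCenteredGaussianVec_zero {ι Ω : Type*} [Fintype ι] [MeasurableSpace Ω] (P : Measure Ω)
    [IsProbabilityMeasure P] : IsCenteredGaussianVec P (0 : ι → ι → ℝ) 0 := by
  refine ⟨aemeasurable_const, fun c => ?_, fun c => ?_⟩ <;> simp

theorem IsCenteredGaussianVec.finsetSum {ι Ω : Type*} [Fintype ι] [MeasurableSpace Ω]
    {P : Measure Ω} [IsProbabilityMeasure P] {C : ℕ → ι → ι → ℝ} {X : ℕ → Ω → ι → ℝ}
    (hX : ∀ k, IsCenteredGaussianVec P (C k) (X k)) (hm : ∀ k, Measurable (X k))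
    (hind : iIndepFun X P) (s : Finset ℕ) :
    IsCenteredGaussianVec P (∑ k ∈ s, C k) (∑ k ∈ s, X k) := by
  induction s using Finset.induction_on with
  | empty => simpa using isCenteredGaussianVec_zero P
  | insert k s hk ih =>
    rw [Finset.sum_insert hk, Finset.sum_insert hk, add_comm, add_comm (X k)]
    exact ih.add (hX k) (hind.indepFun_finsetSum_of_notMem hm hk)

theorem indepFun_sum_sum_of_disjoint {ι Ω : Type*} [MeasurableSpace Ω]
    {P : Measure Ω} {X : ℕ → Ω → ι → ℝ} (hm : ∀ k, Measurable (X k)) (hind : iIndepFun X P)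
    {s t : Finset ℕ} (hst : Disjoint s t) :
    IndepFun (∑ k ∈ s, X k) (∑ k ∈ t, X k) P := by
  have h1 := hind.indepFun_finset s t hst hm
  have hφ : ∀ r : Finset ℕ, Measurable fun z : r → ι → ℝ => ∑ j, z j := fun r =>
    Finset.measurable_fun_sum _ fun j _ => measurable_pi_apply j
  have hX : ∀ r : Finset ℕ,
      (∑ k ∈ r, X k) = (fun z : r → ι → ℝ => ∑ j, z j) ∘ fun a (i : r) => X i a := by
    intro r
    funext ω
    rw [Finset.sum_apply, ← Finset.sum_coe_sort]
    rfl
  rw [hX s, hX t]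
  exact h1.comp (hφ s) (hφ t)

theorem integral_norm_sub_le_sum {Ω : Type*} [MeasurableSpace Ω] {μ : Measure Ω}
    {M : ℕ → Ω → ℂ} (hM : ∀ k, Integrable (M k) μ) {b : ℕ → ℝ} {n N : ℕ}
    (hb : ∀ k, n ≤ k → k < N → ∫ ω, ‖M (k + 1) ω - M k ω‖ ∂μ ≤ b k) (K : ℕ) (hK : n ≤ K)
    (hKN : K ≤ N) : ∫ ω, ‖M K ω - M n ω‖ ∂μ ≤ ∑ k ∈ Finset.Ico n K, b k := by
  induction K, hK using Nat.le_induction with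
  | base => simp
  | succ K hK ih =>
    rw [Finset.sum_Ico_succ_top hK]
    have i1 : Integrable (fun ω => ‖M (K + 1) ω - M K ω‖) μ := ((hM (K + 1)).sub (hM K)).norm
    have i2 : Integrable (fun ω => ‖M K ω - M n ω‖) μ := ((hM K).sub (hM n)).norm
    calc ∫ ω, ‖M (K + 1) ω - M n ω‖ ∂μ
        ≤ ∫ ω, (‖M K ω - M n ω‖ + ‖M (K + 1) ω - M K ω‖) ∂μ := by
          refine integral_mono ((hM (K + 1)).sub (hM n)).norm (i2.add i1) fun ω => ?_
          have := norm_add_le (M K ω - M n ω) (M (K + 1) ω - M K ω)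
          rwa [show M K ω - M n ω + (M (K + 1) ω - M K ω) = M (K + 1) ω - M n ω by ring] at this
      _ = ∫ ω, ‖M K ω - M n ω‖ ∂μ + ∫ ω, ‖M (K + 1) ω - M K ω‖ ∂μ := integral_add i2 i1
      _ ≤ _ := add_le_add (ih (by omega)) (hb K hK (by omega))

/-- Telescoping over independent levels: if adding the level `k + 1` changes the discretised chaos
by at most `b k` in `L¹`, then adding all levels from `n + 1` to `N` changes it by at most
`∑ b k`.  The two fields may live on any probability space, because only their laws matter. -/
theorem integral_norm_chaosSum_levels_le {ι Ω : Type*} [Fintype ι] [MeasurableSpace Ω]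
    {P : Measure Ω} {C : ℕ → ι → ι → ℝ} (hC : ∀ k, (Matrix.of (C k)).PosSemidef) (γ : ℂ)
    (w : ι → ℂ) (b : ℕ → ℝ) {n N : ℕ} (hnN : n ≤ N)
    (hb : ∀ k, n ≤ k → k < N → ∀ (μ : Measure (ℕ → ι → ℝ)) (S T : (ℕ → ι → ℝ) → ι → ℝ),
      IsCenteredGaussianVec μ (∑ j ∈ Finset.range (k + 1), C j) S →
      IsCenteredGaussianVec μ (C (k + 1)) T → IndepFun S T μ →
      ∫ ω, ‖chaosSum γ w (fun i => (∑ j ∈ Finset.range (k + 1), C j) i i + C (k + 1) i i)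
          (S ω + T ω) -
        chaosSum γ w (fun i => (∑ j ∈ Finset.range (k + 1), C j) i i) (S ω)‖ ∂μ ≤ b k)
    {S T : Ω → ι → ℝ} (hS : IsCenteredGaussianVec P (∑ j ∈ Finset.range (n + 1), C j) S)
    (hT : IsCenteredGaussianVec P (∑ j ∈ Finset.Ico (n + 1) (N + 1), C j) T)
    (hST : IndepFun S T P) :
    ∫ ω, ‖chaosSum γ w (fun i => (∑ j ∈ Finset.range (N + 1), C j) i i) (S ω + T ω) -
        chaosSum γ w (fun i => (∑ j ∈ Finset.range (n + 1), C j) i i) (S ω)‖ ∂P ≤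
      ∑ k ∈ Finset.Ico n N, b k := by
  classical
  choose ν hν using fun k => exists_isCenteredGaussianVec (hC k)
  have hνp := fun k => (hν k).isProbabilityMeasure
  set μ : Measure (ℕ → ι → ℝ) := Measure.infinitePi ν with hμ
  set X : ℕ → (ℕ → ι → ℝ) → ι → ℝ := fun k ω => ω k with hX
  have hXm : ∀ k, Measurable (X k) := fun k => measurable_pi_apply k
  have hXi : iIndepFun X μ :=
    iIndepFun_infinitePi (X := fun _ x => x) fun k => measurable_id
  have hXg : ∀ k, IsCenteredGaussianVec μ (C k) (X k) := by
    intro k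
    refine (hν k).of_map_eq (hXm k).aemeasurable ?_
    rw [Measure.map_id]
    exact (Measure.infinitePi_map_eval ν k).symm
  have hsum := fun s => IsCenteredGaussianVec.finsetSum hXg hXm hXi s
  set M : ℕ → (ℕ → ι → ℝ) → ℂ := fun k ω =>
    chaosSum γ w (fun i => (∑ j ∈ Finset.range (k + 1), C j) i i)
      ((∑ j ∈ Finset.range (k + 1), X j) ω) with hM
  have hMi : ∀ k, Integrable (M k) μ := fun k => (hsum _).integrable_chaosSum γ w _
  have hstep : ∀ k, n ≤ k → k < N → ∫ ω, ‖M (k + 1) ω - M k ω‖ ∂μ ≤ b k := by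
    intro k hk hkN
    have := hb k hk hkN μ (∑ j ∈ Finset.range (k + 1), X j) (X (k + 1)) (hsum _) (hXg _)
      (hXi.indepFun_finsetSum_of_notMem hXm (by simp))
    refine le_trans (le_of_eq ?_) this
    simp only [hM]
    rw [Finset.sum_range_succ _ (k + 1), Finset.sum_range_succ _ (k + 1)]
    rfl
  have htel := integral_norm_sub_le_sum hMi hstep
  have hsplit : ∑ j ∈ Finset.range (n + 1), X j + ∑ j ∈ Finset.Ico (n + 1) (N + 1), X j =
      ∑ j ∈ Finset.range (N + 1), X j := Finset.sum_range_add_sum_Ico X (by omega)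
  set S' := ∑ j ∈ Finset.range (n + 1), X j with hS'
  set T' := ∑ j ∈ Finset.Ico (n + 1) (N + 1), X j with hT'
  have hS'T' : IndepFun S' T' μ := by
    refine indepFun_sum_sum_of_disjoint hXm hXi ?_
    rw [Finset.disjoint_left]
    intro a ha hb
    simp only [Finset.mem_range, Finset.mem_Ico] at ha hb
    omega
  have hPp := hS.isProbabilityMeasure
  have hlaw : P.map (fun ω => (S ω, T ω)) = μ.map (fun ω => (S' ω, T' ω)) := by
    rw [(indepFun_iff_map_prod_eq_prod_map_map hS.aemeasurable hT.aemeasurable).1 hST,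
      (indepFun_iff_map_prod_eq_prod_map_map (hsum _).aemeasurable (hsum _).aemeasurable).1 hS'T',
      hS.map_eq (hsum _), hT.map_eq (hsum _)]
  set F : (ι → ℝ) × (ι → ℝ) → ℝ := fun q =>
    ‖chaosSum γ w (fun i => (∑ j ∈ Finset.range (N + 1), C j) i i) (q.1 + q.2) -
      chaosSum γ w (fun i => (∑ j ∈ Finset.range (n + 1), C j) i i) q.1‖
  have hFc : Continuous F :=
    (((continuous_chaosSum γ w _).comp (continuous_fst.add continuous_snd)).sub
      ((continuous_chaosSum γ w _).comp continuous_fst)).norm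
  calc ∫ ω, F (S ω, T ω) ∂P = ∫ ω, F (S' ω, T' ω) ∂μ := by
        rw [← integral_map (hS.aemeasurable.prodMk hT.aemeasurable) hFc.aestronglyMeasurable,
          hlaw, integral_map ((hsum _).aemeasurable.prodMk (hsum _).aemeasurable)
            hFc.aestronglyMeasurable]
    _ = ∫ ω, ‖M N ω - M n ω‖ ∂μ := by
        refine integral_congr_ae (ae_of_all _ fun ω => ?_)
        simp only [F, hM]
        rw [← hsplit]
        rfl
    _ ≤ _ := htel N hnN le_rfl

/-! ### Geometric decay in the subcritical region -/

/-- The rate `(d (p - 1) - p ((p - 1) α² + β²) / 2) / p` at which the increments of the chaos decay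
in `Lᵖ` is positive for a suitable `p`: the value `p = √(2d) / |α|` is optimal when it lies in
`[1, 2]`, and `p = 2` suffices in the disk. -/
theorem exists_exponent_of_mem_subcriticalRegion {d : ℕ} {α β : ℝ}
    (h : (α, β) ∈ subcriticalRegion d) :
    ∃ p : ℝ, 1 ≤ p ∧ p ≤ 2 ∧ 0 < (d * (p - 1) - p * ((p - 1) * α ^ 2 + β ^ 2) / 2) / p := by
  rcases h with h | ⟨⟨h1, h2⟩, h3⟩
  · refine ⟨2, by norm_num, le_rfl, ?_⟩
    simp only [mem_ofPred_eq] at h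
    linarith
  · simp only at h1 h2 h3
    set s := Real.sqrt (2 * d) with hs
    have hss : s ^ 2 = 2 * d := Real.sq_sqrt (by positivity)
    have hs2 : Real.sqrt (d / 2) = s / 2 := by
      rw [hs, show (d : ℝ) / 2 = (2 * d) / 2 ^ 2 by ring, Real.sqrt_div (by positivity),
        Real.sqrt_sq (by norm_num)]
    rw [hs2] at h1
    set a := |α| with ha
    have hs0 : 0 ≤ s := Real.sqrt_nonneg _
    have ha0 : 0 < a := by linarith
    have hs0' : 0 < s := by linarith
    have haa : α ^ 2 = a ^ 2 := (sq_abs α).symm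
    have hb : β ^ 2 < (s - a) ^ 2 := by
      rw [← sq_abs β]
      exact pow_lt_pow_left₀ h3 (abs_nonneg _) (by norm_num)
    refine ⟨s / a, ?_, ?_, ?_⟩
    · rw [le_div_iff₀ ha0]; linarith
    · rw [div_le_iff₀ ha0]; linarith
    · refine div_pos ?_ (by positivity)
      have : (d : ℝ) * (s / a - 1) - s / a * ((s / a - 1) * α ^ 2 + β ^ 2) / 2 =
          s / (2 * a) * ((s - a) ^ 2 - β ^ 2) := by
        rw [haa, show (d : ℝ) = s ^ 2 / 2 by linarith]
        field_simp
        ring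
      rw [this]
      exact mul_pos (by positivity) (by linarith)

theorem EuclideanSpace.abs_apply_sub_le_dist {d : ℕ} (x y : EuclideanSpace ℝ (Fin d)) (l : Fin d) :
    |x l - y l| ≤ dist x y := by
  rw [dist_eq_norm]
  exact PiLp.norm_apply_le (x - y) l

theorem EuclideanSpace.dist_le_of_forall_abs_le {d : ℕ} (x y : EuclideanSpace ℝ (Fin d)) {r : ℝ}
    (hr : 0 ≤ r) (h : ∀ l, |x l - y l| ≤ r) : dist x y ≤ (d + 1) * r := by
  rw [EuclideanSpace.dist_eq]
  refine Real.sqrt_le_iff.2 ⟨by positivity, ?_⟩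
  calc ∑ l, dist (x l) (y l) ^ 2 ≤ ∑ _l : Fin d, r ^ 2 := by
        refine Finset.sum_le_sum fun l _ => ?_
        rw [Real.dist_eq]
        exact pow_le_pow_left₀ (abs_nonneg _) (h l) 2
    _ = d * r ^ 2 := by simp
    _ ≤ ((d + 1) * r) ^ 2 := by
        rw [mul_pow]
        refine mul_le_mul_of_nonneg_right ?_ (sq_nonneg r)
        have : (0 : ℝ) ≤ d := d.cast_nonneg
        nlinarith

/-- Geometric decay, in the number `n` of levels retained, of the `L¹` error made by replacing the
discretised chaos by its conditional expectation given the first `n` levels.  The constant depends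
on the data only through `B`: `B` bounds the excess of the variance of the first `k` levels over
`k`, the size of each further level, its range in units of `exp (-k)`, and the masses of balls. -/
theorem exists_chaosSum_tail_bound (d : ℕ) (γ : ℂ) {p : ℝ} (hp1 : 1 ≤ p) (hp2 : p ≤ 2)
    {c : ℝ} (hc : 0 < c)
    (hcp : c = (d * (p - 1) - p * ((p - 1) * γ.re ^ 2 + γ.im ^ 2) / 2) / p)
    {B : ℝ} (hB : Real.exp 1 ≤ B) :
    ∃ A : ℝ, 0 ≤ A ∧ ∀ {N n m : ℕ} (x : Fin N → EuclideanSpace ℝ (Fin d)) (w : Fin N → ℂ)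
      (C : ℕ → Fin N → Fin N → ℝ), n ≤ m →
      (∀ k, (Matrix.of (C k)).PosSemidef) →
      (∀ k ≤ m, ∀ i, (∑ j ∈ Finset.range (k + 1), C j) i i ≤ k + B) →
      (∀ k ≤ m, ∀ i j, |C (k + 1) i j| ≤ B) →
      (∀ k ≤ m, ∀ i j, B * Real.exp (-(k + 1 : ℝ)) ≤ dist (x i) (x j) → C (k + 1) i j = 0) →
      (∀ (z : EuclideanSpace ℝ (Fin d)) (r : ℝ), Real.exp (-(m : ℝ)) ≤ r →
        ∑ i with dist (x i) z ≤ r, ‖w i‖ ≤ B * r ^ d) →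
      (∑ i, ‖w i‖ ≤ B) →
      ∀ {Ω : Type*} [MeasurableSpace Ω] {P : Measure Ω} {S T : Ω → Fin N → ℝ},
      IsCenteredGaussianVec P (∑ j ∈ Finset.range (n + 1), C j) S →
      IsCenteredGaussianVec P (∑ j ∈ Finset.Ico (n + 1) (m + 1 + 1), C j) T →
      IndepFun S T P →
      ∫ ω, ‖chaosSum γ w (fun i => (∑ j ∈ Finset.range (m + 1 + 1), C j) i i) (S ω + T ω) -
        chaosSum γ w (fun i => (∑ j ∈ Finset.range (n + 1), C j) i i) (S ω)‖ ∂P ≤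
      A * Real.exp (-c * n) := by
  have hp0 : 0 < p := by linarith
  have hB0 : 0 < B := (Real.exp_pos 1).trans_le hB
  set κ : ℝ := p * ((p - 1) * γ.re ^ 2 + γ.im ^ 2) / 2 with hκ
  set M : ℝ := B * ((d + 1) * B * Real.exp (-1)) ^ d with hM
  have hM0 : 0 < M := by positivity
  set A₀ : ℝ := Real.sqrt (3 ^ d * Real.exp (‖γ‖ ^ 2 * B)) *
    (M ^ (p - 1) * (B * Real.exp (κ * B))) ^ p⁻¹ with hA₀
  have hA₀0 : 0 ≤ A₀ := by positivity
  have hec : Real.exp (-c) < 1 := Real.exp_zero ▸ Real.exp_lt_exp.2 (by linarith)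
  refine ⟨A₀ / (1 - Real.exp (-c)), div_nonneg hA₀0 (by linarith), ?_⟩
  intro N n m x w C hnm hpsd hvar hbd hrange hball hmass Ω _ P S T hS hT hST
  have hsum : ∑ k ∈ Finset.Ico n (m + 1), A₀ * Real.exp (-c * k) ≤
      A₀ / (1 - Real.exp (-c)) * Real.exp (-c * n) := by
    have hgeom : ∀ K : ℕ, n ≤ K → ∑ k ∈ Finset.Ico n K, A₀ * Real.exp (-c * k) ≤
        A₀ / (1 - Real.exp (-c)) * (Real.exp (-c * n) - Real.exp (-c * K)) := by
      intro K hK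
      induction K, hK using Nat.le_induction with
      | base => simp
      | succ K hK ih =>
        rw [Finset.sum_Ico_succ_top hK]
        have h1 : Real.exp (-c * (K + 1 : ℕ)) = Real.exp (-c * K) * Real.exp (-c) := by
          rw [← Real.exp_add]; congr 1; push_cast; ring
        have h2 : A₀ * Real.exp (-c * K) = A₀ / (1 - Real.exp (-c)) *
            (Real.exp (-c * K) - Real.exp (-c * (K + 1 : ℕ))) := by
          rw [h1]
          have : 1 - Real.exp (-c) ≠ 0 := by linarith
          field_simp
        linarith
    refine (hgeom (m + 1) (by omega)).trans ?_
    refine mul_le_mul_of_nonneg_left ?_ (div_nonneg hA₀0 (by linarith))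
    linarith [Real.exp_pos (-c * (m + 1 : ℕ))]
  refine le_trans ?_ hsum
  refine integral_norm_chaosSum_levels_le hpsd γ w (fun k => A₀ * Real.exp (-c * k))
    (by omega) ?_ hS hT hST
  intro k hnk hkm μ S' T' hS' hT' hST'
  have hkm' : k ≤ m := by omega
  set r : ℝ := B * Real.exp (-(k + 1 : ℝ)) with hr
  have hr0 : 0 < r := by positivity
  -- cells are cubes whose side is the range of the covariance of level `k + 1`
  set cell : Fin N → Fin d → ℤ := fun i l => ⌊x i l / r⌋ with hcell
  have hnear : ∀ i j, ¬ (∀ l, |cell i l - cell j l| ≤ 1) → C (k + 1) i j = 0 := by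
    intro i j hij
    refine hrange k hkm' i j ?_
    by_contra hlt
    rw [not_le] at hlt
    refine hij fun l => ?_
    have h1 := (EuclideanSpace.abs_apply_sub_le_dist (x i) (x j) l).trans_lt hlt
    have h2 : |x i l / r - x j l / r| < 1 := by
      rw [← sub_div, abs_div, abs_of_pos hr0, div_lt_one hr0]
      exact h1
    rw [abs_lt] at h2
    have a1 := Int.floor_le (x i l / r)
    have a2 := Int.lt_floor_add_one (x i l / r)
    have b1 := Int.floor_le (x j l / r)
    have b2 := Int.lt_floor_add_one (x j l / r)
    have c1 : ((cell i l - cell j l : ℤ) : ℝ) < (2 : ℤ) := by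
      push_cast; linarith
    have c2 : ((-2 : ℤ) : ℝ) < ((cell i l - cell j l : ℤ) : ℝ) := by
      push_cast; linarith
    have c1' := Int.cast_lt.1 c1
    have c2' := Int.cast_lt.1 c2
    rw [abs_le]
    omega
  have hcellmass : ∀ u, ∑ i with cell i = u, ‖w i‖ ≤ B * ((d + 1) * r) ^ d := by
    intro u
    rcases (Finset.univ.filter fun i => cell i = u).eq_empty_or_nonempty with h0 | ⟨i₀, hi₀⟩
    · rw [h0, Finset.sum_empty]; positivity
    · rw [Finset.mem_filter] at hi₀
      refine le_trans (Finset.sum_le_sum_of_subset_of_nonneg ?_ fun _ _ _ => norm_nonneg _)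
        (hball (x i₀) ((d + 1) * r) ?_)
      · intro i hi
        rw [Finset.mem_filter] at hi ⊢
        refine ⟨hi.1, EuclideanSpace.dist_le_of_forall_abs_le _ _ hr0.le fun l => ?_⟩
        have h1 : ⌊x i l / r⌋ = ⌊x i₀ l / r⌋ := congrFun (hi.2.trans hi₀.2.symm) l
        have h2 := Int.abs_sub_lt_one_of_floor_eq_floor h1
        rw [← sub_div, abs_div, abs_of_pos hr0, div_lt_one hr0] at h2
        exact h2.le
      · have e1 : Real.exp (-(m : ℝ)) ≤ r := by
          have hkmr : (k : ℝ) ≤ m := by exact_mod_cast hkm'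
          calc Real.exp (-(m : ℝ)) ≤ Real.exp (1 + -(k + 1 : ℝ)) :=
                Real.exp_le_exp.2 (by linarith)
            _ = Real.exp 1 * Real.exp (-(k + 1 : ℝ)) := Real.exp_add _ _
            _ ≤ r := mul_le_mul_of_nonneg_right hB (Real.exp_pos _).le
        have : (0 : ℝ) ≤ d := d.cast_nonneg
        nlinarith
  have hstep := integral_norm_chaosSum_add_sub_le hS' hT' hST'
    (fun i j => by simpa using ((hpsd (k + 1)).isHermitian.apply i j).symm) γ w (hbd k hkm') cell
    hnear (hvar k hkm') hp1 hp2 (by positivity) hcellmass hmass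
  refine hstep.trans (le_of_eq ?_)
  have e1 : B * ((d + 1) * r) ^ d = M * Real.exp (-(d * k : ℝ)) := by
    rw [hM, hr, show -(k + 1 : ℝ) = -1 + -(k : ℝ) by ring, Real.exp_add,
      show -(d * k : ℝ) = d * -(k : ℝ) by ring, Real.exp_nat_mul, mul_assoc B, ← mul_pow]
    congr 2
    ring
  rw [e1, ← hκ, hA₀, mul_assoc (Real.sqrt _)]
  congr 1
  rw [Real.mul_rpow hM0.le (Real.exp_pos _).le, ← Real.exp_mul, mul_add, Real.exp_add,
    show M ^ (p - 1) * Real.exp (-(d * k : ℝ) * (p - 1)) *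
      (B * (Real.exp (κ * k) * Real.exp (κ * B))) =
      (M ^ (p - 1) * (B * Real.exp (κ * B))) *
        (Real.exp (-(d * k : ℝ) * (p - 1)) * Real.exp (κ * k)) by ring,
    ← Real.exp_add, Real.mul_rpow (by positivity) (Real.exp_pos _).le, ← Real.exp_mul]
  congr 2
  rw [hcp]
  field_simp
  ring

/-! ### Integrals of the kernels against mollifiers -/

/-- Termwise integration of a series that converges absolutely in `L¹`; the sum is only required
to exist almost everywhere. -/
theorem integrable_and_hasSum_integral {α : Type*} [MeasurableSpace α] {μ : Measure α}
    {F : ℕ → α → ℝ} {f : α → ℝ} (hF : ∀ i, Integrable (F i) μ)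
    (hs : Summable fun i => ∫ a, ‖F i a‖ ∂μ) (hf : ∀ᵐ a ∂μ, HasSum (fun i => F i a) (f a)) :
    Integrable f μ ∧ HasSum (fun i => ∫ a, F i a ∂μ) (∫ a, f a ∂μ) := by
  constructor
  · refine ⟨aestronglyMeasurable_of_tendsto_ae atTop
      (f := fun n a => ∑ i ∈ Finset.range n, F i a)
      (fun n => Finset.aestronglyMeasurable_fun_sum _ fun i _ => (hF i).aestronglyMeasurable)
      (hf.mono fun a ha => ha.tendsto_sum_nat), ?_⟩
    have h1 : ∀ᵐ a ∂μ, ‖f a‖ₑ ≤ ∑' i, ‖F i a‖ₑ := by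
      filter_upwards [hf] with a ha
      rw [← ha.tsum_eq]
      exact enorm_tsum_le_tsum_enorm
    refine (lintegral_mono_ae h1).trans_lt ?_
    rw [lintegral_tsum fun i => (hF i).aestronglyMeasurable.enorm]
    have h2 : ∀ i, ∫⁻ a, ‖F i a‖ₑ ∂μ = ENNReal.ofReal (∫ a, ‖F i a‖ ∂μ) := fun i =>
      (ofReal_integral_norm_eq_lintegral_enorm (hF i)).symm
    simp only [h2]
    exact hs.tsum_ofReal_lt_top
  · have h1 := hasSum_integral_of_summable_integral_norm hF hs
    have h2 : ∫ a, (∑' i, F i a) ∂μ = ∫ a, f a ∂μ :=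
      integral_congr_ae (hf.mono fun a ha => ha.tsum_eq)
    rwa [h2] at h1

section kernels

variable {d : ℕ}

local notation "𝔼" => EuclideanSpace ℝ (Fin d)

/-- The bilinear form `∫∫ φ(x) ψ(y) Q(x,y) dx dy`. -/
noncomputable def bilForm (Q : 𝔼 → 𝔼 → ℝ) (φ ψ : 𝔼 → ℝ) : ℝ :=
  ∫ x, ∫ y, φ x * ψ y * Q x y

/-- The symmetrised form `(bilForm Q φ ψ + bilForm Q ψ φ) / 2`; the kernels in the decomposition of
a covariance are not required to be symmetric. -/
noncomputable def symForm (Q : 𝔼 → 𝔼 → ℝ) (φ ψ : 𝔼 → ℝ) : ℝ :=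
  (bilForm Q φ ψ + bilForm Q ψ φ) / 2

theorem bilForm_eq_setIntegral {Q : 𝔼 → 𝔼 → ℝ} {S : Set 𝔼} (hS : MeasurableSet S)
    (hQ : IntegrableOn (fun p : 𝔼 × 𝔼 => Q p.1 p.2) (S ×ˢ S) (volume.prod volume))
    {φ ψ : 𝔼 → ℝ} (hφ : Continuous φ) (hψ : Continuous ψ) {a b : ℝ} (ha : ∀ x, |φ x| ≤ a)
    (hb : ∀ x, |ψ x| ≤ b) (hφS : ∀ x ∉ S, φ x = 0) (hψS : ∀ x ∉ S, ψ x = 0) :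
    IntegrableOn (fun p : 𝔼 × 𝔼 => φ p.1 * ψ p.2 * Q p.1 p.2) (S ×ˢ S) (volume.prod volume) ∧
    bilForm Q φ ψ = ∫ p in S ×ˢ S, φ p.1 * ψ p.2 * Q p.1 p.2 ∂(volume.prod volume) := by
  have hint : IntegrableOn (fun p : 𝔼 × 𝔼 => φ p.1 * ψ p.2 * Q p.1 p.2) (S ×ˢ S)
      (volume.prod volume) := by
    refine Integrable.bdd_mul (c := a * b) hQ ?_ (ae_of_all _ fun p => ?_)
    · exact ((hφ.comp continuous_fst).mul (hψ.comp continuous_snd)).aestronglyMeasurable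
    · rw [norm_mul]
      exact mul_le_mul (ha _) (hb _) (norm_nonneg _) ((abs_nonneg _).trans (ha 0))
  refine ⟨hint, ?_⟩
  rw [setIntegral_prod _ hint, bilForm, ← setIntegral_eq_integral_of_forall_compl_eq_zero (s := S)]
  · refine setIntegral_congr_fun hS fun x _ => ?_
    refine (setIntegral_eq_integral_of_forall_compl_eq_zero fun y hy => ?_).symm
    rw [hψS y hy]; ring
  · intro x hx
    simp [hφS x hx]

variable {D : Set (EuclideanSpace ℝ (Fin d))}
  {K : EuclideanSpace ℝ (Fin d) → EuclideanSpace ℝ (Fin d) → ℝ}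
  {Q : ℕ → EuclideanSpace ℝ (Fin d) → EuclideanSpace ℝ (Fin d) → ℝ}

theorem HasNiceDecomposition.continuousOn' (hK : HasNiceDecomposition D K Q) (n : ℕ) :
    ContinuousOn (Function.uncurry (Q n)) (D ×ˢ D) := by
  rcases Nat.eq_zero_or_pos n with rfl | hn
  · obtain ⟨C, r, hr, h⟩ := hK.zero_holder
    exact h.continuousOn hr
  · exact hK.continuousOn n hn

theorem HasNiceDecomposition.isPosDefKernel (hK : HasNiceDecomposition D K Q) (n : ℕ) :
    IsPosDefKernel D (Q n) := by
  rcases Nat.eq_zero_or_pos n with rfl | hn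
  · exact hK.zero_posDef
  · exact hK.posDef n hn

/-- A uniform Lipschitz constant which also bounds all `Qₙ`, `n ≥ 1`. -/
theorem HasNiceDecomposition.exists_const (hK : HasNiceDecomposition D K Q) :
    ∃ L : ℝ, 1 ≤ L ∧ (∀ n, 1 ≤ n → ∀ x ∈ D, ∀ y ∈ D, Q n x y ≤ L) ∧
      ∀ n : ℕ, 1 ≤ n → ∀ x ∈ D, ∀ x' ∈ D, ∀ y ∈ D, ∀ y' ∈ D,
        |Q n x y - Q n x' y'| ≤ L * Real.exp n * (dist x x' + dist y y') := by
  obtain ⟨C, hC⟩ := hK.lipschitz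
  refine ⟨1 + |C|, by linarith [abs_nonneg C], fun n hn x hx y hy => ?_,
    fun n hn x hx x' hx' y hy y' hy' => (hC n hn x hx x' hx' y hy y' hy').trans ?_⟩
  · rcases le_or_gt (Real.exp (-(n : ℝ))) (dist x y) with h | h
    · rw [hK.finite_range n hn x hx y hy h]
      linarith [abs_nonneg C]
    · have h1 := hC n hn x hx x hx y hy x hx
      rw [hK.diag n hn x hx, dist_self, zero_add, dist_comm] at h1
      have h2 : C * Real.exp n * dist x y ≤ |C| := by
        calc C * Real.exp n * dist x y ≤ |C| * Real.exp n * Real.exp (-(n : ℝ)) := by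
              gcongr
              exact le_abs_self C
          _ = |C| := by rw [mul_assoc, ← Real.exp_add]; simp
      linarith [(abs_le.1 h1).2]
  · gcongr
    linarith [le_abs_self C]

theorem HasNiceDecomposition.integrableOn (hK : HasNiceDecomposition D K Q) {S : Set 𝔼}
    (hS : IsCompact S) (hSD : S ⊆ D) (n : ℕ) :
    IntegrableOn (fun p : 𝔼 × 𝔼 => Q n p.1 p.2) (S ×ˢ S) (volume.prod volume) :=
  ((hK.continuousOn' n).mono (prod_mono hSD hSD)).integrableOn_compact (hS.prod hS)

theorem volume_real_closedBall (x : 𝔼) {r : ℝ} (hr : 0 ≤ r) :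
    volume.real (Metric.closedBall x r) = r ^ d * volume.real (Metric.ball (0 : 𝔼) 1) := by
  rw [Measure.real, Measure.addHaar_closedBall _ _ hr, ENNReal.toReal_mul,
    ENNReal.toReal_ofReal (by positivity), finrank_euclideanSpace_fin]
  rfl

/-- The integral of `Qₙ(x, ·)` is at most of the order of the volume of a ball of radius
`exp (-n)`. -/
theorem HasNiceDecomposition.setIntegral_le (hK : HasNiceDecomposition D K Q) {S : Set 𝔼}
    (hS : IsCompact S) (hSD : S ⊆ D) {L : ℝ} (hL : 0 ≤ L)
    (hQL : ∀ n, 1 ≤ n → ∀ x ∈ D, ∀ y ∈ D, Q n x y ≤ L) {n : ℕ} (hn : 1 ≤ n) {x : 𝔼}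
    (hx : x ∈ D) :
    ∫ y in S, Q n x y ≤ L * volume.real (Metric.ball (0 : 𝔼) 1) * Real.exp (-(d * n : ℝ)) := by
  have hle : ∀ y ∈ S, Q n x y ≤
      (Metric.closedBall x (Real.exp (-(n : ℝ)))).indicator (fun _ => L) y := by
    intro y hy
    by_cases h : y ∈ Metric.closedBall x (Real.exp (-(n : ℝ)))
    · rw [indicator_of_mem h]; exact hQL n hn x hx y (hSD hy)
    · rw [indicator_of_notMem h]
      rw [Metric.mem_closedBall, not_le, dist_comm] at h
      exact (hK.finite_range n hn x hx y (hSD hy) h.le).le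
  have hfin : volume (Metric.closedBall x (Real.exp (-(n : ℝ)))) ≠ ∞ :=
    measure_closedBall_lt_top.ne
  have hind : Integrable
      ((Metric.closedBall x (Real.exp (-(n : ℝ)))).indicator (fun _ : 𝔼 => L)) volume :=
    (integrable_indicator_iff Metric.isClosed_closedBall.measurableSet).2
      (integrableOn_const hfin)
  have hQi : IntegrableOn (fun y => Q n x y) S := by
    have h1 : ContinuousOn (fun y => Q n x y) S :=
      (hK.continuousOn' n).comp (f := fun y => (x, y)) (by fun_prop) fun y hy => ⟨hx, hSD hy⟩
    exact h1.integrableOn_compact hS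
  calc ∫ y in S, Q n x y
      ≤ ∫ y in S, (Metric.closedBall x (Real.exp (-(n : ℝ)))).indicator (fun _ => L) y :=
        setIntegral_mono_on hQi hind.integrableOn hS.measurableSet hle
    _ ≤ ∫ y, (Metric.closedBall x (Real.exp (-(n : ℝ)))).indicator (fun _ => L) y :=
        setIntegral_le_integral hind (ae_of_all _ fun y => indicator_nonneg (fun _ _ => hL) y)
    _ = _ := by
        rw [integral_indicator Metric.isClosed_closedBall.measurableSet, setIntegral_const,
          volume_real_closedBall _ (Real.exp_pos _).le, ← Real.exp_nat_mul, smul_eq_mul]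
        rw [show (d : ℝ) * -(n : ℝ) = -(d * n : ℝ) by ring]
        ring

theorem summable_exp_neg_mul [NeZero d] : Summable fun n : ℕ => Real.exp (-(d * n : ℝ)) := by
  have hd : (0 : ℝ) < d := by exact_mod_cast Nat.pos_of_ne_zero (NeZero.ne d)
  have : ∀ n : ℕ, Real.exp (-(d * n : ℝ)) = Real.exp (-d) ^ n := by
    intro n
    rw [← Real.exp_nat_mul]; congr 1; ring
  simp only [this]
  exact summable_geometric_of_lt_one (Real.exp_pos _).le
    (Real.exp_zero ▸ Real.exp_lt_exp.2 (by linarith))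

theorem measure_prod_diagonal_eq_zero [NeZero d] :
    (volume.prod volume : Measure (𝔼 × 𝔼)) {p | p.1 = p.2} = 0 := by
  have : Nonempty (Fin d) := ⟨0⟩
  have hm : MeasurableSet {p : 𝔼 × 𝔼 | p.1 = p.2} :=
    measurableSet_eq_fun measurable_fst measurable_snd
  rw [Measure.measure_prod_null hm]
  refine ae_of_all _ fun x => ?_
  have : Prod.mk x ⁻¹' {p : 𝔼 × 𝔼 | p.1 = p.2} = {x} := by
    ext y; simp [eq_comm]
  simp [this]

/-- The decomposition of `K` may be integrated term by term against bounded weights. -/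
theorem HasNiceDecomposition.hasSum_setIntegral [NeZero d] (hK : HasNiceDecomposition D K Q)
    {S : Set 𝔼} (hS : IsCompact S) (hSD : S ⊆ D) {h : 𝔼 × 𝔼 → ℝ} (hh : Continuous h)
    {a : ℝ} (ha : ∀ p, |h p| ≤ a) :
    IntegrableOn (fun p => h p * K p.1 p.2) (S ×ˢ S) (volume.prod volume) ∧
    HasSum (fun n => ∫ p in S ×ˢ S, h p * Q n p.1 p.2 ∂(volume.prod volume))
      (∫ p in S ×ˢ S, h p * K p.1 p.2 ∂(volume.prod volume)) := by
  obtain ⟨L, hL1, hQL, -⟩ := hK.exists_const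
  have hL : 0 ≤ L := by linarith
  have ha0 : 0 ≤ a := (abs_nonneg _).trans (ha 0)
  have hSm := hS.measurableSet
  have hQi := fun n => hK.integrableOn hS hSD n
  have hint : ∀ n, IntegrableOn (fun p : 𝔼 × 𝔼 => h p * Q n p.1 p.2) (S ×ˢ S)
      (volume.prod volume) := fun n =>
    Integrable.bdd_mul (c := a) (hQi n) hh.aestronglyMeasurable (ae_of_all _ ha)
  refine integrable_and_hasSum_integral hint ?_ ?_
  · have hb : ∀ n : ℕ, ∫ p in S ×ˢ S, ‖h (p) * Q (n + 1) p.1 p.2‖ ∂(volume.prod volume) ≤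
        a * (volume.real S * (L * volume.real (Metric.ball (0 : 𝔼) 1))) *
          Real.exp (-(d * (n + 1 : ℕ) : ℝ)) := by
      intro n
      have hn : 1 ≤ n + 1 := by omega
      calc ∫ p in S ×ˢ S, ‖h p * Q (n + 1) p.1 p.2‖ ∂(volume.prod volume)
          ≤ ∫ p in S ×ˢ S, a * Q (n + 1) p.1 p.2 ∂(volume.prod volume) := by
            refine setIntegral_mono_on (hint _).norm ((hQi _).const_mul a) (hSm.prod hSm)
              fun p hp => ?_
            rw [norm_mul, Real.norm_eq_abs, Real.norm_eq_abs,
              abs_of_nonneg (hK.nonneg _ hn _ (hSD hp.1) _ (hSD hp.2))]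
            exact mul_le_mul_of_nonneg_right (ha p)
              (hK.nonneg _ hn _ (hSD hp.1) _ (hSD hp.2))
        _ = a * ∫ x in S, ∫ y in S, Q (n + 1) x y := by
            rw [integral_const_mul, setIntegral_prod _ (hQi _)]
        _ ≤ a * ∫ _x in S, L * volume.real (Metric.ball (0 : 𝔼) 1) *
              Real.exp (-(d * (n + 1 : ℕ) : ℝ)) := by
            refine mul_le_mul_of_nonneg_left ?_ ha0
            refine setIntegral_mono_on ?_ (integrableOn_const hS.measure_lt_top.ne) hSm
              fun x hx => hK.setIntegral_le hS hSD hL hQL hn (hSD hx)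
            have := hQi (n + 1)
            rw [IntegrableOn, ← Measure.prod_restrict] at this
            exact this.integral_prod_left
        _ = _ := by
            rw [setIntegral_const, smul_eq_mul]; ring
    rw [← summable_nat_add_iff 1]
    refine Summable.of_nonneg_of_le (fun n => integral_nonneg fun p => norm_nonneg _) hb ?_
    exact ((summable_nat_add_iff 1).2 (summable_exp_neg_mul (d := d))).mul_left _
  · have h1 : ∀ᵐ p ∂((volume.prod volume).restrict (S ×ˢ S) : Measure (𝔼 × 𝔼)), p.1 ≠ p.2 := by
      refine ae_restrict_of_ae ?_
      rw [ae_iff]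
      simpa using measure_prod_diagonal_eq_zero (d := d)
    filter_upwards [h1, ae_restrict_mem (hSm.prod hSm)] with p hp hpS
    exact (hK.hasSum _ (hSD hpS.1) _ (hSD hpS.2) hp).mul_left _

theorem HasNiceDecomposition.integrableOn_kernel [NeZero d] (hK : HasNiceDecomposition D K Q)
    {S : Set 𝔼} (hS : IsCompact S) (hSD : S ⊆ D) :
    IntegrableOn (fun p : 𝔼 × 𝔼 => K p.1 p.2) (S ×ˢ S) (volume.prod volume) := by
  simpa using (hK.hasSum_setIntegral hS hSD (h := fun _ => 1) continuous_const (a := 1)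
    (by simp)).1

/-- A non-negative continuous function of integral one vanishing off the closed ball of radius `ε`
around `x`, and bounded by `M ε^{-d}`. -/
structure IsMollifierAt (x : 𝔼) (ε M : ℝ) (φ : 𝔼 → ℝ) : Prop where
  continuous : Continuous φ
  nonneg : ∀ z, 0 ≤ φ z
  integral_eq_one : ∫ z, φ z = 1
  eq_zero : ∀ z, ε < dist z x → φ z = 0
  le : ∀ z, φ z ≤ M * (ε ^ d)⁻¹

end kernels

/-! ### Mollified covariances -/

section kernels

variable {d : ℕ}

local notation "𝔼" => EuclideanSpace ℝ (Fin d)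

theorem IsMollifierAt.abs_le {x : 𝔼} {ε M : ℝ} {φ : 𝔼 → ℝ} (hφ : IsMollifierAt x ε M φ) (z : 𝔼) :
    |φ z| ≤ M * (ε ^ d)⁻¹ := by
  rw [abs_of_nonneg (hφ.nonneg z)]; exact hφ.le z

theorem IsMollifierAt.integrable {x : 𝔼} {ε M : ℝ} {φ : 𝔼 → ℝ} (hφ : IsMollifierAt x ε M φ) :
    Integrable φ := by
  by_contra h
  have := hφ.integral_eq_one
  rw [integral_undef h] at this
  exact zero_ne_one this

theorem IsMollifierAt.setIntegral_eq_one {x : 𝔼} {ε M : ℝ} {φ : 𝔼 → ℝ}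
    (hφ : IsMollifierAt x ε M φ) {S : Set 𝔼} (hφS : ∀ z ∉ S, φ z = 0) : ∫ z in S, φ z = 1 := by
  rw [setIntegral_eq_integral_of_forall_compl_eq_zero hφS, hφ.integral_eq_one]

section estimates

variable {S : Set (EuclideanSpace ℝ (Fin d))} {x x' : EuclideanSpace ℝ (Fin d)} {ε ε' M M' : ℝ}
  {φ ψ : EuclideanSpace ℝ (Fin d) → ℝ}

/-- `bilForm Q φ ψ` is an average of `Q` over the product of the supports. -/
theorem abs_bilForm_sub_le {Q : 𝔼 → 𝔼 → ℝ} (hS : MeasurableSet S)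
    (hQ : IntegrableOn (fun p : 𝔼 × 𝔼 => Q p.1 p.2) (S ×ˢ S) (volume.prod volume))
    (hφ : IsMollifierAt x ε M φ) (hψ : IsMollifierAt x' ε' M' ψ)
    (hφS : ∀ z ∉ S, φ z = 0) (hψS : ∀ z ∉ S, ψ z = 0) {c η : ℝ}
    (hη : ∀ z ∈ S, ∀ z' ∈ S, dist z x ≤ ε → dist z' x' ≤ ε' → |Q z z' - c| ≤ η) :
    |bilForm Q φ ψ - c| ≤ η := by
  obtain ⟨hi, he⟩ := bilForm_eq_setIntegral hS hQ hφ.continuous hψ.continuous hφ.abs_le hψ.abs_le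
    hφS hψS
  have hpi : IntegrableOn (fun p : 𝔼 × 𝔼 => φ p.1 * ψ p.2) (S ×ˢ S) (volume.prod volume) :=
    (hφ.integrable.mul_prod hψ.integrable).integrableOn
  have h1 : ∫ p in S ×ˢ S, φ p.1 * ψ p.2 ∂(volume.prod volume) = 1 := by
    rw [setIntegral_prod_mul, hφ.setIntegral_eq_one hφS, hψ.setIntegral_eq_one hψS, one_mul]
  have h2 : bilForm Q φ ψ - c =
      ∫ p in S ×ˢ S, φ p.1 * ψ p.2 * (Q p.1 p.2 - c) ∂(volume.prod volume) := by
    simp only [mul_sub]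
    rw [he, integral_sub hi (hpi.mul_const c), integral_mul_const, h1, one_mul]
  rw [h2, ← Real.norm_eq_abs]
  calc ‖∫ p in S ×ˢ S, φ p.1 * ψ p.2 * (Q p.1 p.2 - c) ∂(volume.prod volume)‖
      ≤ ∫ p in S ×ˢ S, φ p.1 * ψ p.2 * η ∂(volume.prod volume) := by
        refine norm_integral_le_of_norm_le (hpi.mul_const η) ?_
        filter_upwards [ae_restrict_mem (hS.prod hS)] with p hp
        rw [norm_mul, norm_mul, Real.norm_of_nonneg (hφ.nonneg _),
          Real.norm_of_nonneg (hψ.nonneg _), Real.norm_eq_abs]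
        by_cases h3 : dist p.1 x ≤ ε
        · by_cases h4 : dist p.2 x' ≤ ε'
          · exact mul_le_mul_of_nonneg_left (hη _ hp.1 _ hp.2 h3 h4)
              (mul_nonneg (hφ.nonneg _) (hψ.nonneg _))
          · rw [hψ.eq_zero _ (not_le.1 h4)]; simp
        · rw [hφ.eq_zero _ (not_le.1 h3)]; simp
    _ = η := by rw [integral_mul_const, h1, one_mul]

theorem abs_symForm_sub_le {Q : 𝔼 → 𝔼 → ℝ} (hS : MeasurableSet S)
    (hQ : IntegrableOn (fun p : 𝔼 × 𝔼 => Q p.1 p.2) (S ×ˢ S) (volume.prod volume))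
    (hφ : IsMollifierAt x ε M φ) (hψ : IsMollifierAt x' ε' M' ψ)
    (hφS : ∀ z ∉ S, φ z = 0) (hψS : ∀ z ∉ S, ψ z = 0) {c η : ℝ}
    (hη : ∀ z ∈ S, ∀ z' ∈ S, dist z x ≤ ε → dist z' x' ≤ ε' →
      |Q z z' - c| ≤ η ∧ |Q z' z - c| ≤ η) :
    |symForm Q φ ψ - c| ≤ η := by
  have h1 := abs_bilForm_sub_le hS hQ hφ hψ hφS hψS
    fun z hz z' hz' h h' => (hη z hz z' hz' h h').1
  have h2 := abs_bilForm_sub_le hS hQ hψ hφ hψS hφS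
    fun z hz z' hz' h h' => (hη z' hz' z hz h' h).2
  rw [abs_le] at h1 h2 ⊢
  rw [symForm]
  constructor <;> linarith [h1.1, h1.2, h2.1, h2.2]

end estimates

variable {D : Set (EuclideanSpace ℝ (Fin d))}
  {K : EuclideanSpace ℝ (Fin d) → EuclideanSpace ℝ (Fin d) → ℝ}
  {Q : ℕ → EuclideanSpace ℝ (Fin d) → EuclideanSpace ℝ (Fin d) → ℝ}
  {S : Set (EuclideanSpace ℝ (Fin d))} {x x' : EuclideanSpace ℝ (Fin d)} {ε ε' M M' : ℝ}
  {φ ψ : EuclideanSpace ℝ (Fin d) → ℝ}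

theorem HasNiceDecomposition.hasSum_bilForm [NeZero d] (hK : HasNiceDecomposition D K Q)
    (hS : IsCompact S) (hSD : S ⊆ D) (hφ : IsMollifierAt x ε M φ) (hψ : IsMollifierAt x' ε' M' ψ)
    (hφS : ∀ z ∉ S, φ z = 0) (hψS : ∀ z ∉ S, ψ z = 0) :
    HasSum (fun n => bilForm (Q n) φ ψ) (bilForm K φ ψ) := by
  have h1 := (hK.hasSum_setIntegral hS hSD (h := fun p => φ p.1 * ψ p.2)
    ((hφ.continuous.comp continuous_fst).mul (hψ.continuous.comp continuous_snd))
    (a := M * (ε ^ d)⁻¹ * (M' * (ε' ^ d)⁻¹)) (fun p => by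
      rw [abs_mul]
      exact mul_le_mul (hφ.abs_le _) (hψ.abs_le _) (abs_nonneg _)
        ((abs_nonneg _).trans (hφ.abs_le 0)))).2
  rw [(bilForm_eq_setIntegral hS.measurableSet (hK.integrableOn_kernel hS hSD) hφ.continuous
    hψ.continuous hφ.abs_le hψ.abs_le hφS hψS).2]
  convert h1 using 2 with n
  exact (bilForm_eq_setIntegral hS.measurableSet (hK.integrableOn hS hSD n) hφ.continuous
    hψ.continuous hφ.abs_le hψ.abs_le hφS hψS).2

theorem HasNiceDecomposition.hasSum_symForm [NeZero d] (hK : HasNiceDecomposition D K Q)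
    (hS : IsCompact S) (hSD : S ⊆ D) (hφ : IsMollifierAt x ε M φ) (hψ : IsMollifierAt x' ε' M' ψ)
    (hφS : ∀ z ∉ S, φ z = 0) (hψS : ∀ z ∉ S, ψ z = 0) :
    HasSum (fun n => symForm (Q n) φ ψ) (symForm K φ ψ) :=
  ((hK.hasSum_bilForm hS hSD hφ hψ hφS hψS).add
    (hK.hasSum_bilForm hS hSD hψ hφ hψS hφS)).div_const 2

/-- At levels finer than the scale of the mollifiers, the mollified covariance is small because the
kernel has short range while the mollifiers have bounded density. -/
theorem HasNiceDecomposition.bilForm_nonneg_le (hK : HasNiceDecomposition D K Q)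
    (hS : IsCompact S) (hSD : S ⊆ D) (hφ : IsMollifierAt x ε M φ) (hψ : IsMollifierAt x' ε' M' ψ)
    (hφS : ∀ z ∉ S, φ z = 0) (hψS : ∀ z ∉ S, ψ z = 0) {L : ℝ} (hL : 0 ≤ L)
    (hQL : ∀ n, 1 ≤ n → ∀ x ∈ D, ∀ y ∈ D, Q n x y ≤ L) {n : ℕ} (hn : 1 ≤ n) :
    0 ≤ bilForm (Q n) φ ψ ∧ bilForm (Q n) φ ψ ≤ M' * (ε' ^ d)⁻¹ *
      (L * volume.real (Metric.ball (0 : 𝔼) 1) * Real.exp (-(d * n : ℝ))) := by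
  have hSm := hS.measurableSet
  obtain ⟨hi, he⟩ := bilForm_eq_setIntegral hSm (hK.integrableOn hS hSD n) hφ.continuous
    hψ.continuous hφ.abs_le hψ.abs_le hφS hψS
  set a := M' * (ε' ^ d)⁻¹
  have ha : 0 ≤ a := (hψ.nonneg 0).trans (hψ.le 0)
  constructor
  · rw [he]
    refine setIntegral_nonneg (hSm.prod hSm) fun p hp => ?_
    exact mul_nonneg (mul_nonneg (hφ.nonneg _) (hψ.nonneg _))
      (hK.nonneg n hn _ (hSD hp.1) _ (hSD hp.2))
  · rw [he, setIntegral_prod _ hi]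
    have hQx : ∀ x ∈ S, IntegrableOn (fun y => Q n x y) S := by
      intro x hx
      have h1 : ContinuousOn (fun y => Q n x y) S :=
        (hK.continuousOn' n).comp (f := fun y => (x, y)) (by fun_prop) fun y hy =>
          ⟨hSD hx, hSD hy⟩
      exact h1.integrableOn_compact hS
    have hin : ∀ x ∈ S, ∫ y in S, φ x * ψ y * Q n x y ≤ φ x * (a *
        (L * volume.real (Metric.ball (0 : 𝔼) 1) * Real.exp (-(d * n : ℝ)))) := by
      intro x hx
      simp only [mul_assoc]
      rw [integral_const_mul]
      refine mul_le_mul_of_nonneg_left ?_ (hφ.nonneg x)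
      calc ∫ y in S, ψ y * Q n x y ≤ ∫ y in S, a * Q n x y := by
            refine setIntegral_mono_on ?_ ((hQx x hx).const_mul a) hSm fun y hy => ?_
            · exact Integrable.bdd_mul (c := a) (hQx x hx) hψ.continuous.aestronglyMeasurable
                (ae_of_all _ hψ.abs_le)
            · exact mul_le_mul_of_nonneg_right (hψ.le y) (hK.nonneg n hn _ (hSD hx) _ (hSD hy))
        _ = a * ∫ y in S, Q n x y := integral_const_mul _ _
        _ ≤ _ := by
            refine mul_le_mul_of_nonneg_left ?_ ha
            simpa only [mul_assoc] using hK.setIntegral_le hS hSD hL hQL hn (hSD hx)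
    calc ∫ x in S, ∫ y in S, φ x * ψ y * Q n x y
        ≤ ∫ x in S, φ x * (a *
          (L * volume.real (Metric.ball (0 : 𝔼) 1) * Real.exp (-(d * n : ℝ)))) := by
          refine setIntegral_mono_on ?_ (hφ.integrable.integrableOn.mul_const _) hSm hin
          rw [IntegrableOn, ← Measure.prod_restrict] at hi
          exact hi.integral_prod_left
      _ = _ := by rw [integral_mul_const, hφ.setIntegral_eq_one hφS, one_mul]

/-- The levels of the covariance of finitely many mollified values are positive semidefinite. -/
theorem HasNiceDecomposition.posSemidef (hK : HasNiceDecomposition D K Q)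
    (hS : IsCompact S) (hSD : S ⊆ D) {ι : Type*} [Fintype ι] {x : ι → 𝔼} {ε M : ι → ℝ}
    {φ : ι → 𝔼 → ℝ} (hφ : ∀ i, IsMollifierAt (x i) (ε i) (M i) (φ i))
    (hφS : ∀ i, ∀ z ∉ S, φ i z = 0) (n : ℕ) :
    (Matrix.of fun i j => symForm (Q n) (φ i) (φ j)).PosSemidef := by
  have hSm := hS.measurableSet
  refine Matrix.PosSemidef.of_dotProduct_mulVec_nonneg ?_ fun c => ?_
  · ext i j
    simp [symForm, add_comm]
  have hb := fun i j => bilForm_eq_setIntegral hSm (hK.integrableOn hS hSD n) (hφ i).continuous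
    (hφ j).continuous (hφ i).abs_le (hφ j).abs_le (hφS i) (hφS j)
  set g : 𝔼 → ℝ := fun z => ∑ i, c i * φ i z with hg
  have hgc : Continuous g := continuous_finsetSum _ fun i _ =>
    continuous_const.mul (hφ i).continuous
  have hg0 : ∀ z ∉ S, g z = 0 := by
    intro z hz
    simp [hg, hφS _ z hz]
  have hgs : tsupport g ⊆ S :=
    closure_minimal (fun z hz => by_contra fun h => hz (hg0 z h)) hS.isClosed
  have hpos := hK.isPosDefKernel n g hgc (hS.of_isClosed_subset (isClosed_tsupport g) hgs)
    (hgs.trans hSD)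
  have hgi : IntegrableOn (fun p : 𝔼 × 𝔼 => Q n p.1 p.2 * g p.1 * g p.2) (S ×ˢ S)
      (volume.prod volume) := by
    have : (fun p : 𝔼 × 𝔼 => Q n p.1 p.2 * g p.1 * g p.2) = fun p =>
        ∑ i, ∑ j, c i * c j * (φ i p.1 * φ j p.2 * Q n p.1 p.2) := by
      ext p
      simp only [hg]
      rw [mul_assoc, Finset.sum_mul_sum, Finset.mul_sum]
      refine Finset.sum_congr rfl fun i _ => ?_
      rw [Finset.mul_sum]
      exact Finset.sum_congr rfl fun j _ => by ring
    rw [this]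
    exact integrable_finsetSum _ fun i _ => integrable_finsetSum _ fun j _ =>
      ((hb i j).1.const_mul _)
  have hval : ∫ x in D, ∫ y in D, Q n x y * g x * g y =
      ∑ i, ∑ j, c i * c j * bilForm (Q n) (φ i) (φ j) := by
    have h1 : ∫ x in D, ∫ y in D, Q n x y * g x * g y =
        ∫ x in S, ∫ y in S, Q n x y * g x * g y := by
      have h2 : ∀ x, ∫ y in D, Q n x y * g x * g y = ∫ y in S, Q n x y * g x * g y := by
        intro x
        rw [setIntegral_eq_integral_of_forall_compl_eq_zero (s := D),
          setIntegral_eq_integral_of_forall_compl_eq_zero (s := S)]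
        · intro y hy; rw [hg0 y hy, mul_zero]
        · intro y hy; rw [hg0 y fun h => hy (hSD h), mul_zero]
      simp only [h2]
      rw [setIntegral_eq_integral_of_forall_compl_eq_zero (s := D),
        setIntegral_eq_integral_of_forall_compl_eq_zero (s := S)]
      · intro y hy; simp [hg0 y hy]
      · intro y hy; simp [hg0 y fun h => hy (hSD h)]
    rw [h1, ← setIntegral_prod (fun p : 𝔼 × 𝔼 => Q n p.1 p.2 * g p.1 * g p.2) hgi]
    have h3 : ∀ p : 𝔼 × 𝔼, Q n p.1 p.2 * g p.1 * g p.2 =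
        ∑ i, ∑ j, c i * c j * (φ i p.1 * φ j p.2 * Q n p.1 p.2) := by
      intro p
      simp only [hg]
      rw [mul_assoc, Finset.sum_mul_sum, Finset.mul_sum]
      refine Finset.sum_congr rfl fun i _ => ?_
      rw [Finset.mul_sum]
      exact Finset.sum_congr rfl fun j _ => by ring
    simp only [h3]
    rw [integral_finsetSum _ fun i _ => integrable_finsetSum _ fun j _ =>
      ((hb i j).1.const_mul _)]
    refine Finset.sum_congr rfl fun i _ => ?_
    rw [integral_finsetSum _ fun j _ => ((hb i j).1.const_mul _)]
    refine Finset.sum_congr rfl fun j _ => ?_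
    rw [integral_const_mul, (hb i j).2]
  rw [hval] at hpos
  have hsym : ∑ i, ∑ j, c i * c j * bilForm (Q n) (φ j) (φ i) =
      ∑ i, ∑ j, c i * c j * bilForm (Q n) (φ i) (φ j) := by
    rw [Finset.sum_comm]
    exact Finset.sum_congr rfl fun i _ => Finset.sum_congr rfl fun j _ => by ring
  have hfin : star c ⬝ᵥ (Matrix.of (fun i j => symForm (Q n) (φ i) (φ j))).mulVec c =
      ∑ i, ∑ j, c i * c j * bilForm (Q n) (φ i) (φ j) := by
    have : star c ⬝ᵥ (Matrix.of (fun i j => symForm (Q n) (φ i) (φ j))).mulVec c =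
        (∑ i, ∑ j, c i * c j * bilForm (Q n) (φ i) (φ j) +
          ∑ i, ∑ j, c i * c j * bilForm (Q n) (φ j) (φ i)) / 2 := by
      simp only [dotProduct, Matrix.mulVec, Matrix.of_apply, star_trivial, symForm]
      rw [← Finset.sum_add_distrib, Finset.sum_div]
      refine Finset.sum_congr rfl fun i _ => ?_
      rw [← Finset.sum_add_distrib, Finset.sum_div, Finset.mul_sum]
      exact Finset.sum_congr rfl fun j _ => by ring
    rw [this, hsym]
    ring
  rw [hfin]
  exact hpos

theorem withDensityᵥ_eq_toSignedMeasure {f : 𝔼 → ℝ} (hf0 : ∀ x, 0 ≤ f x) (hf : Integrable f)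
    [IsFiniteMeasure ((volume : Measure 𝔼).withDensity fun x => ENNReal.ofReal (f x))] :
    (volume : Measure 𝔼).withDensityᵥ f =
      ((volume : Measure 𝔼).withDensity fun x => ENNReal.ofReal (f x)).toSignedMeasure := by
  have h1 : f = fun x => (ENNReal.ofReal (f x)).toReal := by
    ext x; rw [ENNReal.toReal_ofReal (hf0 x)]
  have h2 := withDensityᵥ_toReal (μ := (volume : Measure 𝔼))
    (f := fun x => ENNReal.ofReal (f x)) hf.aemeasurable.ennreal_ofReal
    hf.lintegral_lt_top.ne
  conv_lhs => rw [h1]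
  exact h2

/-- On measures with densities, `kernelForm` is the bilinear form on the densities. -/
theorem kernelForm_withDensityᵥ {f g : 𝔼 → ℝ} (hf0 : ∀ x, 0 ≤ f x) (hf : Integrable f)
    (hfm : Measurable f) (hg0 : ∀ x, 0 ≤ g x) (hg : Integrable g) (hgm : Measurable g)
    (K : 𝔼 → 𝔼 → ℝ) :
    kernelForm K (volume.withDensityᵥ f) (volume.withDensityᵥ g) = bilForm K f g := by
  have := isFiniteMeasure_withDensity_ofReal hf.2
  have := isFiniteMeasure_withDensity_ofReal hg.2
  have hd : ∀ {h : 𝔼 → ℝ} (_ : ∀ x, 0 ≤ h x) (_ : Measurable h) (k : 𝔼 → ℝ),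
      ∫ x, k x ∂((volume : Measure 𝔼).withDensity fun x => ENNReal.ofReal (h x)) =
        ∫ x, h x * k x := by
    intro h h0 hm k
    rw [integral_withDensity_eq_integral_toReal_smul hm.ennreal_ofReal (by simp)]
    refine integral_congr_ae (ae_of_all _ fun x => ?_)
    simp only [smul_eq_mul]
    rw [ENNReal.toReal_ofReal (h0 x)]
  rw [kernelForm, withDensityᵥ_eq_toSignedMeasure hf0 hf, withDensityᵥ_eq_toSignedMeasure hg0 hg]
  simp only [VectorMeasure.integral_toSignedMeasure]
  rw [hd hf0 hfm, bilForm]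
  refine integral_congr_ae (ae_of_all _ fun x => ?_)
  simp only
  rw [hd hg0 hgm, ← integral_const_mul]
  simp only [mul_assoc]

theorem HasNiceDecomposition.mem_energySpace [NeZero d] (hK : HasNiceDecomposition D K Q)
    (hS : IsCompact S) (hSD : S ⊆ D) (hφ : IsMollifierAt x ε M φ) (hφS : ∀ z ∉ S, φ z = 0) :
    (volume : Measure 𝔼).withDensityᵥ φ ∈ energySpace D K := by
  have hne : Nonempty (Fin d) := ⟨0⟩
  have hfin := isFiniteMeasure_withDensity_ofReal hφ.integrable.2
  have hm : Measurable fun z => ENNReal.ofReal (φ z) := hφ.continuous.measurable.ennreal_ofReal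
  refine ⟨_, 0, hfin, inferInstance, ⟨⟨S, hS, hSD, ?_⟩, ?_⟩, ⟨⟨∅, isCompact_empty,
    empty_subset _, by simp⟩, by simp⟩, ?_⟩
  · rw [withDensity_apply _ hS.measurableSet.compl]
    refine setLIntegral_eq_zero hS.measurableSet.compl fun z hz => ?_
    simp [hφS z hz]
  · have hd : ∀ k : 𝔼 → ℝ≥0∞, ∫⁻ z, k z ∂((volume : Measure 𝔼).withDensity fun z =>
        ENNReal.ofReal (φ z)) = ∫⁻ z, ENNReal.ofReal (φ z) * k z := by
      intro k
      exact lintegral_withDensity_eq_lintegral_mul_non_measurable _ hm (by simp) k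
    simp only [hd]
    obtain ⟨hi, -⟩ := bilForm_eq_setIntegral hS.measurableSet (hK.integrableOn_kernel hS hSD)
      hφ.continuous hφ.continuous hφ.abs_le hφ.abs_le hφS hφS
    have hi2 := hi.2
    rw [HasFiniteIntegral] at hi2
    refine lt_of_le_of_lt ?_ hi2
    rw [IntegrableOn] at hi
    rw [← Measure.prod_restrict] at hi ⊢
    rw [lintegral_prod _ hi.aestronglyMeasurable.enorm,
      ← lintegral_indicator hS.measurableSet]
    refine lintegral_mono fun z => ?_
    by_cases hz : z ∈ S
    · rw [indicator_of_mem hz, ← lintegral_indicator hS.measurableSet,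
        ← lintegral_const_mul' _ _ ENNReal.ofReal_ne_top]
      have hae : ∀ᵐ y ∂(volume : Measure 𝔼), z ≠ y := by
        rw [ae_iff]
        simp
      refine lintegral_mono_ae (hae.mono fun y hy => ?_)
      by_cases hyS : y ∈ S
      · rw [indicator_of_mem hyS, kernelAbs, if_neg hy, enorm_mul, enorm_mul,
          Real.enorm_eq_ofReal (hφ.nonneg _), Real.enorm_eq_ofReal (hφ.nonneg _),
          Real.enorm_eq_ofReal_abs, mul_assoc]
      · rw [hφS y hyS]; simp
    · rw [hφS z hz]; simp
  · rw [withDensityᵥ_eq_toSignedMeasure hφ.nonneg hφ.integrable]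
    simp

end kernels

/-! ### Levels of the mollified covariance -/

/-- The tail of a convergent series of positive semidefinite matrices is positive semidefinite. -/
theorem posSemidef_sub_sum_range {ι : Type*} [Fintype ι] {C : ℕ → ι → ι → ℝ} {T : ι → ι → ℝ}
    (hC : ∀ k, (Matrix.of (C k)).PosSemidef) (hT : ∀ i j, HasSum (fun k => C k i j) (T i j))
    (n : ℕ) :
    (Matrix.of fun i j => T i j - ∑ k ∈ Finset.range n, C k i j).PosSemidef := by
  have hsym : ∀ k i j, C k j i = C k i j := fun k i j => by
    simpa using (hC k).isHermitian.apply i j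
  have hTs : ∀ i j, T j i = T i j := by
    intro i j
    have h1 := hT j i
    simp only [hsym] at h1
    exact h1.unique (hT i j)
  refine Matrix.PosSemidef.of_dotProduct_mulVec_nonneg ?_ fun c => ?_
  · ext i j
    simp [hTs i j, hsym]
  have hq : ∀ U : ι → ι → ℝ, star c ⬝ᵥ (Matrix.of U).mulVec c =
      ∑ i, ∑ j, c i * c j * U i j := by
    intro U
    simp only [dotProduct, Matrix.mulVec, Matrix.of_apply, star_trivial]
    refine Finset.sum_congr rfl fun i _ => ?_
    rw [Finset.mul_sum]
    exact Finset.sum_congr rfl fun j _ => by ring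
  rw [hq]
  have h1 : HasSum (fun k => ∑ i, ∑ j, c i * c j * C k i j) (∑ i, ∑ j, c i * c j * T i j) :=
    hasSum_sum fun i _ => hasSum_sum fun j _ => (hT i j).mul_left _
  have h2 : ∀ k, 0 ≤ ∑ i, ∑ j, c i * c j * C k i j := fun k => by
    rw [← hq]; exact (hC k).dotProduct_mulVec_nonneg c
  have h3 := sum_le_hasSum (Finset.range n) (fun k _ => h2 k) h1
  have h4 : ∑ i, ∑ j, c i * c j * (T i j - ∑ k ∈ Finset.range n, C k i j) =
      ∑ i, ∑ j, c i * c j * T i j - ∑ k ∈ Finset.range n, ∑ i, ∑ j, c i * c j * C k i j := by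
    rw [Finset.sum_comm (s := Finset.range n), ← Finset.sum_sub_distrib]
    refine Finset.sum_congr rfl fun i _ => ?_
    rw [Finset.sum_comm (s := Finset.range n), ← Finset.sum_sub_distrib]
    refine Finset.sum_congr rfl fun j _ => ?_
    rw [mul_sub, Finset.mul_sum]
  rw [h4]
  linarith

section levels

variable {d : ℕ}

local notation "𝔼" => EuclideanSpace ℝ (Fin d)

variable {D : Set (EuclideanSpace ℝ (Fin d))}
  {K : EuclideanSpace ℝ (Fin d) → EuclideanSpace ℝ (Fin d) → ℝ}
  {Q : ℕ → EuclideanSpace ℝ (Fin d) → EuclideanSpace ℝ (Fin d) → ℝ}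
  {S : Set (EuclideanSpace ℝ (Fin d))} {x x' : EuclideanSpace ℝ (Fin d)} {ε ε' M M' : ℝ}
  {φ ψ : EuclideanSpace ℝ (Fin d) → ℝ}

theorem HasNiceDecomposition.abs_symForm_le (hK : HasNiceDecomposition D K Q)
    (hS : IsCompact S) (hSD : S ⊆ D) (hφ : IsMollifierAt x ε M φ) (hψ : IsMollifierAt x' ε' M' ψ)
    (hφS : ∀ z ∉ S, φ z = 0) (hψS : ∀ z ∉ S, ψ z = 0) {L : ℝ}
    (hQL : ∀ n, 1 ≤ n → ∀ x ∈ D, ∀ y ∈ D, Q n x y ≤ L) {n : ℕ} (hn : 1 ≤ n) :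
    |symForm (Q n) φ ψ| ≤ L := by
  have := abs_symForm_sub_le hS.measurableSet (hK.integrableOn hS hSD n) hφ hψ hφS hψS (c := 0)
    (η := L) (fun z hz z' hz' _ _ => by
      have hz := hSD hz
      have hz' := hSD hz'
      rw [sub_zero, sub_zero, abs_of_nonneg (hK.nonneg n hn _ hz _ hz'),
        abs_of_nonneg (hK.nonneg n hn _ hz' _ hz)]
      exact ⟨hQL n hn _ hz _ hz', hQL n hn _ hz' _ hz⟩)
  rwa [sub_zero] at this

theorem HasNiceDecomposition.symForm_eq_zero (hK : HasNiceDecomposition D K Q)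
    (hS : IsCompact S) (hSD : S ⊆ D) (hφ : IsMollifierAt x ε M φ) (hψ : IsMollifierAt x' ε' M' ψ)
    (hφS : ∀ z ∉ S, φ z = 0) (hψS : ∀ z ∉ S, ψ z = 0) {n : ℕ} (hn : 1 ≤ n)
    (hx : Real.exp (-(n : ℝ)) + ε + ε' ≤ dist x x') :
    symForm (Q n) φ ψ = 0 := by
  have := abs_symForm_sub_le hS.measurableSet (hK.integrableOn hS hSD n) hφ hψ hφS hψS (c := 0)
    (η := 0) (fun z hz z' hz' h h' => by
      have hz := hSD hz
      have hz' := hSD hz'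
      have h1 : Real.exp (-(n : ℝ)) ≤ dist z z' := by
        have h2 := dist_triangle4 x z z' x'
        rw [dist_comm x z] at h2
        linarith
      rw [hK.finite_range n hn _ hz _ hz' h1,
        hK.finite_range n hn _ hz' _ hz (by rwa [dist_comm])]
      simp)
  simpa using this

/-- The variance of the first `k` levels of the mollified field exceeds `k` by a bounded amount as
long as `exp k ≤ 1 / ε`. -/
theorem HasNiceDecomposition.sum_symForm_le (hK : HasNiceDecomposition D K Q)
    (hS : IsCompact S) (hSD : S ⊆ D) (hφ : IsMollifierAt x ε M φ)
    (hφS : ∀ z ∉ S, φ z = 0) {L B₀ : ℝ} (hL : 0 ≤ L) (hε : 0 ≤ ε)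
    (hB₀ : ∀ z ∈ S, ∀ z' ∈ S, |Q 0 z z'| ≤ B₀)
    (hLip : ∀ n : ℕ, 1 ≤ n → ∀ x ∈ D, ∀ x' ∈ D, ∀ y ∈ D, ∀ y' ∈ D,
        |Q n x y - Q n x' y'| ≤ L * Real.exp n * (dist x x' + dist y y')) (k : ℕ) :
    ∑ j ∈ Finset.range (k + 1), symForm (Q j) φ φ ≤ k + B₀ + 4 * L * (ε * Real.exp k) := by
  induction k with
  | zero =>
    have h0 := abs_symForm_sub_le hS.measurableSet (hK.integrableOn hS hSD 0) hφ hφ hφS hφS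
      (c := 0) (η := B₀) (fun z hz z' hz' _ _ => by
        rw [sub_zero, sub_zero]; exact ⟨hB₀ z hz z' hz', hB₀ z' hz' z hz⟩)
    rw [sub_zero] at h0
    have : 0 ≤ 4 * L * (ε * Real.exp (0 : ℕ)) := by positivity
    simp only [zero_add, Finset.range_one, Finset.sum_singleton]
    have := (abs_le.1 h0).2
    push_cast
    push_cast at *
    linarith
  | succ k ih =>
    rw [Finset.sum_range_succ]
    have hn : 1 ≤ k + 1 := by omega
    have h1 := abs_symForm_sub_le hS.measurableSet (hK.integrableOn hS hSD (k + 1)) hφ hφ hφS hφS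
      (c := 1) (η := L * Real.exp (k + 1 : ℕ) * (2 * ε)) (fun z hz z' hz' h h' => by
        have hz := hSD hz
        have hz' := hSD hz'
        have hd : dist z z' ≤ 2 * ε := by
          have := dist_triangle_right z z' x
          linarith
        have e1 := hLip (k + 1) hn z hz z hz z' hz' z hz
        have e2 := hLip (k + 1) hn z' hz' z hz z hz z hz
        rw [hK.diag _ hn z hz, dist_self, zero_add, dist_comm] at e1
        rw [hK.diag _ hn z hz, dist_self, add_zero, dist_comm] at e2
        have hle : L * Real.exp (k + 1 : ℕ) * dist z z' ≤ L * Real.exp (k + 1 : ℕ) * (2 * ε) :=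
          mul_le_mul_of_nonneg_left hd (by positivity)
        exact ⟨e1.trans hle, e2.trans hle⟩)
    have h2 := (abs_le.1 h1).2
    have h3 : 2 * Real.exp k ≤ Real.exp (k + 1 : ℕ) := by
      push_cast
      rw [Real.exp_add, mul_comm]
      refine mul_le_mul_of_nonneg_left ?_ (Real.exp_pos _).le
      linarith [Real.add_one_le_exp 1]
    have h4 : 2 * L * ε * (2 * Real.exp k) ≤ 2 * L * ε * Real.exp (k + 1 : ℕ) :=
      mul_le_mul_of_nonneg_left h3 (by positivity)
    push_cast at h2 h3 h4 ⊢
    linarith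

/-- The levels `j ≥ m + 1` of the mollified covariance have a bounded sum when
`exp (-(m + 1)) ≤ ε`. -/
theorem HasNiceDecomposition.abs_symForm_sub_sum_le [NeZero d] (hK : HasNiceDecomposition D K Q)
    (hS : IsCompact S) (hSD : S ⊆ D) (hφ : IsMollifierAt x ε M φ) (hψ : IsMollifierAt x' ε M ψ)
    (hφS : ∀ z ∉ S, φ z = 0) (hψS : ∀ z ∉ S, ψ z = 0) {L : ℝ} (hL : 0 ≤ L) (hM : 0 ≤ M)
    (hQL : ∀ n, 1 ≤ n → ∀ x ∈ D, ∀ y ∈ D, Q n x y ≤ L) {m : ℕ} (hε : 0 < ε)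
    (hm : Real.exp (-(m + 1 : ℝ)) ≤ ε) :
    |symForm K φ ψ - ∑ j ∈ Finset.range (m + 1), symForm (Q j) φ ψ| ≤
      M * L * volume.real (Metric.ball (0 : 𝔼) 1) * ∑' n : ℕ, Real.exp (-(d * n : ℝ)) := by
  have h1 := (hasSum_nat_add_iff' (m + 1)).2 (hK.hasSum_symForm hS hSD hφ hψ hφS hψS)
  have hb : ∀ n, 0 ≤ symForm (Q (n + (m + 1))) φ ψ ∧ symForm (Q (n + (m + 1))) φ ψ ≤
      M * L * volume.real (Metric.ball (0 : 𝔼) 1) * Real.exp (-(d * n : ℝ)) := by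
    intro n
    obtain ⟨a1, a2⟩ := hK.bilForm_nonneg_le hS hSD hφ hψ hφS hψS hL hQL
      (n := n + (m + 1)) (by omega)
    obtain ⟨b1, b2⟩ := hK.bilForm_nonneg_le hS hSD hψ hφ hψS hφS hL hQL
      (n := n + (m + 1)) (by omega)
    have hle : M * (ε ^ d)⁻¹ * (L * volume.real (Metric.ball (0 : 𝔼) 1) *
        Real.exp (-(d * (n + (m + 1) : ℕ) : ℝ))) ≤
        M * L * volume.real (Metric.ball (0 : 𝔼) 1) * Real.exp (-(d * n : ℝ)) := by
      have e1 : Real.exp (-(d * (n + (m + 1) : ℕ) : ℝ)) =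
          Real.exp (-(d * n : ℝ)) * Real.exp (-(m + 1 : ℝ)) ^ d := by
        rw [← Real.exp_nat_mul, ← Real.exp_add]
        congr 1
        push_cast
        ring
      have e2 : (ε ^ d)⁻¹ * Real.exp (-(m + 1 : ℝ)) ^ d ≤ 1 := by
        rw [inv_mul_le_one₀ (by positivity)]
        exact pow_le_pow_left₀ (Real.exp_pos _).le hm d
      rw [e1]
      calc _ = M * L * volume.real (Metric.ball (0 : 𝔼) 1) * Real.exp (-(d * n : ℝ)) *
            ((ε ^ d)⁻¹ * Real.exp (-(m + 1 : ℝ)) ^ d) := by ring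
        _ ≤ M * L * volume.real (Metric.ball (0 : 𝔼) 1) * Real.exp (-(d * n : ℝ)) * 1 :=
            mul_le_mul_of_nonneg_left e2 (by positivity)
        _ = _ := mul_one _
    rw [symForm]
    constructor <;> linarith
  rw [abs_of_nonneg (h1.nonneg fun n => (hb n).1)]
  exact hasSum_le (fun n => (hb n).2) h1 ((summable_exp_neg_mul (d := d)).hasSum.mul_left _)

theorem HasNiceDecomposition.exists_bound_zero (hK : HasNiceDecomposition D K Q)
    (hS : IsCompact S) (hSD : S ⊆ D) : ∃ B₀ : ℝ, 0 ≤ B₀ ∧ ∀ z ∈ S, ∀ z' ∈ S, |Q 0 z z'| ≤ B₀ := by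
  obtain ⟨B, hB⟩ := (hS.prod hS).exists_bound_of_continuousOn
    ((hK.continuousOn' 0).mono (prod_mono hSD hSD))
  exact ⟨|B|, abs_nonneg _, fun z hz z' hz' => (hB (z, z') ⟨hz, hz'⟩).trans (le_abs_self B)⟩

theorem exists_nat_exp_lt_le {ε : ℝ} (hε0 : 0 < ε) (hε1 : ε ≤ 1) :
    ∃ m : ℕ, Real.exp (-(m + 1 : ℝ)) < ε ∧ ε ≤ Real.exp (-(m : ℝ)) := by
  have h0 : 0 ≤ -Real.log ε := by linarith [Real.log_nonpos hε0.le hε1]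
  refine ⟨⌊-Real.log ε⌋₊, ?_, ?_⟩
  · have := Nat.lt_floor_add_one (-Real.log ε)
    rw [← Real.lt_log_iff_exp_lt hε0]
    linarith
  · have := Nat.floor_le h0
    rw [← Real.log_le_iff_le_exp hε0]
    linarith

/-- Geometric decay of the error made by keeping only the first `n` levels of the mollified field,
uniformly in the scale `ε ≤ exp (-n)` and in the discretisation.  All levels beyond `log (1 / ε)`
are treated as a single one. -/
theorem HasNiceDecomposition.exists_tail_bound [NeZero d] (hK : HasNiceDecomposition D K Q)
    (hS : IsCompact S) (hSD : S ⊆ D) (γ : ℂ) {p : ℝ} (hp1 : 1 ≤ p) (hp2 : p ≤ 2)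
    {c : ℝ} (hc : 0 < c)
    (hcp : c = (d * (p - 1) - p * ((p - 1) * γ.re ^ 2 + γ.im ^ 2) / 2) / p)
    {M : ℝ} (hM : 0 ≤ M) {B₁ : ℝ} (hB₁ : 0 ≤ B₁) :
    ∃ A : ℝ, 0 ≤ A ∧ ∀ {ε : ℝ} {N n : ℕ} (x : Fin N → 𝔼) (φ : Fin N → 𝔼 → ℝ) (w : Fin N → ℂ),
      0 < ε → ε ≤ Real.exp (-(n : ℝ)) →
      (∀ i, IsMollifierAt (x i) ε M (φ i)) → (∀ i, ∀ z ∉ S, φ i z = 0) →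
      (∀ (z : 𝔼) (r : ℝ), ε ≤ r → ∑ i with dist (x i) z ≤ r, ‖w i‖ ≤ B₁ * r ^ d) →
      (∑ i, ‖w i‖ ≤ B₁) →
      ∀ {Ω : Type*} [MeasurableSpace Ω] {P : Measure Ω} {G T : Ω → Fin N → ℝ},
      IsCenteredGaussianVec P
        (fun i j => ∑ k ∈ Finset.range (n + 1), symForm (Q k) (φ i) (φ j)) G →
      IsCenteredGaussianVec P (fun i j => symForm K (φ i) (φ j) -
        ∑ k ∈ Finset.range (n + 1), symForm (Q k) (φ i) (φ j)) T →
      IndepFun G T P →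
      ∫ ω, ‖chaosSum γ w (fun i => symForm K (φ i) (φ i)) (G ω + T ω) -
        chaosSum γ w (fun i => ∑ k ∈ Finset.range (n + 1), symForm (Q k) (φ i) (φ i)) (G ω)‖ ∂P ≤
      A * Real.exp (-c * n) := by
  obtain ⟨L, hL1, hQL, hLip⟩ := hK.exists_const
  obtain ⟨B₀, hB₀0, hB₀⟩ := hK.exists_bound_zero hS hSD
  have hL : 0 ≤ L := by linarith
  set B₂ := M * L * volume.real (Metric.ball (0 : 𝔼) 1) * ∑' n : ℕ, Real.exp (-(d * n : ℝ))
    with hB₂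
  have hB₂0 : 0 ≤ B₂ := mul_nonneg (by positivity) (tsum_nonneg fun n => (Real.exp_pos _).le)
  have hexp1 : Real.exp 1 ≤ 3 := Real.exp_one_lt_three.le
  obtain ⟨A, hA0, hA⟩ := exists_chaosSum_tail_bound d γ hp1 hp2 hc hcp
    (B := 7 + B₀ + 4 * L + B₂ + B₁) (by linarith)
  set B := 7 + B₀ + 4 * L + B₂ + B₁ with hB
  refine ⟨A, hA0, ?_⟩
  intro ε N n x φ w hε0 hεn hφ hφS hball hmass Ω _ P G T hG hT hGT
  obtain ⟨m, hm1, hm2⟩ := exists_nat_exp_lt_le hε0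
    (hεn.trans (Real.exp_le_one_iff.2 (by simp)))
  have hnm : n ≤ m := by
    have h1 := Real.exp_lt_exp.1 (hm1.trans_le hεn)
    have h2 : (n : ℝ) < (m + 1 : ℕ) := by push_cast; linarith
    have h3 : n < m + 1 := by exact_mod_cast h2
    omega
  set q : ℕ → Fin N → Fin N → ℝ := fun k i j => symForm (Q k) (φ i) (φ j) with hq
  set R : Fin N → Fin N → ℝ := fun i j =>
    symForm K (φ i) (φ j) - ∑ k ∈ Finset.range (m + 1), q k i j with hR
  set C : ℕ → Fin N → Fin N → ℝ := fun k => if k ≤ m then q k else if k = m + 1 then R else 0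
    with hC
  have hC1 : ∀ k ≤ m, C k = q k := fun k hk => if_pos hk
  have hC2 : C (m + 1) = R := by simp [hC]
  have hqpsd : ∀ k, (Matrix.of (q k)).PosSemidef := fun k => hK.posSemidef hS hSD hφ hφS k
  have hpsd : ∀ k, (Matrix.of (C k)).PosSemidef := by
    intro k
    by_cases h1 : k ≤ m
    · rw [hC1 k h1]; exact hqpsd k
    · by_cases h2 : k = m + 1
      · rw [h2, hC2]
        exact posSemidef_sub_sum_range hqpsd
          (fun i j => hK.hasSum_symForm hS hSD (hφ i) (hφ j) (hφS i) (hφS j)) (m + 1)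
      · have : C k = 0 := by simp [hC, h1, h2]
        rw [this]
        exact Matrix.PosSemidef.zero
  have hsum : ∀ k ≤ m, ∑ j ∈ Finset.range (k + 1), C j =
      fun i j => ∑ l ∈ Finset.range (k + 1), q l i j := by
    intro k hk
    rw [Finset.sum_congr rfl fun l hl => hC1 l (by rw [Finset.mem_range] at hl; omega)]
    ext i j
    simp only [Finset.sum_apply]
  have htot : ∑ j ∈ Finset.range (m + 1 + 1), C j = fun i j => symForm K (φ i) (φ j) := by
    rw [Finset.sum_range_succ, hC2, hsum m le_rfl]
    ext i j
    simp only [Pi.add_apply, hR]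
    ring
  have hIco : ∑ j ∈ Finset.Ico (n + 1) (m + 1 + 1), C j = fun i j => symForm K (φ i) (φ j) -
      ∑ k ∈ Finset.range (n + 1), symForm (Q k) (φ i) (φ j) := by
    rw [Finset.sum_Ico_eq_sub _ (by omega), htot, hsum n hnm]
    rfl
  have hexpε : ε ≤ 3 * Real.exp (-(m + 1 : ℝ)) := by
    refine hm2.trans ?_
    rw [show -(m : ℝ) = 1 + -(m + 1 : ℝ) by ring, Real.exp_add]
    exact mul_le_mul_of_nonneg_right hexp1 (Real.exp_pos _).le
  have hzero : ∀ k ≤ m, ∀ l, k + 1 ≤ l → ∀ i j,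
      B * Real.exp (-(k + 1 : ℝ)) ≤ dist (x i) (x j) → q l i j = 0 := by
    intro k hk l hl i j hd
    refine hK.symForm_eq_zero hS hSD (hφ i) (hφ j) (hφS i) (hφS j) (by omega) (le_trans ?_ hd)
    have hkm : (k : ℝ) ≤ m := by exact_mod_cast hk
    have hkl : (k + 1 : ℝ) ≤ l := by exact_mod_cast hl
    have e1 : Real.exp (-(l : ℝ)) ≤ Real.exp (-(k + 1 : ℝ)) := Real.exp_le_exp.2 (by linarith)
    have e2 : Real.exp (-(m + 1 : ℝ)) ≤ Real.exp (-(k + 1 : ℝ)) :=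
      Real.exp_le_exp.2 (by linarith)
    have e3 : 7 * Real.exp (-(k + 1 : ℝ)) ≤ B * Real.exp (-(k + 1 : ℝ)) :=
      mul_le_mul_of_nonneg_right (by linarith) (Real.exp_pos _).le
    linarith
  have hvar : ∀ k ≤ m, ∀ i, (∑ j ∈ Finset.range (k + 1), C j) i i ≤ k + B := by
    intro k hk i
    rw [hsum k hk]
    refine (hK.sum_symForm_le hS hSD (hφ i) (hφS i) hL hε0.le hB₀ hLip k).trans ?_
    have hkm : (k : ℝ) ≤ m := by exact_mod_cast hk
    have e1 : ε * Real.exp k ≤ 1 := by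
      calc ε * Real.exp k ≤ Real.exp (-(m : ℝ)) * Real.exp m :=
            mul_le_mul hm2 (Real.exp_le_exp.2 hkm) (Real.exp_pos _).le (Real.exp_pos _).le
        _ = 1 := by rw [← Real.exp_add]; simp
    have e2 : 4 * L * (ε * Real.exp k) ≤ 4 * L * 1 := mul_le_mul_of_nonneg_left e1 (by linarith)
    linarith
  have hbd : ∀ k ≤ m, ∀ i j, |C (k + 1) i j| ≤ B := by
    intro k hk i j
    rcases hk.lt_or_eq with h | rfl
    · rw [hC1 (k + 1) h]
      exact (hK.abs_symForm_le hS hSD (hφ i) (hφ j) (hφS i) (hφS j) hQL (by omega)).trans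
        (by linarith)
    · rw [hC2]
      exact (hK.abs_symForm_sub_sum_le hS hSD (hφ i) (hφ j) (hφS i) (hφS j) hL hM hQL hε0
        hm1.le).trans (by linarith)
  have hrange : ∀ k ≤ m, ∀ i j, B * Real.exp (-(k + 1 : ℝ)) ≤ dist (x i) (x j) →
      C (k + 1) i j = 0 := by
    intro k hk i j hd
    rcases hk.lt_or_eq with h | rfl
    · rw [hC1 (k + 1) h]
      exact hzero k hk (k + 1) le_rfl i j hd
    · rw [hC2]
      have h1 := (hasSum_nat_add_iff' (k + 1)).2
        (hK.hasSum_symForm hS hSD (hφ i) (hφ j) (hφS i) (hφS j))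
      have h2 : ∀ l, symForm (Q (l + (k + 1))) (φ i) (φ j) = 0 := fun l =>
        hzero k hk (l + (k + 1)) (by omega) i j hd
      simp only [h2] at h1
      exact h1.unique hasSum_zero
  have hball' : ∀ (z : 𝔼) (r : ℝ), Real.exp (-(m : ℝ)) ≤ r →
      ∑ i with dist (x i) z ≤ r, ‖w i‖ ≤ B * r ^ d := by
    intro z r hr
    refine (hball z r (hm2.trans hr)).trans ?_
    have : 0 ≤ r := (Real.exp_pos _).le.trans hr
    exact mul_le_mul_of_nonneg_right (by linarith) (by positivity)
  have key := hA x w C hnm hpsd hvar hbd hrange hball' (hmass.trans (by linarith))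
    (P := P) (S := G) (T := T) (by rw [hsum n hnm]; exact hG) (by rw [hIco]; exact hT) hGT
  simp only [htot, hsum n hnm] at key
  exact key

end levels

/-! ### Comparison of two discretised chaoses -/

theorem IsCenteredGaussianVec.integral_norm_wickExp_sub_le {ι Ω : Type*} [Fintype ι]
    [MeasurableSpace Ω] {P : Measure Ω} {C : ι → ι → ℝ} {G : Ω → ι → ℝ}
    (h : IsCenteredGaussianVec P C G) (hC : ∀ i j, C i j = C j i) (γ : ℂ) (i j : ι) :
    ∫ ω, ‖wickExp γ (C i i) (G ω i) - wickExp γ (C j j) (G ω j)‖ ∂P ≤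
      Real.sqrt (Real.exp (‖γ‖ ^ 2 * C i i) + Real.exp (‖γ‖ ^ 2 * C j j) -
        2 * Real.exp (‖γ‖ ^ 2 * C i j)) := by
  have := h.isProbabilityMeasure
  set F : ι → ι → Ω → ℂ := fun i j ω =>
    wickExp γ (C i i) (G ω i) * (starRingEnd ℂ) (wickExp γ (C j j) (G ω j)) with hF
  have hFi : ∀ i j, Integrable (F i j) P := fun i j => (h.wickExp_mul_conj hC γ i j).1
  have hFv : ∀ i j, ∫ ω, F i j ω ∂P = (Real.exp (‖γ‖ ^ 2 * C i j) : ℝ) := fun i j =>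
    (h.wickExp_mul_conj hC γ i j).2
  have hsq : ∀ ω, ((‖wickExp γ (C i i) (G ω i) - wickExp γ (C j j) (G ω j)‖ ^ 2 : ℝ) : ℂ) =
      F i i ω + F j j ω - F i j ω - F j i ω := by
    intro ω
    rw [← Complex.normSq_eq_norm_sq, ← Complex.mul_conj, map_sub]
    simp only [hF]
    ring
  have i1 : Integrable (fun ω => F i i ω + F j j ω) P := (hFi i i).add (hFi j j)
  have i2 : Integrable (fun ω => F i i ω + F j j ω - F i j ω) P := i1.sub (hFi i j)
  have i3 : Integrable (fun ω => F i i ω + F j j ω - F i j ω - F j i ω) P := i2.sub (hFi j i)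
  have hI : Integrable
      (fun ω => ‖wickExp γ (C i i) (G ω i) - wickExp γ (C j j) (G ω j)‖ ^ 2) P := by
    have h1 := i3
    simp only [← hsq] at h1
    have h2 := h1.re
    simp only [RCLike.re_to_complex, Complex.ofReal_re] at h2
    exact h2
  have hval : ∫ ω, ‖wickExp γ (C i i) (G ω i) - wickExp γ (C j j) (G ω j)‖ ^ 2 ∂P =
      Real.exp (‖γ‖ ^ 2 * C i i) + Real.exp (‖γ‖ ^ 2 * C j j) -
        2 * Real.exp (‖γ‖ ^ 2 * C i j) := by
    have h1 : ((∫ ω, ‖wickExp γ (C i i) (G ω i) - wickExp γ (C j j) (G ω j)‖ ^ 2 ∂P : ℝ) : ℂ) =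
        ((Real.exp (‖γ‖ ^ 2 * C i i) + Real.exp (‖γ‖ ^ 2 * C j j) -
          2 * Real.exp (‖γ‖ ^ 2 * C i j) : ℝ) : ℂ) := by
      rw [← integral_complex_ofReal]
      simp only [hsq]
      rw [integral_sub i2 (hFi j i), integral_sub i1 (hFi i j), integral_add (hFi i i) (hFi j j)]
      simp only [hFv]
      rw [hC j i]
      push_cast
      ring
    exact_mod_cast h1
  obtain ⟨-, hj⟩ := integral_rpow_le_rpow_integral (fun ω => sq_nonneg _) hI
    (q := 1 / 2) (by norm_num) (by norm_num)
  simp only [← Real.sqrt_eq_rpow, Real.sqrt_sq (norm_nonneg _)] at hj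
  rwa [hval] at hj

/-- Two normalised exponentials are `L¹`-close as soon as their variances are close to their
covariance. -/
theorem IsCenteredGaussianVec.integral_norm_wickExp_sub_le' {ι Ω : Type*} [Fintype ι]
    [MeasurableSpace Ω] {P : Measure Ω} {C : ι → ι → ℝ} {G : Ω → ι → ℝ}
    (h : IsCenteredGaussianVec P C G) (hC : ∀ i j, C i j = C j i) (γ : ℂ) (i j : ι) {R δ : ℝ}
    (hR : C i j ≤ R) (hi : C i i - C i j ≤ δ) (hj : C j j - C i j ≤ δ) (hδ : 0 ≤ δ) :
    ∫ ω, ‖wickExp γ (C i i) (G ω i) - wickExp γ (C j j) (G ω j)‖ ∂P ≤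
      Real.sqrt (2 * Real.exp (‖γ‖ ^ 2 * R) * (Real.exp (‖γ‖ ^ 2 * δ) - 1)) := by
  refine (h.integral_norm_wickExp_sub_le hC γ i j).trans (Real.sqrt_le_sqrt ?_)
  have key : ∀ a, a - C i j ≤ δ → Real.exp (‖γ‖ ^ 2 * a) - Real.exp (‖γ‖ ^ 2 * C i j) ≤
      Real.exp (‖γ‖ ^ 2 * R) * (Real.exp (‖γ‖ ^ 2 * δ) - 1) := by
    intro a ha
    have e1 : Real.exp (‖γ‖ ^ 2 * a) - Real.exp (‖γ‖ ^ 2 * C i j) =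
        Real.exp (‖γ‖ ^ 2 * C i j) * (Real.exp (‖γ‖ ^ 2 * (a - C i j)) - 1) := by
      rw [mul_sub, ← Real.exp_add]; ring_nf
    have e2 : Real.exp (‖γ‖ ^ 2 * (a - C i j)) ≤ Real.exp (‖γ‖ ^ 2 * δ) :=
      Real.exp_le_exp.2 (mul_le_mul_of_nonneg_left ha (by positivity))
    have e3 : 1 ≤ Real.exp (‖γ‖ ^ 2 * δ) := Real.one_le_exp (by positivity)
    rw [e1]
    calc _ ≤ Real.exp (‖γ‖ ^ 2 * C i j) * (Real.exp (‖γ‖ ^ 2 * δ) - 1) :=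
          mul_le_mul_of_nonneg_left (by linarith) (Real.exp_pos _).le
      _ ≤ _ := mul_le_mul_of_nonneg_right
          (Real.exp_le_exp.2 (mul_le_mul_of_nonneg_left hR (by positivity))) (by linarith)
  linarith [key _ hi, key _ hj]

theorem exists_sqrt_exp_sub_one_lt (g R : ℝ) {η : ℝ} (hη : 0 < η) :
    ∃ δ : ℝ, 0 < δ ∧ Real.sqrt (2 * Real.exp (g * R) * (Real.exp (g * δ) - 1)) < η := by
  have hc : Continuous fun δ : ℝ =>
      Real.sqrt (2 * Real.exp (g * R) * (Real.exp (g * δ) - 1)) := by fun_prop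
  have h0 : Tendsto (fun δ : ℝ => Real.sqrt (2 * Real.exp (g * R) * (Real.exp (g * δ) - 1)))
      (𝓝[>] 0) (𝓝 0) := by
    have := hc.tendsto 0
    simp only [mul_zero, Real.exp_zero, sub_self, Real.sqrt_zero] at this
    exact this.mono_left nhdsWithin_le_nhds
  obtain ⟨δ, h1, h2⟩ := ((h0.eventually_lt_const hη).and self_mem_nhdsWithin).exists
  exact ⟨δ, h2, h1⟩

section compare

variable {d : ℕ}

local notation "𝔼" => EuclideanSpace ℝ (Fin d)

variable {D : Set (EuclideanSpace ℝ (Fin d))}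
  {K : EuclideanSpace ℝ (Fin d) → EuclideanSpace ℝ (Fin d) → ℝ}
  {Q : ℕ → EuclideanSpace ℝ (Fin d) → EuclideanSpace ℝ (Fin d) → ℝ}
  {S : Set (EuclideanSpace ℝ (Fin d))}

/-- Finitely many levels of the mollified covariance converge, as the scales tend to zero, to the
values of the kernels on the diagonal, whatever the mollifiers are. -/
theorem HasNiceDecomposition.exists_abs_sum_symForm_sub_le (hK : HasNiceDecomposition D K Q)
    (hS : IsCompact S) (hSD : S ⊆ D) (n : ℕ) {η : ℝ} (hη : 0 < η) :
    ∃ ε₁ : ℝ, 0 < ε₁ ∧ ∀ {x : 𝔼} {ε ε' M M' : ℝ} {φ ψ : 𝔼 → ℝ}, x ∈ S → ε ≤ ε₁ → ε' ≤ ε₁ →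
      IsMollifierAt x ε M φ → IsMollifierAt x ε' M' ψ → (∀ z ∉ S, φ z = 0) →
      (∀ z ∉ S, ψ z = 0) →
      |∑ k ∈ Finset.range n, symForm (Q k) φ ψ - ∑ k ∈ Finset.range n, Q k x x| ≤ η := by
  induction n generalizing η with
  | zero => exact ⟨1, one_pos, by intros; simp [hη.le]⟩
  | succ n ih =>
    obtain ⟨ε₁, hε₁, h1⟩ := ih (half_pos hη)
    have huc := (hS.prod hS).uniformContinuousOn_of_continuous
      ((hK.continuousOn' n).mono (prod_mono hSD hSD))
    obtain ⟨ε₂, hε₂, h2⟩ := Metric.uniformContinuousOn_iff.1 huc (η / 2) (half_pos hη)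
    refine ⟨min ε₁ (ε₂ / 2), by positivity, ?_⟩
    intro x ε ε' M M' φ ψ hx hε hε' hφ hψ hφS hψS
    have h3 := h1 hx (hε.trans (min_le_left _ _)) (hε'.trans (min_le_left _ _)) hφ hψ hφS hψS
    have hε2 := hε.trans (min_le_right _ _)
    have hε2' := hε'.trans (min_le_right _ _)
    have h4 := abs_symForm_sub_le hS.measurableSet (hK.integrableOn hS hSD n) hφ hψ hφS hψS
      (c := Q n x x) (η := η / 2) (fun z hz z' hz' h h' => by
        have e1 : dist z x < ε₂ := by linarith
        have e2 : dist z' x < ε₂ := by linarith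
        constructor
        · have := h2 (z, z') ⟨hz, hz'⟩ (x, x) ⟨hx, hx⟩ (by
            rw [Prod.dist_eq]; exact max_lt e1 e2)
          rw [Real.dist_eq] at this
          exact this.le
        · have := h2 (z', z) ⟨hz', hz⟩ (x, x) ⟨hx, hx⟩ (by
            rw [Prod.dist_eq]; exact max_lt e2 e1)
          rw [Real.dist_eq] at this
          exact this.le)
    rw [Finset.sum_range_succ, Finset.sum_range_succ, add_sub_add_comm]
    refine (abs_add_le _ _).trans ?_
    linarith

/-- Discretised chaoses built from two families of mollifiers at the same points are `L¹`-close
when both scales are small: each is close to its conditional expectation given the first `n`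
levels, and for fixed `n` these conditional expectations are close to each other. -/
theorem HasNiceDecomposition.exists_chaosSum_sub_le [NeZero d] (hK : HasNiceDecomposition D K Q)
    (hS : IsCompact S) (hSD : S ⊆ D) {α β : ℝ} (hαβ : (α, β) ∈ subcriticalRegion d) {γ : ℂ}
    (hγ : γ = α + β * Complex.I) {M : ℝ} (hM : 0 ≤ M) {B₁ : ℝ} (hB₁ : 0 ≤ B₁) {η : ℝ}
    (hη : 0 < η) :
    ∃ ε₁ : ℝ, 0 < ε₁ ∧ ∀ {ε ε' : ℝ} {N : ℕ} (x : Fin N → 𝔼) (φ ψ : Fin N → 𝔼 → ℝ)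
      (w : Fin N → ℂ), 0 < ε → 0 < ε' → ε ≤ ε₁ → ε' ≤ ε₁ → (∀ i, x i ∈ S) →
      (∀ i, IsMollifierAt (x i) ε M (φ i)) → (∀ i, IsMollifierAt (x i) ε' M (ψ i)) →
      (∀ i, ∀ z ∉ S, φ i z = 0) → (∀ i, ∀ z ∉ S, ψ i z = 0) →
      (∀ (z : 𝔼) (r : ℝ), min ε ε' ≤ r → ∑ i with dist (x i) z ≤ r, ‖w i‖ ≤ B₁ * r ^ d) →
      (∑ i, ‖w i‖ ≤ B₁) →
      ∀ {Ω : Type*} [MeasurableSpace Ω] {P : Measure Ω} {Z : Ω → Fin N ⊕ Fin N → ℝ},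
      IsCenteredGaussianVec P
        (fun a b => symForm K (Sum.elim φ ψ a) (Sum.elim φ ψ b)) Z →
      ∫ ω, ‖chaosSum γ w (fun i => symForm K (φ i) (φ i)) (fun i => Z ω (Sum.inl i)) -
        chaosSum γ w (fun i => symForm K (ψ i) (ψ i)) (fun i => Z ω (Sum.inr i))‖ ∂P ≤ η := by
  obtain ⟨p, hp1, hp2, hc⟩ := exists_exponent_of_mem_subcriticalRegion hαβ
  set c := (d * (p - 1) - p * ((p - 1) * α ^ 2 + β ^ 2) / 2) / p with hcdef
  have hre : γ.re = α := by simp [hγ]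
  have him : γ.im = β := by simp [hγ]
  obtain ⟨A, hA0, hA⟩ := hK.exists_tail_bound hS hSD γ hp1 hp2 hc
    (by rw [hre, him]) hM hB₁
  obtain ⟨L, hL1, hQL, -⟩ := hK.exists_const
  obtain ⟨B₀, hB₀0, hB₀⟩ := hK.exists_bound_zero hS hSD
  -- the number of levels is chosen so that both tails are at most `η / 3`
  obtain ⟨n, hn⟩ : ∃ n : ℕ, A * Real.exp (-c * n) ≤ η / 3 := by
    have h1 : Tendsto (fun n : ℕ => A * Real.exp (-c * n)) atTop (𝓝 (A * 0)) := by
      refine Tendsto.const_mul A (Real.tendsto_exp_atBot.comp ?_)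
      exact tendsto_natCast_atTop_atTop.const_mul_atTop_of_neg (by linarith)
    rw [mul_zero] at h1
    exact ((h1.eventually_lt_const (by positivity : 0 < η / 3)).mono fun n h => h.le).exists
  obtain ⟨δ, hδ0, hδ⟩ := exists_sqrt_exp_sub_one_lt (‖γ‖ ^ 2) (B₀ + n * L)
    (η := η / 3 / (B₁ + 1)) (by positivity)
  obtain ⟨ε₁, hε₁, h1⟩ := hK.exists_abs_sum_symForm_sub_le hS hSD (n + 1) (half_pos hδ0)
  refine ⟨min ε₁ (Real.exp (-(n : ℝ))), by positivity, ?_⟩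
  intro ε ε' N x φ ψ w hε0 hε0' hε hε' hxS hφ hψ hφS hψS hball hmass Ω _ P Z hZ
  set χ : Fin N ⊕ Fin N → 𝔼 → ℝ := Sum.elim φ ψ with hχ
  have hχm : ∀ a, IsMollifierAt (Sum.elim x x a) (Sum.elim (fun _ => ε) (fun _ => ε') a) M
      (χ a) := by
    rintro (i | i)
    · exact hφ i
    · exact hψ i
  have hχS : ∀ a, ∀ z ∉ S, χ a z = 0 := by
    rintro (i | i)
    · exact hφS i
    · exact hψS i
  set q : ℕ → Fin N ⊕ Fin N → Fin N ⊕ Fin N → ℝ := fun k a b => symForm (Q k) (χ a) (χ b) with hq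
  have hqpsd : ∀ k, (Matrix.of (q k)).PosSemidef := fun k => hK.posSemidef hS hSD
    (ε := Sum.elim (fun _ => ε) (fun _ => ε')) (M := fun _ => M) hχm hχS k
  set C₁ : Fin N ⊕ Fin N → Fin N ⊕ Fin N → ℝ := fun a b => ∑ k ∈ Finset.range (n + 1), q k a b
    with hC₁
  set C₂ : Fin N ⊕ Fin N → Fin N ⊕ Fin N → ℝ := fun a b => symForm K (χ a) (χ b) -
    ∑ k ∈ Finset.range (n + 1), q k a b with hC₂
  have hC₁psd : (Matrix.of C₁).PosSemidef := by
    have h2 := Matrix.posSemidef_sum (Finset.range (n + 1)) fun k _ => hqpsd k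
    convert h2 using 1
    ext a b
    simp [hC₁, Matrix.sum_apply]
  have hC₂psd : (Matrix.of C₂).PosSemidef := posSemidef_sub_sum_range hqpsd
    (fun a b => hK.hasSum_symForm hS hSD (hχm a) (hχm b) (hχS a) (hχS b)) (n + 1)
  obtain ⟨μ₁, hμ₁⟩ := exists_isCenteredGaussianVec hC₁psd
  obtain ⟨μ₂, hμ₂⟩ := exists_isCenteredGaussianVec hC₂psd
  have hμ₁p := hμ₁.isProbabilityMeasure
  have hμ₂p := hμ₂.isProbabilityMeasure
  set μ := μ₁.prod μ₂ with hμ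
  set G : (Fin N ⊕ Fin N → ℝ) × (Fin N ⊕ Fin N → ℝ) → Fin N ⊕ Fin N → ℝ := Prod.fst
  set T : (Fin N ⊕ Fin N → ℝ) × (Fin N ⊕ Fin N → ℝ) → Fin N ⊕ Fin N → ℝ := Prod.snd
  have hG : IsCenteredGaussianVec μ C₁ G := hμ₁.of_map_eq measurable_fst.aemeasurable (by
    rw [Measure.map_id]; exact (Measure.map_fst_prod.trans (by simp)).symm)
  have hT : IsCenteredGaussianVec μ C₂ T := hμ₂.of_map_eq measurable_snd.aemeasurable (by
    rw [Measure.map_id]; exact (Measure.map_snd_prod.trans (by simp)).symm)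
  have hGT : IndepFun G T μ := by
    rw [indepFun_iff_map_prod_eq_prod_map_map measurable_fst.aemeasurable
      measurable_snd.aemeasurable]
    have e1 : μ.map G = μ₁ := Measure.map_fst_prod.trans (by simp)
    have e2 : μ.map T = μ₂ := Measure.map_snd_prod.trans (by simp)
    rw [e1, e2]
    exact Measure.map_id
  have hGTs : IsCenteredGaussianVec μ (fun a b => symForm K (χ a) (χ b)) (G + T) := by
    have := hG.add hT hGT
    convert this using 1
    ext a b
    simp only [hC₁, hC₂, Pi.add_apply]
    ring
  -- only the law of the vector matters, so that it may be realised as `G + T`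
  set F : (Fin N ⊕ Fin N → ℝ) → ℝ := fun z =>
    ‖chaosSum γ w (fun i => symForm K (φ i) (φ i)) (fun i => z (Sum.inl i)) -
      chaosSum γ w (fun i => symForm K (ψ i) (ψ i)) (fun i => z (Sum.inr i))‖ with hF
  have hFc : Continuous F :=
    (((continuous_chaosSum γ w _).comp (by fun_prop)).sub
      ((continuous_chaosSum γ w _).comp (by fun_prop))).norm
  have htrans : ∫ ω, F (Z ω) ∂P = ∫ ω, F (G ω + T ω) ∂μ := by
    rw [← integral_map hZ.aemeasurable hFc.aestronglyMeasurable, hZ.map_eq hGTs,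
      integral_map hGTs.aemeasurable hFc.aestronglyMeasurable]
    rfl
  refine htrans.le.trans ?_
  set a : _ → ℂ := fun ω => chaosSum γ w (fun i => symForm K (φ i) (φ i))
    (fun i => (G + T) ω (Sum.inl i)) with ha
  set b : _ → ℂ := fun ω => chaosSum γ w (fun i => symForm K (ψ i) (ψ i))
    (fun i => (G + T) ω (Sum.inr i)) with hb
  set a' : _ → ℂ := fun ω => chaosSum γ w
    (fun i => ∑ k ∈ Finset.range (n + 1), symForm (Q k) (φ i) (φ i))
    (fun i => G ω (Sum.inl i)) with ha'
  set b' : _ → ℂ := fun ω => chaosSum γ w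
    (fun i => ∑ k ∈ Finset.range (n + 1), symForm (Q k) (ψ i) (ψ i))
    (fun i => G ω (Sum.inr i)) with hb'
  have hai : Integrable a μ := (hGTs.comp Sum.inl).integrable_chaosSum γ w _
  have hbi : Integrable b μ := (hGTs.comp Sum.inr).integrable_chaosSum γ w _
  have hai' : Integrable a' μ := (hG.comp Sum.inl).integrable_chaosSum γ w _
  have hbi' : Integrable b' μ := (hG.comp Sum.inr).integrable_chaosSum γ w _
  have hind : ∀ e : Fin N → Fin N ⊕ Fin N,
      IndepFun (fun ω i => G ω (e i)) (fun ω i => T ω (e i)) μ := fun e =>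
    hGT.comp (measurable_pi_lambda _ fun i => measurable_pi_apply (e i))
      (measurable_pi_lambda _ fun i => measurable_pi_apply (e i))
  have ta : ∫ ω, ‖a ω - a' ω‖ ∂μ ≤ η / 3 :=
    (hA x φ w hε0 (hε.trans (min_le_right _ _)) hφ hφS
      (fun z r hr => hball z r ((min_le_left _ _).trans hr)) hmass (hG.comp Sum.inl)
      (hT.comp Sum.inl) (hind Sum.inl)).trans hn
  have tb : ∫ ω, ‖b ω - b' ω‖ ∂μ ≤ η / 3 :=
    (hA x ψ w hε0' (hε'.trans (min_le_right _ _)) hψ hψS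
      (fun z r hr => hball z r ((min_le_right _ _).trans hr)) hmass (hG.comp Sum.inr)
      (hT.comp Sum.inr) (hind Sum.inr)).trans hn
  have hsym : ∀ u v, C₁ u v = C₁ v u := fun u v => by
    simpa using (hC₁psd.isHermitian.apply u v).symm
  have tab : ∫ ω, ‖a' ω - b' ω‖ ∂μ ≤ η / 3 := by
    set y : Fin N → _ → ℂ := fun i ω => wickExp γ (C₁ (Sum.inl i) (Sum.inl i)) (G ω (Sum.inl i)) -
      wickExp γ (C₁ (Sum.inr i) (Sum.inr i)) (G ω (Sum.inr i)) with hy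
    have hyi : ∀ i, Integrable (y i) μ := fun i =>
      (hG.integrable_wickExp γ _ _).sub (hG.integrable_wickExp γ _ _)
    have hyb : ∀ i, ∫ ω, ‖y i ω‖ ∂μ ≤ η / 3 / (B₁ + 1) := by
      intro i
      have hε1 := hε.trans (min_le_left _ _)
      have hε1' := hε'.trans (min_le_left _ _)
      have u1 := abs_le.1 (h1 (hxS i) hε1 hε1 (hφ i) (hφ i) (hφS i) (hφS i))
      have u2 := abs_le.1 (h1 (hxS i) hε1 hε1' (hφ i) (hψ i) (hφS i) (hψS i))
      have u3 := abs_le.1 (h1 (hxS i) hε1' hε1' (hψ i) (hψ i) (hψS i) (hψS i))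
      refine (hG.integral_norm_wickExp_sub_le' hsym γ (Sum.inl i) (Sum.inr i)
        (R := B₀ + n * L) (δ := δ) ?_ ?_ ?_ hδ0.le).trans hδ.le
      · change ∑ k ∈ Finset.range (n + 1), symForm (Q k) (φ i) (ψ i) ≤ _
        rw [Finset.sum_range_succ', add_comm]
        refine add_le_add ?_ ?_
        · have := abs_symForm_sub_le hS.measurableSet (hK.integrableOn hS hSD 0) (hφ i) (hψ i)
            (hφS i) (hψS i) (c := 0) (η := B₀) (fun z hz z' hz' _ _ => by
              rw [sub_zero, sub_zero]; exact ⟨hB₀ z hz z' hz', hB₀ z' hz' z hz⟩)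
          rw [sub_zero] at this
          exact (abs_le.1 this).2
        · calc ∑ k ∈ Finset.range n, symForm (Q (k + 1)) (φ i) (ψ i)
              ≤ ∑ _k ∈ Finset.range n, L := Finset.sum_le_sum fun k _ =>
                (abs_le.1 (hK.abs_symForm_le hS hSD (hφ i) (hψ i) (hφS i) (hψS i) hQL
                  (by omega))).2
            _ = n * L := by simp
      · change ∑ k ∈ Finset.range (n + 1), symForm (Q k) (φ i) (φ i) -
          ∑ k ∈ Finset.range (n + 1), symForm (Q k) (φ i) (ψ i) ≤ _
        linarith [u1.2, u2.1]
      · change ∑ k ∈ Finset.range (n + 1), symForm (Q k) (ψ i) (ψ i) -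
          ∑ k ∈ Finset.range (n + 1), symForm (Q k) (φ i) (ψ i) ≤ _
        linarith [u3.2, u2.1]
    have hrew : ∀ ω, a' ω - b' ω = ∑ i, w i * y i ω := by
      intro ω
      simp only [ha', hb', chaosSum, hy, mul_sub, Finset.sum_sub_distrib]
      rfl
    calc ∫ ω, ‖a' ω - b' ω‖ ∂μ ≤ ∫ ω, ∑ i, ‖w i‖ * ‖y i ω‖ ∂μ := by
          refine integral_mono (hai'.sub hbi').norm
            (integrable_finsetSum _ fun i _ => (hyi i).norm.const_mul _) fun ω => ?_
          simp only [hrew]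
          exact (norm_sum_le _ _).trans (by simp only [norm_mul]; exact le_rfl)
      _ = ∑ i, ‖w i‖ * ∫ ω, ‖y i ω‖ ∂μ := by
          rw [integral_finsetSum _ fun i _ => (hyi i).norm.const_mul _]
          simp only [integral_const_mul]
      _ ≤ ∑ i, ‖w i‖ * (η / 3 / (B₁ + 1)) := Finset.sum_le_sum fun i _ =>
          mul_le_mul_of_nonneg_left (hyb i) (norm_nonneg _)
      _ ≤ (B₁ + 1) * (η / 3 / (B₁ + 1)) := by
          rw [← Finset.sum_mul]
          exact mul_le_mul_of_nonneg_right (by linarith) (by positivity)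
      _ = η / 3 := by field_simp
  have j1 : Integrable (fun ω => ‖a ω - a' ω‖) μ := (hai.sub hai').norm
  have j2 : Integrable (fun ω => ‖a' ω - b' ω‖) μ := (hai'.sub hbi').norm
  have j3 : Integrable (fun ω => ‖b ω - b' ω‖) μ := (hbi.sub hbi').norm
  have j12 : Integrable (fun ω => ‖a ω - a' ω‖ + ‖a' ω - b' ω‖) μ := j1.add j2
  have j123 : Integrable (fun ω => ‖a ω - a' ω‖ + ‖a' ω - b' ω‖ + ‖b ω - b' ω‖) μ := j12.add j3
  calc ∫ ω, F (G ω + T ω) ∂μ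
      ≤ ∫ ω, (‖a ω - a' ω‖ + ‖a' ω - b' ω‖ + ‖b ω - b' ω‖) ∂μ := by
        refine integral_mono (hai.sub hbi).norm j123 fun ω => ?_
        have e1 : a ω - b ω = (a ω - a' ω) + (a' ω - b' ω) - (b ω - b' ω) := by ring
        change ‖a ω - b ω‖ ≤ _
        rw [e1]
        exact (norm_sub_le _ _).trans (add_le_add (norm_add_le _ _) le_rfl)
    _ = ∫ ω, ‖a ω - a' ω‖ ∂μ + ∫ ω, ‖a' ω - b' ω‖ ∂μ + ∫ ω, ‖b ω - b' ω‖ ∂μ := by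
        rw [integral_add j12 j3, integral_add j1 j2]
    _ ≤ η := by linarith

end compare

/-! ### Random integrals and their Riemann sums -/

section random_integrals

variable {E Ω : Type*} [MeasurableSpace E] [MeasurableSpace Ω]

variable {P : Measure Ω} {ν : Measure E} {A : Set E}
  {Y : E → Ω → ℂ} {h : E → ℂ}

/-- A process sampled at the image of a measurable map with finitely many values is jointly
measurable. -/
theorem aestronglyMeasurable_comp_fin [SFinite ν] {N : ℕ} {e : Fin N → E} {π : E → Fin N}
    (hπ : Measurable π) (hY : ∀ i, AEStronglyMeasurable (Y (e i)) P) :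
    AEStronglyMeasurable (fun p : E × Ω => Y (e (π p.1)) p.2) ((ν.restrict A).prod P) := by
  have h1 : (fun p : E × Ω => Y (e (π p.1)) p.2) = fun p => ∑ i,
      ((π ⁻¹' {i}) ×ˢ univ).indicator (fun p : E × Ω => Y (e i) p.2) p := by
    ext p
    rw [Finset.sum_eq_single (π p.1)]
    · rw [indicator_of_mem (by simp)]
    · intro i _ hi
      rw [indicator_of_notMem]
      simpa using fun h => hi h.symm
    · simp
  rw [h1]
  refine Finset.aestronglyMeasurable_fun_sum _ fun i _ => ?_
  exact (hY i).comp_snd.indicator ((hπ (measurableSet_singleton i)).prod MeasurableSet.univ)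

/-- Fubini's theorem applies to a jointly measurable process whose first absolute moments are
bounded, against a bounded weight. -/
theorem integrable_prod_mul_of_bound [IsProbabilityMeasure P] (hνA : ν A ≠ ∞) (hAm : MeasurableSet A) [SFinite ν]
    (hY : AEStronglyMeasurable (fun p : E × Ω => Y p.1 p.2) ((ν.restrict A).prod P))
    (hYi : ∀ x ∈ A, Integrable (Y x) P) {R : ℝ} (hR : ∀ x ∈ A, ∫ ω, ‖Y x ω‖ ∂P ≤ R)
    (hh : AEStronglyMeasurable h (ν.restrict A)) {H : ℝ} (hH : ∀ x ∈ A, ‖h x‖ ≤ H) :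
    Integrable (fun p : E × Ω => Y p.1 p.2 * h p.1) ((ν.restrict A).prod P) := by
  have hfin : IsFiniteMeasure (ν.restrict A) := ⟨by simpa using hνA.lt_top⟩
  have h0 : Integrable (fun p : E × Ω => Y p.1 p.2) ((ν.restrict A).prod P) := by
    rw [integrable_prod_iff hY]
    refine ⟨(ae_restrict_mem hAm).mono fun x hx => hYi x hx, ?_⟩
    refine Integrable.of_bound (C := R) hY.norm.integral_prod_right' ?_
    filter_upwards [ae_restrict_mem hAm] with x hx
    rw [Real.norm_of_nonneg (integral_nonneg fun _ => norm_nonneg _)]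
    exact hR x hx
  refine h0.mul_bdd (c := H) hh.comp_fst ?_
  have h1 : ∀ᵐ p ∂((ν.restrict A).prod P), p.1 ∈ A :=
    Measure.quasiMeasurePreserving_fst.ae (ae_restrict_mem hAm)
  exact h1.mono fun p hp => hH _ hp

/-- Error of the Riemann sum of a random integral whose integrand is uniformly continuous in
mean. -/
theorem integral_norm_setIntegral_sub_sum_le [IsProbabilityMeasure P] (hνA : ν A ≠ ∞) (hAm : MeasurableSet A) [SFinite ν]
    (hY : AEStronglyMeasurable (fun p : E × Ω => Y p.1 p.2) ((ν.restrict A).prod P))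
    (hYi : ∀ x ∈ A, Integrable (Y x) P) {R : ℝ} (hR : ∀ x ∈ A, ∫ ω, ‖Y x ω‖ ∂P ≤ R)
    (hh : AEStronglyMeasurable h (ν.restrict A)) {H : ℝ} (hH : ∀ x ∈ A, ‖h x‖ ≤ H)
    {N : ℕ} {e : Fin N → E} {π : E → Fin N} (hπ : Measurable π) (he : ∀ i, e i ∈ A) {η : ℝ}
    (hη : ∀ x ∈ A, ∫ ω, ‖Y x ω - Y (e (π x)) ω‖ ∂P ≤ η) :
    ∫ ω, ‖∫ x in A, Y x ω * h x ∂ν - ∑ i, (∫ x in A ∩ π ⁻¹' {i}, h x ∂ν) * Y (e i) ω‖ ∂P ≤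
      η * H * ν.real A := by
  have hfin : IsFiniteMeasure (ν.restrict A) := ⟨by simpa using hνA.lt_top⟩
  have hi1 := integrable_prod_mul_of_bound hνA hAm hY hYi hR hh hH
  have hY' := aestronglyMeasurable_comp_fin (ν := ν) (A := A) (P := P) (Y := Y) hπ
    fun i => (hYi _ (he i)).aestronglyMeasurable
  have hi2 := integrable_prod_mul_of_bound (Y := fun x => Y (e (π x))) hνA hAm hY'
    (fun x _ => hYi _ (he _)) (fun x _ => hR _ (he _)) hh hH
  have hhi : IntegrableOn h A ν :=
    Integrable.of_bound (C := H) hh ((ae_restrict_mem hAm).mono fun x hx => hH x hx)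
  have hstep : ∀ ω, ∑ i, (∫ x in A ∩ π ⁻¹' {i}, h x ∂ν) * Y (e i) ω =
      ∫ x in A, Y (e (π x)) ω * h x ∂ν := by
    intro ω
    have h1 : ∀ x, Y (e (π x)) ω * h x = ∑ i, (π ⁻¹' {i}).indicator
        (fun x => h x * Y (e i) ω) x := by
      intro x
      rw [Finset.sum_eq_single (π x)]
      · rw [indicator_of_mem (by simp), mul_comm]
      · intro i _ hi
        rw [indicator_of_notMem]
        simpa using fun h => hi h.symm
      · simp
    simp only [h1]
    rw [integral_finsetSum]
    · refine Finset.sum_congr rfl fun i _ => ?_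
      rw [setIntegral_indicator (hπ (measurableSet_singleton i)), integral_mul_const]
    · intro i _
      exact (hhi.integrable.mul_const _).indicator (hπ (measurableSet_singleton i))
  have hi3 : Integrable (fun p : E × Ω => Y p.1 p.2 * h p.1 - Y (e (π p.1)) p.2 * h p.1)
      ((ν.restrict A).prod P) := hi1.sub hi2
  calc ∫ ω, ‖∫ x in A, Y x ω * h x ∂ν - ∑ i, (∫ x in A ∩ π ⁻¹' {i}, h x ∂ν) * Y (e i) ω‖ ∂P
      ≤ ∫ ω, ∫ x in A, ‖Y x ω * h x - Y (e (π x)) ω * h x‖ ∂ν ∂P := by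
        refine integral_mono_of_nonneg (ae_of_all _ fun _ => norm_nonneg _)
          hi3.norm.integral_prod_right ?_
        filter_upwards [hi1.prod_left_ae, hi2.prod_left_ae] with ω h1 h2
        rw [hstep, ← integral_sub h1 h2]
        exact norm_integral_le_integral_norm _
    _ = ∫ x in A, ∫ ω, ‖Y x ω * h x - Y (e (π x)) ω * h x‖ ∂P ∂ν :=
        (integral_integral_swap hi3.norm).symm
    _ ≤ ∫ x in A, η * H ∂ν := by
        refine setIntegral_mono_on hi3.norm.integral_prod_left (integrableOn_const hνA) hAm
          fun x hx => ?_
        simp only [← sub_mul, norm_mul]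
        rw [integral_mul_const]
        exact mul_le_mul (hη x hx) (hH x hx) (norm_nonneg _)
          ((integral_nonneg fun _ => norm_nonneg _).trans (hη x hx))
    _ = η * H * ν.real A := by rw [setIntegral_const, smul_eq_mul, mul_comm]

variable [PseudoMetricSpace E] [OpensMeasurableSpace E]

/-- A totally bounded set has a measurable projection onto a finite `δ`-net. -/
theorem exists_measurable_finite_net {A : Set E} (hA : TotallyBounded A) (hne : A.Nonempty)
    {δ : ℝ} (hδ : 0 < δ) :
    ∃ (N : ℕ) (e : Fin N → E) (π : E → Fin N), Measurable π ∧ (∀ i, e i ∈ A) ∧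
      ∀ x ∈ A, dist x (e (π x)) ≤ δ := by
  obtain ⟨t, htA, htf, ht⟩ := Metric.finite_approx_of_totallyBounded hA δ hδ
  have htne : t.Nonempty := by
    obtain ⟨x, hx⟩ := hne
    obtain ⟨y, hy, -⟩ := mem_iUnion₂.1 (ht hx)
    exact ⟨y, hy⟩
  obtain ⟨f, rfl⟩ := htf.countable.exists_eq_range htne
  obtain ⟨m, hm⟩ : ∃ m, ∀ y ∈ range f, ∃ k ≤ m, f k = y := by
    choose! g hg using fun (y : E) (hy : y ∈ range f) => hy
    obtain ⟨m, hm⟩ := (htf.image g).bddAbove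
    exact ⟨m, fun y hy => ⟨g y, hm (mem_image_of_mem g hy), hg y hy⟩⟩
  refine ⟨m + 1, fun i => f i,
    fun x => ⟨SimpleFunc.nearestPtInd f m x, Nat.lt_succ_of_le (SimpleFunc.nearestPtInd_le f m x)⟩,
    ?_, fun i => htA (mem_range_self _), fun x hx => ?_⟩
  · refine measurable_to_countable' fun i => ?_
    have : (fun x => (⟨SimpleFunc.nearestPtInd f m x,
        Nat.lt_succ_of_le (SimpleFunc.nearestPtInd_le f m x)⟩ : Fin (m + 1))) ⁻¹' {i} =
        SimpleFunc.nearestPtInd f m ⁻¹' {(i : ℕ)} := by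
      ext x; simp [Fin.ext_iff]
    rw [this]
    exact SimpleFunc.measurableSet_fiber _ _
  · obtain ⟨y, hy, hxy⟩ := mem_iUnion₂.1 (ht hx)
    obtain ⟨k, hk, rfl⟩ := hm y hy
    have h1 := SimpleFunc.edist_nearestPt_le f x hk
    rw [edist_comm, edist_comm (f k), edist_dist, edist_dist,
      ENNReal.ofReal_le_ofReal_iff dist_nonneg] at h1
    exact h1.trans (Metric.mem_ball.1 hxy).le

/-- A process with almost surely continuous paths is jointly measurable. -/
theorem aestronglyMeasurable_prod_of_continuousOn [SFinite ν] [SFinite P] (hA : TotallyBounded A)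
    (hAm : MeasurableSet A) (hY : ∀ x ∈ A, AEStronglyMeasurable (Y x) P)
    (hc : ∀ᵐ ω ∂P, ContinuousOn (fun x => Y x ω) A) :
    AEStronglyMeasurable (fun p : E × Ω => Y p.1 p.2) ((ν.restrict A).prod P) := by
  rcases A.eq_empty_or_nonempty with rfl | hne
  · simp
  choose N e π hπ he hd using fun k : ℕ =>
    exists_measurable_finite_net hA hne (δ := 1 / ((k : ℝ) + 1)) (by positivity)
  refine aestronglyMeasurable_of_tendsto_ae atTop
    (f := fun k (p : E × Ω) => Y (e k (π k p.1)) p.2)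
    (fun k => aestronglyMeasurable_comp_fin (hπ k) fun i => hY _ (he k i)) ?_
  have h1 : ∀ᵐ p ∂((ν.restrict A).prod P), p.1 ∈ A :=
    Measure.quasiMeasurePreserving_fst.ae (ae_restrict_mem hAm)
  have h2 : ∀ᵐ p ∂((ν.restrict A).prod P), ContinuousOn (fun x => Y x p.2) A :=
    Measure.quasiMeasurePreserving_snd.ae hc
  filter_upwards [h1, h2] with p hp hcp
  refine (hcp p.1 hp).tendsto.comp (tendsto_nhdsWithin_iff.2 ⟨?_, Eventually.of_forall
    fun k => he k _⟩)
  rw [tendsto_iff_dist_tendsto_zero]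
  refine squeeze_zero (fun _ => dist_nonneg) (fun k => ?_) tendsto_one_div_add_atTop_nhds_zero_nat
  rw [dist_comm]
  exact hd k _ hp

end random_integrals

/-! ### Mollified values of the field -/

section field

variable {d : ℕ}

local notation "𝔼" => EuclideanSpace ℝ (Fin d)

theorem IsSmoothingKernel.hasCompactSupport {θ : 𝔼 → ℝ} (hθ : IsSmoothingKernel θ) :
    HasCompactSupport θ :=
  (isCompact_closedBall 0 1).of_isClosed_subset (isClosed_tsupport θ) hθ.support

theorem IsSmoothingKernel.exists_le {θ : 𝔼 → ℝ} (hθ : IsSmoothingKernel θ) :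
    ∃ M, 0 ≤ M ∧ ∀ z, θ z ≤ M := by
  obtain ⟨M, hM⟩ := hθ.hasCompactSupport.exists_bound_of_continuous hθ.smooth.continuous
  exact ⟨M, (norm_nonneg _).trans (hM 0), fun z => (le_abs_self _).trans (hM z)⟩

theorem IsSmoothingKernel.isMollifierAt {θ : 𝔼 → ℝ} (hθ : IsSmoothingKernel θ) {M : ℝ}
    (hM : ∀ z, θ z ≤ M) {ε : ℝ} (hε : 0 < ε) (x : 𝔼) :
    IsMollifierAt x ε M fun z => scaledKernel θ ε (x - z) where
  continuous := continuous_const.mul (hθ.smooth.continuous.comp (by fun_prop))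
  nonneg z := mul_nonneg (by positivity) (hθ.nonneg _)
  integral_eq_one := by
    rw [integral_sub_left_eq_self (scaledKernel θ ε) volume x]
    simp only [scaledKernel]
    rw [integral_const_mul, Measure.integral_comp_inv_smul_of_nonneg _ _ hε.le,
      hθ.integral_eq_one, finrank_euclideanSpace_fin, smul_eq_mul, mul_one]
    exact inv_mul_cancel₀ (by positivity)
  eq_zero z hz := by
    have : ε⁻¹ • (x - z) ∉ tsupport θ := fun h => by
      have h1 := hθ.support h
      rw [mem_closedBall_zero_iff, norm_smul, norm_inv, Real.norm_of_nonneg hε.le,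
        ← dist_eq_norm, dist_comm, inv_mul_le_iff₀ hε, mul_one] at h1
      exact absurd h1 (not_le.2 hz)
    simp only [scaledKernel]
    rw [image_eq_zero_of_notMem_tsupport this, mul_zero]
  le z := by
    rw [scaledKernel, mul_comm]
    exact mul_le_mul_of_nonneg_right (hM _) (by positivity)

/-- The translates of a scaled smoothing kernel depend uniformly continuously on the centre. -/
theorem IsSmoothingKernel.exists_abs_scaledKernel_sub_le {θ : 𝔼 → ℝ} (hθ : IsSmoothingKernel θ)
    {ε : ℝ} {η : ℝ} (hη : 0 < η) :
    ∃ δ : ℝ, 0 < δ ∧ ∀ x y : 𝔼, dist x y ≤ δ →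
      ∀ z, |scaledKernel θ ε (x - z) - scaledKernel θ ε (y - z)| ≤ η := by
  have hu : UniformContinuous θ :=
    hθ.hasCompactSupport.uniformContinuous_of_continuous hθ.smooth.continuous
  have hu' : UniformContinuous (scaledKernel θ ε) :=
    (hu.comp (uniformContinuous_const_smul ε⁻¹)).const_mul' _
  obtain ⟨δ, hδ, h⟩ := Metric.uniformContinuous_iff.1 hu' η hη
  refine ⟨δ / 2, half_pos hδ, fun x y hxy z => ?_⟩
  have := h (a := x - z) (b := y - z) (by rw [dist_sub_right]; linarith)
  rw [Real.dist_eq] at this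
  exact this.le

variable {D : Set (EuclideanSpace ℝ (Fin d))}
  {K : EuclideanSpace ℝ (Fin d) → EuclideanSpace ℝ (Fin d) → ℝ}
  {Q : ℕ → EuclideanSpace ℝ (Fin d) → EuclideanSpace ℝ (Fin d) → ℝ}
  {S : Set (EuclideanSpace ℝ (Fin d))}

theorem abs_bilForm_sub_bilForm_le (hS : MeasurableSet S)
    (hK : IntegrableOn (fun p : 𝔼 × 𝔼 => K p.1 p.2) (S ×ˢ S) (volume.prod volume))
    {φ ψ φ' ψ' : 𝔼 → ℝ} {a : ℝ}
    (hφ : Continuous φ) (hψ : Continuous ψ) (hφ' : Continuous φ') (hψ' : Continuous ψ')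
    (ha : ∀ x, |φ x| ≤ a) (hb : ∀ x, |ψ x| ≤ a) (ha' : ∀ x, |φ' x| ≤ a) (hb' : ∀ x, |ψ' x| ≤ a)
    (hφS : ∀ x ∉ S, φ x = 0) (hψS : ∀ x ∉ S, ψ x = 0) (hφS' : ∀ x ∉ S, φ' x = 0)
    (hψS' : ∀ x ∉ S, ψ' x = 0) {c : ℝ} (hc : ∀ x y, |φ x * ψ y - φ' x * ψ' y| ≤ c) :
    |bilForm K φ ψ - bilForm K φ' ψ'| ≤
      c * ∫ p in S ×ˢ S, |K p.1 p.2| ∂(volume.prod volume) := by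
  obtain ⟨i1, e1⟩ := bilForm_eq_setIntegral hS hK hφ hψ ha hb hφS hψS
  obtain ⟨i2, e2⟩ := bilForm_eq_setIntegral hS hK hφ' hψ' ha' hb' hφS' hψS'
  rw [e1, e2, ← integral_sub i1 i2, ← integral_const_mul, ← Real.norm_eq_abs]
  refine norm_integral_le_of_norm_le (hK.norm.const_mul c) (ae_of_all _ fun p => ?_)
  rw [← sub_mul, norm_mul]
  exact mul_le_mul_of_nonneg_right (hc _ _) (norm_nonneg _)

variable {Ω : Type*} [MeasurableSpace Ω] {P : Measure Ω} [IsProbabilityMeasure P]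
  {X : SignedMeasure (EuclideanSpace ℝ (Fin d)) → Ω → ℝ}

/-- Finitely many mollified values of the field form a centered Gaussian vector. -/
theorem IsGaussianFieldWithKernel.isCenteredGaussianVec [NeZero d]
    (hX : IsGaussianFieldWithKernel P D K X) (hK : HasNiceDecomposition D K Q)
    (hS : IsCompact S) (hSD : S ⊆ D) {ι : Type*} [Fintype ι] {x : ι → 𝔼} {ε M : ι → ℝ}
    {φ : ι → 𝔼 → ℝ} (hφ : ∀ i, IsMollifierAt (x i) (ε i) (M i) (φ i))
    (hφS : ∀ i, ∀ z ∉ S, φ i z = 0) {G : Ω → ι → ℝ}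
    (hG : ∀ i, (fun ω => G ω i) =ᵐ[P] X (volume.withDensityᵥ (φ i))) :
    IsCenteredGaussianVec P (fun i j => symForm K (φ i) (φ j)) G := by
  have hmem := fun i => hK.mem_energySpace hS hSD (hφ i) (hφS i)
  have hcov : ∀ i j, ∫ ω, X (volume.withDensityᵥ (φ i)) ω * X (volume.withDensityᵥ (φ j)) ω ∂P =
      bilForm K (φ i) (φ j) := fun i j => by
    rw [hX.covariance _ (hmem i) _ (hmem j), kernelForm_withDensityᵥ (hφ i).nonneg
      (hφ i).integrable (hφ i).continuous.measurable (hφ j).nonneg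
      (hφ j).integrable (hφ j).continuous.measurable]
  -- the form is symmetric here since it is a covariance, although `K` need not be symmetric
  have hsym : ∀ i j, bilForm K (φ i) (φ j) = symForm K (φ i) (φ j) := fun i j => by
    have : bilForm K (φ j) (φ i) = bilForm K (φ i) (φ j) := by
      rw [← hcov, ← hcov]
      simp only [mul_comm]
    rw [symForm, this, add_self_div_two]
  have hgauss : HasGaussianLaw (fun ω i => X (volume.withDensityᵥ (φ i)) ω) P := by
    classical
    set e : ι → energySpace D K := fun i => ⟨_, hmem i⟩
    let L : (Finset.univ.image e → ℝ) →L[ℝ] ι → ℝ := ContinuousLinearMap.pi fun i =>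
      ContinuousLinearMap.proj (⟨e i, by simp⟩ : Finset.univ.image e)
    exact (hX.gaussian.hasGaussianLaw (Finset.univ.image e)).map L
  have hae : (fun ω i => X (volume.withDensityᵥ (φ i)) ω) =ᵐ[P] G := by
    filter_upwards [ae_all_iff.2 hG] with ω h
    ext i
    exact (h i).symm
  have hgm := hgauss.aemeasurable
  refine (isCenteredGaussianVec_of_hasGaussianLaw hgauss hgm
    (fun i => hX.centered _ (hmem i)) (fun i j => (hcov i j).trans (hsym i j)) ?_).of_map_eq
    (hgm.congr hae) (Measure.map_congr hae)
  have := posSemidef_sub_sum_range (fun k => hK.posSemidef hS hSD hφ hφS k)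
    (fun i j => hK.hasSum_symForm hS hSD (hφ i) (hφ j) (hφS i) (hφS j)) 0
  simpa using this

end field

/-! ### The mollified field at a fixed scale -/

section field

variable {d : ℕ}

local notation "𝔼" => EuclideanSpace ℝ (Fin d)

variable {D : Set (EuclideanSpace ℝ (Fin d))}
  {K : EuclideanSpace ℝ (Fin d) → EuclideanSpace ℝ (Fin d) → ℝ}
  {Q : ℕ → EuclideanSpace ℝ (Fin d) → EuclideanSpace ℝ (Fin d) → ℝ}
  {S A : Set (EuclideanSpace ℝ (Fin d))} {θ : EuclideanSpace ℝ (Fin d) → ℝ} {ε : ℝ}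

theorem mollifiedVariance_eq_symForm (K : 𝔼 → 𝔼 → ℝ) (θ : 𝔼 → ℝ) (ε : ℝ) (x : 𝔼) :
    mollifiedVariance K θ ε x = symForm K (fun z => scaledKernel θ ε (x - z))
      (fun z => scaledKernel θ ε (x - z)) := by
  rw [symForm, add_self_div_two]
  rfl

theorem IsSmoothingKernel.scaledKernel_eq_zero (hθ : IsSmoothingKernel θ) (hε : 0 < ε)
    (hAS : ∀ x ∈ A, Metric.closedBall x ε ⊆ S) {x : 𝔼} (hx : x ∈ A) :
    ∀ z ∉ S, scaledKernel θ ε (x - z) = 0 := by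
  intro z hz
  obtain ⟨M, -, hM⟩ := hθ.exists_le
  refine (hθ.isMollifierAt hM hε x).eq_zero z ?_
  by_contra h
  exact hz (hAS x hx (not_lt.1 h))

/-- At a fixed scale the mollified covariance is bounded and uniformly continuous. -/
theorem HasNiceDecomposition.exists_symForm_scaledKernel_bound [NeZero d]
    (hK : HasNiceDecomposition D K Q) (hS : IsCompact S) (hSD : S ⊆ D) (hθ : IsSmoothingKernel θ)
    (hε : 0 < ε) (hAS : ∀ x ∈ A, Metric.closedBall x ε ⊆ S) :
    ∃ R : ℝ, (∀ x ∈ A, ∀ y ∈ A, |symForm K (fun z => scaledKernel θ ε (x - z))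
        (fun z => scaledKernel θ ε (y - z))| ≤ R) ∧
      ∀ η : ℝ, 0 < η → ∃ δ : ℝ, 0 < δ ∧ ∀ x ∈ A, ∀ x' ∈ A, ∀ y ∈ A, ∀ y' ∈ A,
        dist x x' ≤ δ → dist y y' ≤ δ →
        |symForm K (fun z => scaledKernel θ ε (x - z)) (fun z => scaledKernel θ ε (y - z)) -
          symForm K (fun z => scaledKernel θ ε (x' - z)) (fun z => scaledKernel θ ε (y' - z))|
          ≤ η := by
  obtain ⟨M, hM0, hM⟩ := hθ.exists_le
  have hmol := fun x => hθ.isMollifierAt hM hε x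
  have hzero := fun x (hx : x ∈ A) => hθ.scaledKernel_eq_zero hε hAS hx
  have hKi := hK.integrableOn_kernel hS hSD
  set I := ∫ p in S ×ˢ S, |K p.1 p.2| ∂(volume.prod volume) with hI
  have hI0 : 0 ≤ I := integral_nonneg fun _ => abs_nonneg _
  set a := M * (ε ^ d)⁻¹ with ha
  have ha0 : 0 ≤ a := by positivity
  set φ : 𝔼 → 𝔼 → ℝ := fun x z => scaledKernel θ ε (x - z) with hφ
  have hcomp : ∀ x ∈ A, ∀ x' ∈ A, ∀ y ∈ A, ∀ y' ∈ A, ∀ c, (∀ z, |φ x z - φ x' z| ≤ c) →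
      (∀ z, |φ y z - φ y' z| ≤ c) →
      |bilForm K (φ x) (φ y) - bilForm K (φ x') (φ y')| ≤ (2 * a * c) * I := by
    intro x hx x' hx' y hy y' hy' c h1 h2
    refine abs_bilForm_sub_bilForm_le hS.measurableSet hKi (hmol x).continuous
      (hmol y).continuous (hmol x').continuous (hmol y').continuous (hmol x).abs_le
      (hmol y).abs_le (hmol x').abs_le (hmol y').abs_le (hzero x hx) (hzero y hy) (hzero x' hx')
      (hzero y' hy') fun u v => ?_
    have e : φ x u * φ y v - φ x' u * φ y' v =
        (φ x u - φ x' u) * φ y v + φ x' u * (φ y v - φ y' v) := by ring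
    change |φ x u * φ y v - φ x' u * φ y' v| ≤ _
    rw [e]
    refine (abs_add_le _ _).trans ?_
    rw [abs_mul, abs_mul]
    have b1 := mul_le_mul (h1 u) ((hmol y).abs_le v) (abs_nonneg _) ((abs_nonneg _).trans (h1 u))
    have b2 := mul_le_mul ((hmol x').abs_le u) (h2 v) (abs_nonneg _) ha0
    linarith
  refine ⟨a * a * I, fun x hx y hy => ?_, fun η hη => ?_⟩
  · have hb : ∀ x ∈ A, ∀ y ∈ A, |bilForm K (φ x) (φ y)| ≤ a * a * I := by
      intro x hx y hy
      have := abs_bilForm_sub_bilForm_le hS.measurableSet hKi (hmol x).continuous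
        (hmol y).continuous continuous_const continuous_const (hmol x).abs_le (hmol y).abs_le
        (φ' := fun _ => 0) (ψ' := fun _ => 0) (by simpa using ha0) (by simpa using ha0)
        (hzero x hx) (hzero y hy) (by simp) (by simp) (c := a * a) (fun u v => by
          rw [mul_zero, sub_zero, abs_mul]
          exact mul_le_mul ((hmol x).abs_le u) ((hmol y).abs_le v) (abs_nonneg _) ha0)
      have h0 : bilForm K (fun _ => 0) (fun _ => 0) = 0 := by simp [bilForm]
      rwa [h0, sub_zero] at this
    have h1 := abs_le.1 (hb x hx y hy)
    have h2 := abs_le.1 (hb y hy x hx)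
    rw [symForm, abs_le]
    constructor <;> linarith [h1.1, h1.2, h2.1, h2.2]
  · obtain ⟨δ, hδ, h⟩ := hθ.exists_abs_scaledKernel_sub_le (ε := ε)
      (η := η / (2 * a * I + 1)) (by positivity)
    refine ⟨δ, hδ, fun x hx x' hx' y hy y' hy' h1 h2 => ?_⟩
    have hle : (2 * a * (η / (2 * a * I + 1))) * I ≤ η := by
      have e : (2 * a * (η / (2 * a * I + 1))) * I = η * (2 * a * I / (2 * a * I + 1)) := by
        field_simp
      rw [e]
      refine mul_le_of_le_one_right hη.le ?_
      rw [div_le_one (by positivity)]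
      linarith
    have b1 := abs_le.1 ((hcomp x hx x' hx' y hy y' hy' _ (h x x' h1) (h y y' h2)).trans hle)
    have b2 := abs_le.1 ((hcomp y hy y' hy' x hx x' hx' _ (h y y' h2) (h x x' h1)).trans hle)
    simp only [symForm]
    rw [abs_le]
    constructor <;> linarith [b1.1, b1.2, b2.1, b2.2]

variable {Ω : Type*} [MeasurableSpace Ω] {P : Measure Ω}
  {X : SignedMeasure (EuclideanSpace ℝ (Fin d)) → Ω → ℝ}
  {Xε : ℝ → EuclideanSpace ℝ (Fin d) → Ω → ℝ}

theorem IsMollifiedField.ae_continuousOn_wickExp [NeZero d] (hXε : IsMollifiedField P D X θ Xε)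
    (hK : HasNiceDecomposition D K Q)
    (hS : IsCompact S) (hSD : S ⊆ D) (hθ : IsSmoothingKernel θ) (hε : ε ∈ Ioc (0 : ℝ) 1)
    (hA : A ⊆ shrunkDomain D ε) (hAS : ∀ x ∈ A, Metric.closedBall x ε ⊆ S) (γ : ℂ) :
    ∀ᵐ ω ∂P, ContinuousOn
      (fun x => wickExp γ (mollifiedVariance K θ ε x) (Xε ε x ω)) A := by
  obtain ⟨R, -, hδ⟩ := hK.exists_symForm_scaledKernel_bound hS hSD hθ hε.1 hAS
  have hv : ContinuousOn (mollifiedVariance K θ ε) A := by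
    rw [Metric.continuousOn_iff]
    intro y hy η hη
    obtain ⟨δ, hδ0, h⟩ := hδ (η / 2) (half_pos hη)
    refine ⟨δ, hδ0, fun x hx hxy => ?_⟩
    rw [Real.dist_eq, mollifiedVariance_eq_symForm, mollifiedVariance_eq_symForm]
    exact (h x hx y hy x hx y hy hxy.le hxy.le).trans_lt (half_lt_self hη)
  filter_upwards [hXε.continuous] with ω hω
  have hx : ContinuousOn (fun x => Xε ε x ω) A :=
    hω.comp (f := fun x : 𝔼 => (ε, x)) (by fun_prop) fun x hx => ⟨hε, hA hx⟩
  simp only [wickExp]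
  have hv' := Complex.continuous_ofReal.comp_continuousOn hv
  have hx' := Complex.continuous_ofReal.comp_continuousOn hx
  exact Complex.continuous_exp.comp_continuousOn
    ((continuousOn_const.mul hx').sub (continuousOn_const.mul hv'))

variable [IsProbabilityMeasure P]

/-- Finitely many values of the mollified field form a centered Gaussian vector. -/
theorem IsMollifiedField.isCenteredGaussianVec [NeZero d] (hXε : IsMollifiedField P D X θ Xε)
    (hX : IsGaussianFieldWithKernel P D K X) (hK : HasNiceDecomposition D K Q)
    (hS : IsCompact S) (hSD : S ⊆ D) (hθ : IsSmoothingKernel θ) (hε : ε ∈ Ioc (0 : ℝ) 1)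
    (hA : A ⊆ shrunkDomain D ε) (hAS : ∀ x ∈ A, Metric.closedBall x ε ⊆ S) {ι : Type*} [Fintype ι]
    {x : ι → 𝔼} (hx : ∀ i, x i ∈ A) :
    IsCenteredGaussianVec P (fun i j => symForm K (fun z => scaledKernel θ ε (x i - z))
      (fun z => scaledKernel θ ε (x j - z))) (fun ω i => Xε ε (x i) ω) := by
  obtain ⟨M, -, hM⟩ := hθ.exists_le
  exact hX.isCenteredGaussianVec hK hS hSD (fun i => hθ.isMollifierAt hM hε.1 (x i))
    (fun i => hθ.scaledKernel_eq_zero hε.1 hAS (hx i)) fun i => hXε.version ε hε _ (hA (hx i))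

theorem IsMollifiedField.integrable_wickExp [NeZero d] (hXε : IsMollifiedField P D X θ Xε)
    (hX : IsGaussianFieldWithKernel P D K X) (hK : HasNiceDecomposition D K Q)
    (hS : IsCompact S) (hSD : S ⊆ D) (hθ : IsSmoothingKernel θ) (hε : ε ∈ Ioc (0 : ℝ) 1)
    (hA : A ⊆ shrunkDomain D ε) (hAS : ∀ x ∈ A, Metric.closedBall x ε ⊆ S) (γ : ℂ) :
    ∃ R : ℝ, ∀ x ∈ A,
      Integrable (fun ω => wickExp γ (mollifiedVariance K θ ε x) (Xε ε x ω)) P ∧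
      ∫ ω, ‖wickExp γ (mollifiedVariance K θ ε x) (Xε ε x ω)‖ ∂P ≤ R := by
  obtain ⟨R, hR, -⟩ := hK.exists_symForm_scaledKernel_bound hS hSD hθ hε.1 hAS
  refine ⟨Real.exp (γ.im ^ 2 / 2 * R), fun x hx => ?_⟩
  have hvec := hXε.isCenteredGaussianVec hX hK hS hSD hθ hε hA hAS (ι := Unit) (x := fun _ => x)
    fun _ => hx
  have h1 := (hvec.integral_norm_wickExp_rpow γ 1 ()).2
  have h2 := hvec.integrable_wickExp γ (mollifiedVariance K θ ε x) ()
  rw [mollifiedVariance_eq_symForm] at h2 ⊢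
  refine ⟨h2, ?_⟩
  simp only [Real.rpow_one] at h1
  rw [h1]
  refine Real.exp_le_exp.2 ?_
  have := mul_le_mul_of_nonneg_left ((abs_le.1 (hR x hx x hx)).2)
    (by positivity : 0 ≤ γ.im ^ 2 / 2)
  refine le_trans (le_of_eq ?_) this
  ring

/-- At a fixed scale the normalised exponential of the field is uniformly continuous in mean. -/
theorem IsMollifiedField.exists_integral_norm_wickExp_sub_le [NeZero d]
    (hXε : IsMollifiedField P D X θ Xε)
    (hX : IsGaussianFieldWithKernel P D K X) (hK : HasNiceDecomposition D K Q)
    (hS : IsCompact S) (hSD : S ⊆ D) (hθ : IsSmoothingKernel θ) (hε : ε ∈ Ioc (0 : ℝ) 1)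
    (hA : A ⊆ shrunkDomain D ε) (hAS : ∀ x ∈ A, Metric.closedBall x ε ⊆ S) (γ : ℂ) {η : ℝ}
    (hη : 0 < η) :
    ∃ δ : ℝ, 0 < δ ∧ ∀ x ∈ A, ∀ y ∈ A, dist x y ≤ δ →
      ∫ ω, ‖wickExp γ (mollifiedVariance K θ ε x) (Xε ε x ω) -
        wickExp γ (mollifiedVariance K θ ε y) (Xε ε y ω)‖ ∂P ≤ η := by
  obtain ⟨R, hR, hδ⟩ := hK.exists_symForm_scaledKernel_bound hS hSD hθ hε.1 hAS
  obtain ⟨δ₁, hδ₁, h1⟩ := exists_sqrt_exp_sub_one_lt (‖γ‖ ^ 2) R hη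
  obtain ⟨δ, hδ0, h2⟩ := hδ δ₁ hδ₁
  refine ⟨δ, hδ0, fun x hx y hy hxy => ?_⟩
  have hvec := hXε.isCenteredGaussianVec hX hK hS hSD hθ hε hA hAS (ι := Fin 2) (x := ![x, y])
    (by intro i; fin_cases i <;> assumption)
  simp only [mollifiedVariance_eq_symForm]
  have d0 : ∀ u : 𝔼, dist u u ≤ δ := fun u => by rw [dist_self]; exact hδ0.le
  have e1 := (abs_le.1 (h2 x hx x hx x hx y hy (d0 x) hxy)).2
  have e2 := (abs_le.1 (h2 y hy x hx y hy y hy (by rwa [dist_comm]) (d0 y))).2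
  exact (hvec.integral_norm_wickExp_sub_le' (fun i j => by simp only [symForm]; ring) γ 0 1
    ((le_abs_self _).trans (hR x hx y hy)) e1 e2 hδ₁.le).trans h1.le

end field

/-! ### The mollified chaos as a random integral -/

section chaos

variable {d : ℕ}

local notation "𝔼" => EuclideanSpace ℝ (Fin d)

variable {D : Set (EuclideanSpace ℝ (Fin d))}

theorem measurableSet_shrunkDomain (hD : IsOpen D) {ε : ℝ} (hε : 0 ≤ ε) :
    MeasurableSet (shrunkDomain D ε) := by
  have : shrunkDomain D ε = D \ Metric.cthickening (2 * ε) Dᶜ := by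
    rw [hD.isClosed_compl.cthickening_eq_biUnion_closedBall (by positivity)]
    ext x
    simp [shrunkDomain]
  rw [this]
  exact hD.measurableSet.diff Metric.isClosed_cthickening.measurableSet

theorem cthickening_subset_of_subset_shrunkDomain {A : Set 𝔼} {ε : ℝ} (hε : 0 < ε)
    (hA : A ⊆ shrunkDomain D ε) : Metric.cthickening ε A ⊆ D := by
  intro z hz
  obtain ⟨x, hx, hzx⟩ := Metric.mem_thickening_iff.1
    (Metric.cthickening_subset_thickening' (by positivity) (by linarith : ε < 2 * ε) A hz)
  by_contra hzD
  have := (hA hx).2 z hzD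
  rw [dist_comm] at this
  exact absurd hzx (not_lt.2 this.le)

theorem isCompact_cthickening_of_isBounded {A : Set 𝔼} (hA : Bornology.IsBounded A) (ε : ℝ) :
    IsCompact (Metric.cthickening ε A) :=
  Metric.isCompact_of_isClosed_isBounded Metric.isClosed_cthickening hA.cthickening

theorem exists_subset_shrunkDomain {A : Set 𝔼} (hD : IsOpen D) (hA : IsCompact A) (hAD : A ⊆ D) :
    ∃ ε₀ : ℝ, 0 < ε₀ ∧ ε₀ ≤ 1 ∧ ∀ ε ≤ ε₀, A ⊆ shrunkDomain D ε := by
  obtain ⟨δ, hδ, h⟩ := hA.exists_cthickening_subset_open hD hAD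
  refine ⟨min (δ / 3) 1, by positivity, min_le_right _ _, fun ε hε x hx =>
    ⟨hAD hx, fun y hy => ?_⟩⟩
  by_contra hlt
  have h1 := hε.trans (min_le_left _ _)
  refine hy (h (Metric.closedBall_subset_cthickening hx δ (Metric.mem_closedBall.2 ?_)))
  rw [dist_comm]
  linarith

variable {K : EuclideanSpace ℝ (Fin d) → EuclideanSpace ℝ (Fin d) → ℝ}
  {Q : ℕ → EuclideanSpace ℝ (Fin d) → EuclideanSpace ℝ (Fin d) → ℝ}
  {S A : Set (EuclideanSpace ℝ (Fin d))} {θ : EuclideanSpace ℝ (Fin d) → ℝ} {ε : ℝ}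
  {Ω : Type*} {f ϱ : EuclideanSpace ℝ (Fin d) → ℝ}
  {X : SignedMeasure (EuclideanSpace ℝ (Fin d)) → Ω → ℝ}
  {Xε : ℝ → EuclideanSpace ℝ (Fin d) → Ω → ℝ}

/-- The domain of integration may be reduced to any set outside which `f` vanishes. -/
theorem complexChaos_eq_setIntegral (hA : A ⊆ shrunkDomain D ε)
    (hAm : MeasurableSet (shrunkDomain D ε)) (hf : ∀ x ∈ shrunkDomain D ε, x ∉ A → f x = 0)
    (γ : ℂ) (ω : Ω) :
    complexChaos D K θ Xε ϱ f γ ε ω = ∫ x in A,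
      wickExp γ (mollifiedVariance K θ ε x) (Xε ε x ω) * ((f x : ℂ) * (ϱ x : ℂ)) := by
  rw [complexChaos]
  simp only [wickExp, ← mul_assoc]
  refine setIntegral_eq_of_subset_of_forall_sdiff_eq_zero hAm hA fun x hx => ?_
  simp [hf x hx.1 hx.2]

/-- The weight is measurable on subsets of `D`; nothing is assumed on `ϱ` off `D`. -/
theorem aestronglyMeasurable_mul_restrict (hD : IsOpen D) (hϱ : Measurable fun x : D => ϱ x)
    (hf : Continuous f) (hAD : A ⊆ D) :
    AEStronglyMeasurable (fun x => (f x : ℂ) * (ϱ x : ℂ)) (volume.restrict A) := by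
  have h1 : AEMeasurable ϱ (volume.restrict D) :=
    (aemeasurable_restrict_iff_comap_subtype hD.measurableSet).2 hϱ.aemeasurable
  have h2 : AEMeasurable ϱ (volume.restrict A) := h1.mono_set hAD
  exact ((Complex.measurable_ofReal.comp hf.measurable).aemeasurable.mul
    (Complex.measurable_ofReal.comp_aemeasurable h2)).aestronglyMeasurable

theorem exists_norm_mul_le (hϱ : ∃ B : ℝ, ∀ x ∈ D, |ϱ x| ≤ B) (hf : Continuous f)
    (hfs : HasCompactSupport f) :
    ∃ H : ℝ, 0 ≤ H ∧ ∀ x ∈ D, ‖(f x : ℂ) * (ϱ x : ℂ)‖ ≤ H := by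
  obtain ⟨B, hB⟩ := hϱ
  obtain ⟨F, hF⟩ := hfs.exists_bound_of_continuous hf
  refine ⟨F * |B|, mul_nonneg ((norm_nonneg _).trans (hF 0)) (abs_nonneg _), fun x hx => ?_⟩
  rw [norm_mul, Complex.norm_real, Complex.norm_real]
  exact mul_le_mul (hF x) ((hB x hx).trans (le_abs_self B)) (norm_nonneg _)
    ((norm_nonneg _).trans (hF 0))

/-- The total weight attached by a discretisation of mesh at most `r` to a ball of radius `r` is
at most of the order of the volume of the ball. -/
theorem sum_norm_setIntegral_le {h : 𝔼 → ℂ} (hA : MeasurableSet A) (hAfin : volume A ≠ ∞)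
    {H : ℝ} (hH0 : 0 ≤ H) (hH : ∀ x ∈ A, ‖h x‖ ≤ H) {N : ℕ} {e : Fin N → 𝔼} {π : 𝔼 → Fin N}
    (hπ : Measurable π) :
    (∑ i, ‖∫ x in A ∩ π ⁻¹' {i}, h x‖ ≤ H * volume.real A) ∧
    ∀ r : ℝ, 0 ≤ r → (∀ x ∈ A, dist x (e (π x)) ≤ r) → ∀ z,
      ∑ i with dist (e i) z ≤ r, ‖∫ x in A ∩ π ⁻¹' {i}, h x‖ ≤
        H * ((2 * r) ^ d * volume.real (Metric.ball (0 : 𝔼) 1)) := by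
  have hm : ∀ i, MeasurableSet (A ∩ π ⁻¹' {i}) := fun i =>
    hA.inter (hπ (measurableSet_singleton i))
  have hdis : ∀ s : Finset (Fin N), (s : Set (Fin N)).PairwiseDisjoint fun i => A ∩ π ⁻¹' {i} := by
    intro s i _ j _ hij
    refine Set.disjoint_left.2 fun x hx hx' => hij ?_
    exact (mem_singleton_iff.1 hx.2).symm.trans hx'.2
  have hfin : ∀ i, volume (A ∩ π ⁻¹' {i}) ≠ ∞ := fun i =>
    ((measure_mono inter_subset_left).trans_lt hAfin.lt_top).ne
  have key : ∀ s : Finset (Fin N), ∑ i ∈ s, ‖∫ x in A ∩ π ⁻¹' {i}, h x‖ ≤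
      H * volume.real (⋃ i ∈ s, A ∩ π ⁻¹' {i}) := by
    intro s
    rw [measureReal_biUnion_finset (hdis s) (fun i _ => hm i) (fun i _ => hfin i), Finset.mul_sum]
    refine Finset.sum_le_sum fun i _ => ?_
    exact norm_setIntegral_le_of_norm_le_const (hfin i).lt_top fun x hx => hH x hx.1
  constructor
  · refine (key Finset.univ).trans (mul_le_mul_of_nonneg_left ?_ hH0)
    exact measureReal_mono (iUnion₂_subset fun i _ => inter_subset_left) hAfin
  · intro r hr hd z
    refine (key _).trans (mul_le_mul_of_nonneg_left ?_ hH0)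
    rw [← volume_real_closedBall z (by positivity)]
    refine measureReal_mono (iUnion₂_subset fun i hi x hx => ?_) measure_closedBall_lt_top.ne
    have h1 := hd x hx.1
    rw [mem_singleton_iff.1 hx.2] at h1
    have h2 : dist (e i) z ≤ r := by simpa using hi
    exact Metric.mem_closedBall.2 ((dist_triangle _ _ _).trans (by linarith))

variable [MeasurableSpace Ω] {P : Measure Ω} [IsProbabilityMeasure P]

theorem IsMollifiedField.aestronglyMeasurable_wickExp [NeZero d]
    (hXε : IsMollifiedField P D X θ Xε)
    (hX : IsGaussianFieldWithKernel P D K X) (hK : HasNiceDecomposition D K Q)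
    (hS : IsCompact S) (hSD : S ⊆ D) (hθ : IsSmoothingKernel θ) (hε : ε ∈ Ioc (0 : ℝ) 1)
    (hAb : TotallyBounded A) (hAm : MeasurableSet A)
    (hA : A ⊆ shrunkDomain D ε) (hAS : ∀ x ∈ A, Metric.closedBall x ε ⊆ S) (γ : ℂ) :
    AEStronglyMeasurable
      (fun p : 𝔼 × Ω => wickExp γ (mollifiedVariance K θ ε p.1) (Xε ε p.1 p.2))
      ((volume.restrict A).prod P) := by
  obtain ⟨R, hR⟩ := hXε.integrable_wickExp hX hK hS hSD hθ hε hA hAS γ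
  exact aestronglyMeasurable_prod_of_continuousOn
    (Y := fun x ω => wickExp γ (mollifiedVariance K θ ε x) (Xε ε x ω)) hAb hAm
    (fun x hx => (hR x hx).1.aestronglyMeasurable)
    (hXε.ae_continuousOn_wickExp hK hS hSD hθ hε hA hAS γ)

theorem IsMollifiedField.integrable_complexChaos [NeZero d] (hXε : IsMollifiedField P D X θ Xε)
    (hX : IsGaussianFieldWithKernel P D K X) (hK : HasNiceDecomposition D K Q) (hD : IsOpen D)
    (hθ : IsSmoothingKernel θ) (hε : ε ∈ Ioc (0 : ℝ) 1)
    (hϱm : Measurable fun x : D => ϱ x) (hϱ : ∃ B : ℝ, ∀ x ∈ D, |ϱ x| ≤ B)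
    (hf : Continuous f) (hfs : HasCompactSupport f) (γ : ℂ) :
    Integrable (complexChaos D K θ Xε ϱ f γ ε) P := by
  set A := shrunkDomain D ε ∩ tsupport f with hAdef
  have hDm := measurableSet_shrunkDomain hD hε.1.le
  have hA : A ⊆ shrunkDomain D ε := inter_subset_left
  have hAD : A ⊆ D := fun x hx => hx.1.1
  have hAm : MeasurableSet A := hDm.inter (isClosed_tsupport f).measurableSet
  have hAb : Bornology.IsBounded A := hfs.isBounded.subset inter_subset_right
  have hS := isCompact_cthickening_of_isBounded hAb ε
  have hSD := cthickening_subset_of_subset_shrunkDomain hε.1 hA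
  have hAS : ∀ x ∈ A, Metric.closedBall x ε ⊆ Metric.cthickening ε A := fun x hx =>
    Metric.closedBall_subset_cthickening hx ε
  obtain ⟨R, hR⟩ := hXε.integrable_wickExp hX hK hS hSD hθ hε hA hAS γ
  obtain ⟨H, -, hH⟩ := exists_norm_mul_le hϱ hf hfs
  -- the part of the support of `f` in `D_ε` has an `ε`-neighbourhood with compact closure in `D`,
  -- by the factor `2` in the definition of `D_ε`
  have h1 := integrable_prod_mul_of_bound
    (Y := fun x ω => wickExp γ (mollifiedVariance K θ ε x) (Xε ε x ω)) hAb.measure_lt_top.ne hAm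
    (hXε.aestronglyMeasurable_wickExp hX hK hS hSD hθ hε
      (hS.totallyBounded.subset (Metric.self_subset_cthickening A)) hAm hA hAS γ)
    (fun x hx => (hR x hx).1) (fun x hx => (hR x hx).2)
    (aestronglyMeasurable_mul_restrict hD hϱm hf hAD) (fun x hx => hH x (hAD hx))
  refine h1.integral_prod_right.congr (ae_of_all _ fun ω => ?_)
  refine (complexChaos_eq_setIntegral hA hDm (fun x hx hxA => ?_) γ ω).symm
  exact image_eq_zero_of_notMem_tsupport fun h => hxA ⟨hx, h⟩

end chaos

/-! ### Convergence in mean -/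

theorem eLpNorm_one_eq_ofReal_integral_norm {Ω : Type*} [MeasurableSpace Ω] {P : Measure Ω}
    {g : Ω → ℂ} (hg : Integrable g P) : eLpNorm g 1 P = ENNReal.ofReal (∫ ω, ‖g ω‖ ∂P) := by
  rw [eLpNorm_one_eq_lintegral_enorm, ofReal_integral_norm_eq_lintegral_enorm hg]

/-- Completeness of `L¹`, in terms of functions. -/
theorem exists_tendsto_eLpNorm_one_of_cauchy {Ω : Type*} [MeasurableSpace Ω] {P : Measure Ω}
    {F : ℕ → Ω → ℂ} (hF : ∀ n, Integrable (F n) P)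
    (h : ∀ η : ℝ, 0 < η → ∃ N, ∀ m ≥ N, ∀ n ≥ N, ∫ ω, ‖F m ω - F n ω‖ ∂P ≤ η) :
    ∃ M₀ : Ω → ℂ, MemLp M₀ 1 P ∧ Tendsto (fun n => eLpNorm (F n - M₀) 1 P) atTop (𝓝 0) := by
  have hm := fun n => memLp_one_iff_integrable.2 (hF n)
  have hc : CauchySeq fun n => (hm n).toLp (F n) := by
    rw [Metric.cauchySeq_iff]
    intro η hη
    obtain ⟨N, hN⟩ := h (η / 2) (half_pos hη)
    refine ⟨N, fun m hmN n hnN => ?_⟩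
    rw [dist_edist, Lp.edist_toLp_toLp,
      eLpNorm_one_eq_ofReal_integral_norm ((hF m).sub (hF n)),
      ENNReal.toReal_ofReal (integral_nonneg fun _ => norm_nonneg _)]
    exact (hN m hmN n hnN).trans_lt (half_lt_self hη)
  obtain ⟨g, hg⟩ := cauchySeq_tendsto_of_complete hc
  refine ⟨g, Lp.memLp g, ?_⟩
  rw [tendsto_iff_edist_tendsto_0] at hg
  refine hg.congr fun n => ?_
  rw [Lp.edist_def]
  exact eLpNorm_congr_ae ((hm n).coeFn_toLp.sub ae_eq_rfl)

section chaos

variable {d : ℕ}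

local notation "𝔼" => EuclideanSpace ℝ (Fin d)

variable {D : Set (EuclideanSpace ℝ (Fin d))}
  {K : EuclideanSpace ℝ (Fin d) → EuclideanSpace ℝ (Fin d) → ℝ}
  {Q : ℕ → EuclideanSpace ℝ (Fin d) → EuclideanSpace ℝ (Fin d) → ℝ}
  {S A : Set (EuclideanSpace ℝ (Fin d))} {θ : EuclideanSpace ℝ (Fin d) → ℝ} {ε : ℝ}
  {Ω : Type*} {f ϱ : EuclideanSpace ℝ (Fin d) → ℝ}
  {X : SignedMeasure (EuclideanSpace ℝ (Fin d)) → Ω → ℝ}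
  {Xε : ℝ → EuclideanSpace ℝ (Fin d) → Ω → ℝ}
  [MeasurableSpace Ω] {P : Measure Ω} [IsProbabilityMeasure P]

/-- At a fixed scale the mollified chaos is the `L¹` limit of its discretisations. -/
theorem IsMollifiedField.exists_integral_norm_sub_chaosSum_le [NeZero d]
    (hXε : IsMollifiedField P D X θ Xε)
    (hX : IsGaussianFieldWithKernel P D K X) (hK : HasNiceDecomposition D K Q) (hD : IsOpen D)
    (hS : IsCompact S) (hSD : S ⊆ D) (hθ : IsSmoothingKernel θ) (hε : ε ∈ Ioc (0 : ℝ) 1)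
    (hϱm : Measurable fun x : D => ϱ x) (hϱ : ∃ B : ℝ, ∀ x ∈ D, |ϱ x| ≤ B)
    (hf : Continuous f) (hfs : HasCompactSupport f) (hfε : tsupport f ⊆ shrunkDomain D ε)
    (hfS : ∀ x ∈ tsupport f, Metric.closedBall x ε ⊆ S) (γ : ℂ) {η : ℝ} (hη : 0 < η) :
    ∃ δ : ℝ, 0 < δ ∧ ∀ {N : ℕ} {e : Fin N → 𝔼} {π : 𝔼 → Fin N}, Measurable π →
      (∀ i, e i ∈ tsupport f) → (∀ x ∈ tsupport f, dist x (e (π x)) ≤ δ) →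
      ∫ ω, ‖complexChaos D K θ Xε ϱ f γ ε ω - chaosSum γ
        (fun i => ∫ x in tsupport f ∩ π ⁻¹' {i}, (f x : ℂ) * (ϱ x : ℂ))
        (fun i => mollifiedVariance K θ ε (e i)) (fun i => Xε ε (e i) ω)‖ ∂P ≤ η := by
  have hfD : tsupport f ⊆ D := fun x hx => (hfε hx).1
  have hAm : MeasurableSet (tsupport f) := (isClosed_tsupport f).measurableSet
  have hc : IsCompact (tsupport f) := hfs
  obtain ⟨R, hR⟩ := hXε.integrable_wickExp hX hK hS hSD hθ hε hfε hfS γ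
  obtain ⟨H, hH0, hH⟩ := exists_norm_mul_le hϱ hf hfs
  set V := volume.real (tsupport f)
  have hV : 0 ≤ V := measureReal_nonneg
  obtain ⟨δ, hδ, h1⟩ := hXε.exists_integral_norm_wickExp_sub_le hX hK hS hSD hθ hε hfε hfS γ
    (η := η / (H * V + 1)) (by positivity)
  refine ⟨δ, hδ, fun {N e π} hπ he hd => ?_⟩
  have h2 := integral_norm_setIntegral_sub_sum_le
    (Y := fun x ω => wickExp γ (mollifiedVariance K θ ε x) (Xε ε x ω)) hc.measure_lt_top.ne hAm
    (hXε.aestronglyMeasurable_wickExp hX hK hS hSD hθ hε hc.totallyBounded hAm hfε hfS γ)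
    (fun x hx => (hR x hx).1) (fun x hx => (hR x hx).2)
    (aestronglyMeasurable_mul_restrict hD hϱm hf hfD) (fun x hx => hH x (hfD hx)) hπ he
    (fun x hx => h1 x hx _ (he _) (hd x hx))
  have h3 : η / (H * V + 1) * H * V ≤ η := by
    have e : η / (H * V + 1) * H * V = η * (H * V / (H * V + 1)) := by
      field_simp
    rw [e]
    refine mul_le_of_le_one_right hη.le ?_
    rw [div_le_one (by positivity)]
    linarith
  refine le_trans (le_of_eq ?_) (h2.trans h3)
  refine integral_congr_ae (ae_of_all _ fun ω => ?_)
  simp only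
  rw [complexChaos_eq_setIntegral hfε (measurableSet_shrunkDomain hD hε.1.le)
    (fun x _ hxA => image_eq_zero_of_notMem_tsupport hxA) γ ω]
  rfl

/-- The mollified chaoses form a Cauchy family in `L¹`, uniformly over the smoothing kernels
bounded by a given constant. -/
theorem HasNiceDecomposition.exists_integral_norm_complexChaos_sub_le [NeZero d]
    (hK : HasNiceDecomposition D K Q) (hX : IsGaussianFieldWithKernel P D K X) (hD : IsOpen D)
    (hϱm : Measurable fun x : D => ϱ x) (hϱ : ∃ B : ℝ, ∀ x ∈ D, |ϱ x| ≤ B)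
    (hf : Continuous f) (hfs : HasCompactSupport f) (hfD : tsupport f ⊆ D)
    {α β : ℝ} (hαβ : (α, β) ∈ subcriticalRegion d) {M : ℝ} (hM : 0 ≤ M) {η : ℝ} (hη : 0 < η) :
    ∃ ε₁ : ℝ, 0 < ε₁ ∧ ∀ {θ θ' : 𝔼 → ℝ} {Xε Xε' : ℝ → 𝔼 → Ω → ℝ},
      IsSmoothingKernel θ → IsSmoothingKernel θ' → (∀ z, θ z ≤ M) → (∀ z, θ' z ≤ M) →
      IsMollifiedField P D X θ Xε → IsMollifiedField P D X θ' Xε' →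
      ∀ {ε ε' : ℝ}, 0 < ε → 0 < ε' → ε ≤ ε₁ → ε' ≤ ε₁ →
      ∫ ω, ‖complexChaos D K θ Xε ϱ f (α + β * Complex.I) ε ω -
        complexChaos D K θ' Xε' ϱ f (α + β * Complex.I) ε' ω‖ ∂P ≤ η := by
  have hc : IsCompact (tsupport f) := hfs
  have hAm : MeasurableSet (tsupport f) := (isClosed_tsupport f).measurableSet
  obtain ⟨ε₀, hε₀, hε₀1, hsub⟩ := exists_subset_shrunkDomain hD hc hfD
  have hS := isCompact_cthickening_of_isBounded hc.isBounded ε₀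
  have hSD := cthickening_subset_of_subset_shrunkDomain hε₀ (hsub ε₀ le_rfl)
  set S := Metric.cthickening ε₀ (tsupport f) with hSdef
  have hAS : ∀ ε ≤ ε₀, ∀ x ∈ tsupport f, Metric.closedBall x ε ⊆ S := fun ε hε x hx =>
    (Metric.closedBall_subset_closedBall hε).trans (Metric.closedBall_subset_cthickening hx ε₀)
  obtain ⟨H, hH0, hH⟩ := exists_norm_mul_le hϱ hf hfs
  set γ : ℂ := α + β * Complex.I with hγ
  set v := volume.real (Metric.ball (0 : 𝔼) 1) with hv
  have hv0 : 0 ≤ v := measureReal_nonneg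
  set B₁ := H * (2 ^ d * v) + H * volume.real (tsupport f) with hB₁
  have hB₁0 : 0 ≤ B₁ := by positivity
  obtain ⟨ε₁, hε₁, h1⟩ := hK.exists_chaosSum_sub_le hS hSD hαβ hγ hM hB₁0
    (η := η / 3) (by positivity)
  refine ⟨min ε₁ ε₀, by positivity, ?_⟩
  intro θ θ' Xε Xε' hθ hθ' hθM hθM' hXε hXε' ε ε' hε0 hε0' hε hε'
  have hεmem : ε ∈ Ioc (0 : ℝ) 1 := ⟨hε0, (hε.trans (min_le_right _ _)).trans hε₀1⟩
  have hεmem' : ε' ∈ Ioc (0 : ℝ) 1 := ⟨hε0', (hε'.trans (min_le_right _ _)).trans hε₀1⟩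
  have hfε := hsub ε (hε.trans (min_le_right _ _))
  have hfε' := hsub ε' (hε'.trans (min_le_right _ _))
  have hfS := hAS ε (hε.trans (min_le_right _ _))
  have hfS' := hAS ε' (hε'.trans (min_le_right _ _))
  rcases (tsupport f).eq_empty_or_nonempty with hemp | hne
  · have hz : ∀ x, f x = 0 := fun x => image_eq_zero_of_notMem_tsupport (by simp [hemp])
    simp [complexChaos, hz, hη.le]
  obtain ⟨δ, hδ, h2⟩ := hXε.exists_integral_norm_sub_chaosSum_le hX hK hD hS hSD hθ hεmem hϱm hϱ
    hf hfs hfε hfS γ (η := η / 3) (by positivity)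
  obtain ⟨δ', hδ', h2'⟩ := hXε'.exists_integral_norm_sub_chaosSum_le hX hK hD hS hSD hθ' hεmem'
    hϱm hϱ hf hfs hfε' hfS' γ (η := η / 3) (by positivity)
  -- a mesh finer than both scales, so that the discrete weights of balls of radius at least
  -- `min ε ε'` are controlled by their volume
  obtain ⟨N, e, π, hπ, he, hd⟩ := exists_measurable_finite_net hc.totallyBounded hne
    (δ := min (min δ δ') (min ε ε')) (by positivity)
  have h3 := h2 hπ he fun x hx => (hd x hx).trans ((min_le_left _ _).trans (min_le_left _ _))
  have h3' := h2' hπ he fun x hx => (hd x hx).trans ((min_le_left _ _).trans (min_le_right _ _))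
  set w : Fin N → ℂ := fun i => ∫ x in tsupport f ∩ π ⁻¹' {i}, (f x : ℂ) * (ϱ x : ℂ) with hw
  obtain ⟨hw1, hw2⟩ := sum_norm_setIntegral_le (e := e) hAm hc.measure_lt_top.ne hH0
    (fun x hx => hH x (hfD hx)) hπ
  have hmol := fun i => hθ.isMollifierAt hθM hε0 (e i)
  have hmol' := fun i => hθ'.isMollifierAt hθM' hε0' (e i)
  have hzero := fun i => hθ.scaledKernel_eq_zero hε0 hfS (he i)
  have hzero' := fun i => hθ'.scaledKernel_eq_zero hε0' hfS' (he i)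
  have hvec : IsCenteredGaussianVec P
      (fun a b => symForm K
        (Sum.elim (fun i z => scaledKernel θ ε (e i - z))
          (fun i z => scaledKernel θ' ε' (e i - z)) a)
        (Sum.elim (fun i z => scaledKernel θ ε (e i - z))
          (fun i z => scaledKernel θ' ε' (e i - z)) b))
      (fun ω => Sum.elim (fun i => Xε ε (e i) ω) (fun i => Xε' ε' (e i) ω)) := by
    refine hX.isCenteredGaussianVec hK hS hSD (x := Sum.elim e e)
      (ε := Sum.elim (fun _ => ε) (fun _ => ε')) (M := fun _ => M) ?_ ?_ ?_
    · rintro (i | i)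
      · exact hmol i
      · exact hmol' i
    · rintro (i | i)
      · exact hzero i
      · exact hzero' i
    · rintro (i | i)
      · exact hXε.version ε hεmem _ (hfε (he i))
      · exact hXε'.version ε' hεmem' _ (hfε' (he i))
  have h4 := h1 e _ _ w hε0 hε0' (hε.trans (min_le_left _ _)) (hε'.trans (min_le_left _ _))
    (fun i => Metric.self_subset_cthickening _ (he i)) hmol hmol' hzero hzero'
    (fun z r hr => by
      have hr0 : 0 ≤ r := (le_min hε0.le hε0'.le).trans hr
      refine (hw2 r hr0 (fun x hx => (hd x hx).trans ((min_le_right _ _).trans hr)) z).trans ?_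
      rw [hB₁, add_mul, mul_pow]
      have : 0 ≤ H * volume.real (tsupport f) * r ^ d := by positivity
      linarith)
    (hw1.trans (by rw [hB₁]; linarith [mul_nonneg hH0 (mul_nonneg (pow_nonneg
      (zero_le_two (α := ℝ)) d) hv0)])) hvec
  simp only [← mollifiedVariance_eq_symForm, Sum.elim_inl, Sum.elim_inr] at h4
  set a := complexChaos D K θ Xε ϱ f γ ε
  set b := complexChaos D K θ' Xε' ϱ f γ ε'
  set a' : Ω → ℂ := fun ω => chaosSum γ w (fun i => mollifiedVariance K θ ε (e i))
    (fun i => Xε ε (e i) ω)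
  set b' : Ω → ℂ := fun ω => chaosSum γ w (fun i => mollifiedVariance K θ' ε' (e i))
    (fun i => Xε' ε' (e i) ω)
  have hai : Integrable a P := hXε.integrable_complexChaos hX hK hD hθ hεmem hϱm hϱ hf hfs γ
  have hbi : Integrable b P := hXε'.integrable_complexChaos hX hK hD hθ' hεmem' hϱm hϱ hf hfs γ
  have hai' : Integrable a' P := (hvec.comp Sum.inl).integrable_chaosSum γ w _
  have hbi' : Integrable b' P := (hvec.comp Sum.inr).integrable_chaosSum γ w _
  have j1 : Integrable (fun ω => ‖a ω - a' ω‖) P := (hai.sub hai').norm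
  have j2 : Integrable (fun ω => ‖a' ω - b' ω‖) P := (hai'.sub hbi').norm
  have j3 : Integrable (fun ω => ‖b ω - b' ω‖) P := (hbi.sub hbi').norm
  have j12 : Integrable (fun ω => ‖a ω - a' ω‖ + ‖a' ω - b' ω‖) P := j1.add j2
  have j123 : Integrable (fun ω => ‖a ω - a' ω‖ + ‖a' ω - b' ω‖ + ‖b ω - b' ω‖) P := j12.add j3
  calc ∫ ω, ‖a ω - b ω‖ ∂P
      ≤ ∫ ω, (‖a ω - a' ω‖ + ‖a' ω - b' ω‖ + ‖b ω - b' ω‖) ∂P := by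
        refine integral_mono (hai.sub hbi).norm j123 fun ω => ?_
        have e1 : a ω - b ω = (a ω - a' ω) + (a' ω - b' ω) - (b ω - b' ω) := by ring
        simp only
        rw [e1]
        exact (norm_sub_le _ _).trans (add_le_add (norm_add_le _ _) le_rfl)
    _ = ∫ ω, ‖a ω - a' ω‖ ∂P + ∫ ω, ‖a' ω - b' ω‖ ∂P + ∫ ω, ‖b ω - b' ω‖ ∂P := by
        rw [integral_add j12 j3, integral_add j1 j2]
    _ ≤ η := by linarith

end chaos

theorem neZero_of_mem_subcriticalRegion {d : ℕ} {p : ℝ × ℝ} (h : p ∈ subcriticalRegion d) :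
    NeZero d := by
  refine ⟨?_⟩
  rintro rfl
  rcases h with h | ⟨h, -⟩
  · have : p.1 ^ 2 + p.2 ^ 2 < 0 := by simpa using h
    nlinarith [sq_nonneg p.1, sq_nonneg p.2]
  · simp at h

theorem mainTheorem3 {d : ℕ} {Ω : Type*} [MeasurableSpace Ω] (P : Measure Ω)
    [IsProbabilityMeasure P]
    (D : Set (EuclideanSpace ℝ (Fin d))) (hD : IsOpen D)
    (K : EuclideanSpace ℝ (Fin d) → EuclideanSpace ℝ (Fin d) → ℝ)
    (Q : ℕ → EuclideanSpace ℝ (Fin d) → EuclideanSpace ℝ (Fin d) → ℝ)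
    (hK : HasNiceDecomposition D K Q)
    (X : SignedMeasure (EuclideanSpace ℝ (Fin d)) → Ω → ℝ)
    (hX : IsGaussianFieldWithKernel P D K X)
    (ϱ : EuclideanSpace ℝ (Fin d) → ℝ) (hϱ_meas : Measurable fun x : D => ϱ x)
    (hϱ_bdd : ∃ B : ℝ, ∀ x ∈ D, |ϱ x| ≤ B)
    (α β : ℝ) (hαβ : (α, β) ∈ subcriticalRegion d)
    (f : EuclideanSpace ℝ (Fin d) → ℝ) (hf : Continuous f) (hf_supp : HasCompactSupport f)
    (hfD : tsupport f ⊆ D) :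
    ∃ M₀ : Ω → ℂ, MemLp M₀ 1 P ∧
      ∀ θ : EuclideanSpace ℝ (Fin d) → ℝ, IsSmoothingKernel θ →
        ∀ Xε : ℝ → EuclideanSpace ℝ (Fin d) → Ω → ℝ, IsMollifiedField P D X θ Xε →
          (∀ ε ∈ Ioc (0 : ℝ) 1,
            MemLp (complexChaos D K θ Xε ϱ f (α + β * Complex.I) ε) 1 P) ∧
          TendstoInMeasure P (fun ε : ℝ => complexChaos D K θ Xε ϱ f (α + β * Complex.I) ε)
            (𝓝[>] 0) M₀ ∧
          Tendsto (fun ε : ℝ =>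
              eLpNorm (complexChaos D K θ Xε ϱ f (α + β * Complex.I) ε - M₀) 1 P)
            (𝓝[>] 0) (𝓝 0) := by
  have hd := neZero_of_mem_subcriticalRegion hαβ
  have hint : ∀ {θ : EuclideanSpace ℝ (Fin d) → ℝ} {Xε : ℝ → EuclideanSpace ℝ (Fin d) → Ω → ℝ},
      IsSmoothingKernel θ → IsMollifiedField P D X θ Xε → ∀ ε ∈ Ioc (0 : ℝ) 1,
      Integrable (complexChaos D K θ Xε ϱ f (α + β * Complex.I) ε) P := fun hθ hXε ε hε =>
    hXε.integrable_complexChaos hX hK hD hθ hε hϱ_meas hϱ_bdd hf hf_supp _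
  -- the limit is constructed from one smoothing kernel, if there is any mollified field at all
  by_cases hex : ∃ (θ : EuclideanSpace ℝ (Fin d) → ℝ)
      (Xε : ℝ → EuclideanSpace ℝ (Fin d) → Ω → ℝ), IsSmoothingKernel θ ∧
        IsMollifiedField P D X θ Xε
  swap
  · exact ⟨0, MemLp.zero', fun θ hθ Xε hXε => absurd ⟨θ, Xε, hθ, hXε⟩ hex⟩
  obtain ⟨θ₀, X₀, hθ₀, hX₀⟩ := hex
  obtain ⟨m₀, hm₀, hm₀'⟩ := hθ₀.exists_le
  have hs : ∀ n : ℕ, 1 / ((n : ℝ) + 1) ∈ Ioc (0 : ℝ) 1 := fun n =>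
    ⟨by positivity, by
      rw [div_le_one (by positivity)]
      linarith [Nat.cast_nonneg (α := ℝ) n]⟩
  have hs0 : ∀ ε₁ : ℝ, 0 < ε₁ → ∀ᶠ n : ℕ in atTop, 1 / ((n : ℝ) + 1) ≤ ε₁ := fun ε₁ hε₁ =>
    (tendsto_one_div_add_atTop_nhds_zero_nat.eventually_lt_const hε₁).mono fun _ h => h.le
  obtain ⟨M₀, hM₀, hlim⟩ := exists_tendsto_eLpNorm_one_of_cauchy
    (F := fun n : ℕ => complexChaos D K θ₀ X₀ ϱ f (α + β * Complex.I) (1 / ((n : ℝ) + 1)))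
    (P := P) (fun n => hint hθ₀ hX₀ _ (hs n)) (fun η hη => by
      obtain ⟨ε₁, hε₁, h⟩ := hK.exists_integral_norm_complexChaos_sub_le hX hD hϱ_meas hϱ_bdd hf
        hf_supp hfD hαβ hm₀ hη
      obtain ⟨N, hN⟩ := eventually_atTop.1 (hs0 ε₁ hε₁)
      exact ⟨N, fun m hm n hn => h hθ₀ hθ₀ hm₀' hm₀' hX₀ hX₀ (hs m).1 (hs n).1 (hN m hm)
        (hN n hn)⟩)
  refine ⟨M₀, hM₀, fun θ hθ Xε hXε => ?_⟩
  have hmem : ∀ ε ∈ Ioc (0 : ℝ) 1,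
      MemLp (complexChaos D K θ Xε ϱ f (α + β * Complex.I) ε) 1 P := fun ε hε =>
    memLp_one_iff_integrable.2 (hint hθ hXε ε hε)
  have hL1 : Tendsto (fun ε : ℝ =>
      eLpNorm (complexChaos D K θ Xε ϱ f (α + β * Complex.I) ε - M₀) 1 P) (𝓝[>] 0) (𝓝 0) := by
    obtain ⟨m, hm, hm'⟩ := hθ.exists_le
    rw [ENNReal.tendsto_nhds_zero]
    intro η hη
    obtain ⟨η', hη'0, hη'⟩ : ∃ η' : ℝ, 0 < η' ∧ ENNReal.ofReal η' + ENNReal.ofReal η' ≤ η := by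
      rcases eq_or_ne η ∞ with rfl | hne
      · exact ⟨1, one_pos, le_top⟩
      · have hpos := ENNReal.toReal_pos hη.ne' hne
        refine ⟨η.toReal / 2, half_pos hpos, ?_⟩
        rw [← ENNReal.ofReal_add (half_pos hpos).le (half_pos hpos).le, add_halves,
          ENNReal.ofReal_toReal hne]
    obtain ⟨ε₁, hε₁, h⟩ := hK.exists_integral_norm_complexChaos_sub_le hX hD hϱ_meas hϱ_bdd hf
      hf_supp hfD hαβ (hm.trans (le_max_left m m₀)) hη'0
    obtain ⟨n, hn, hn'⟩ := ((hs0 ε₁ hε₁).and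
      ((ENNReal.tendsto_nhds_zero.1 hlim) _ (ENNReal.ofReal_pos.2 hη'0))).exists
    have hev : ∀ᶠ ε : ℝ in 𝓝[>] 0, 0 < ε ∧ ε ≤ min ε₁ 1 :=
      Ioc_mem_nhdsGT (by positivity)
    filter_upwards [hev] with ε hε
    have i1 := hint hθ hXε ε ⟨hε.1, hε.2.trans (min_le_right _ _)⟩
    have i2 := hint hθ₀ hX₀ _ (hs n)
    have h1 := h hθ hθ₀ (fun z => (hm' z).trans (le_max_left _ _))
      (fun z => (hm₀' z).trans (le_max_right _ _)) hXε hX₀ hε.1 (hs n).1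
      (hε.2.trans (min_le_left _ _)) hn
    refine le_trans ?_ hη'
    rw [← sub_add_sub_cancel _ (complexChaos D K θ₀ X₀ ϱ f (α + β * Complex.I)
      (1 / ((n : ℝ) + 1))) M₀]
    refine (eLpNorm_add_le (i1.sub i2).aestronglyMeasurable
      (i2.aestronglyMeasurable.sub hM₀.aestronglyMeasurable) le_rfl).trans (add_le_add ?_ hn')
    rw [eLpNorm_one_eq_ofReal_integral_norm (i1.sub i2)]
    exact ENNReal.ofReal_le_ofReal h1
  refine ⟨hmem, ?_, hL1⟩
  -- scales outside `(0, 1]`, where measurability is not available, do not affect the limit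
  have hmem0 : ∀ᶠ ε : ℝ in 𝓝[>] 0, ε ∈ Ioc (0 : ℝ) 1 := Ioc_mem_nhdsGT one_pos
  classical
  have h1 : TendstoInMeasure P (fun ε : ℝ => if ε ∈ Ioc (0 : ℝ) 1 then
      complexChaos D K θ Xε ϱ f (α + β * Complex.I) ε else 0) (𝓝[>] 0) M₀ := by
    refine tendstoInMeasure_of_tendsto_eLpNorm one_ne_zero (fun ε => ?_)
      hM₀.aestronglyMeasurable (hL1.congr' (hmem0.mono fun ε hε => by simp only [if_pos hε]))
    split_ifs with hε
    · exact (hmem ε hε).aestronglyMeasurable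
    · exact aestronglyMeasurable_zero
  exact fun δ hδ => (h1 δ hδ).congr' (hmem0.mono fun ε hε => by simp only [if_pos hε])
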